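/- Let $N\ge 1$ and let $\Omega\subset\mathbb R^N$ be a bounded domain with boundary $\Gamma=\partial\Omega$ of class $C^\infty$ and outward unit normal $n$. For $\delta>0$ put $\Gamma(\delta)=\{x\in\mathbb R^N : \operatorname{dist}(x,\Gamma)\le\delta\}$. Then there is $\delta_0>0$ such that every $x\in\Gamma(\delta_0)$ has a unique representation $x=\bar x+t\,n(\bar x)$ with $\bar x\in\Gamma$ and $t\in[-\delta_0,\delta_0]$, and such that the following holds. For a function $f$ on $\Omega$ define $Pf=f$ in $\Omega\setminus\Gamma(\delta_0)$ and $$ Pf(\bar x+t\,n(\bar x))=\begin{cases} f(\bar x+t\,n(\bar x)) & (-\delta_0\le t<0),\\ 3f(\bar x-t\,n(\bar x))-2f(\bar x-2t\,n(\bar x)) & (0\le t\le\delta_0),\end{cases}\qquad \bar x\in\Gamma $$ (on the null set $\Gamma$ the values of $f$ are immaterial). For all $k\in\{0,1,2\}$ and $p\in[1,\infty]$ there is a constant $C$ such that for all $0<\delta\le\delta_0$ and all real-valued $f\in W^{k,p}(\Omega)$ one has $Pf\in W^{k,p}(\Gamma(\delta))$ and $$ \|Pf\|_{W^{k,p}(\Gamma(\delta))}\le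 C\,\|f\|_{W^{k,p}(\Omega\cap\Gamma(2\delta))}. $$ In particular, $C$ is independent of $\delta$ and $f$. Here $W^{k,p}(D)$ for the layers $D=\Gamma(\delta)$ and $D=\Omega\cap\Gamma(2\delta)$ means $W^{k,p}$ of the interior of $D$, with norm the sum of the $L^p$-norms of all weak partial derivatives of order at most $k$. -/

import Mathlib

open MeasureTheory Filter Topology Set
open scoped ContDiff ENNReal NNReal

/-- The Euclidean space `ℝ^N`. -/
abbrev RN (N : ℕ) : Type := EuclideanSpace ℝ (Fin N)

/-! ### Smooth bounded domains, the outward unit normal, tubular layers -/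

/-- `Ω ⊆ ℝ^N` is a bounded domain (open, connected, non-empty) with boundary of class `C^∞`:
near every boundary point, after a rotation that makes the unit vector `e` the last coordinate
direction, `Ω` is the part strictly below the graph of a `C^∞` function `φ` of the remaining
coordinates. (Here `y - ⟪e, y⟫ e` is the orthogonal projection of `y` to the hyperplane `e^⊥`, so
only the restriction of `φ` to this hyperplane matters.) -/
structure IsSmoothBoundedDomain {N : ℕ} (Ω : Set (RN N)) : Prop where
  isOpen : IsOpen Ω
  isConnected : IsConnected Ω
  isBounded : Bornology.IsBounded Ω
  exists_graph : ∀ x ∈ frontier Ω, ∃ (r : ℝ) (e : RN N) (φ : RN N → ℝ),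
    0 < r ∧ ‖e‖ = 1 ∧ ContDiff ℝ ∞ φ ∧
    ∀ y ∈ Metric.ball x r, (y ∈ Ω ↔ inner ℝ e y < φ (y - inner ℝ e y • e))

/-- `ν` is the outward unit normal to `∂Ω` at `x`: it has length one, every direction that makes an
obtuse angle with `ν` points from `x` into `Ω`, and every direction that makes an acute angle with
`ν` points from `x` to the exterior of `Ω`. -/
def IsOutwardUnitNormal {N : ℕ} (Ω : Set (RN N)) (x ν : RN N) : Prop :=
  ‖ν‖ = 1 ∧
  (∀ v : RN N, inner ℝ ν v < 0 → ∀ᶠ s : ℝ in 𝓝[>] 0, x + s • v ∈ Ω) ∧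
  (∀ v : RN N, 0 < inner ℝ ν v → ∀ᶠ s : ℝ in 𝓝[>] 0, x + s • v ∉ closure Ω)

open Classical in
/-- The outward unit normal field `n` of `∂Ω` (with the value `0` at points that have none; there
are no such points on the boundary of a smooth domain). -/
noncomputable def outwardNormal {N : ℕ} (Ω : Set (RN N)) (x : RN N) : RN N :=
  if h : ∃ ν, IsOutwardUnitNormal Ω x ν then h.choose else 0

/-- The tubular layer `Γ(δ) = {x : dist(x, Γ) ≤ δ}` around `Γ = ∂Ω`. -/
def tube {N : ℕ} (Ω : Set (RN N)) (δ : ℝ) : Set (RN N) :=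
  {x | Metric.infDist x (frontier Ω) ≤ δ}

/-- `q = (x̄, t)` is a pair of normal coordinates of `x`: `x̄ ∈ Γ`, `t ∈ [-δ₀, δ₀]` and
`x = x̄ + t n(x̄)`. -/
def IsNormalCoord {N : ℕ} (Ω : Set (RN N)) (δ₀ : ℝ) (x : RN N) (q : RN N × ℝ) : Prop :=
  q.1 ∈ frontier Ω ∧ q.2 ∈ Icc (-δ₀) δ₀ ∧ x = q.1 + q.2 • outwardNormal Ω q.1

open Classical in
/-- The reflection-type extension `P f`: at a point `x = x̄ + t n(x̄)` with `x̄ ∈ Γ` and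
`t ∈ [-δ₀, δ₀]` it is `f x` if `t < 0` and `3 f(x̄ - t n(x̄)) - 2 f(x̄ - 2 t n(x̄))` if `0 ≤ t`;
at all other points it is `f x`. -/
noncomputable def reflectionExt {N : ℕ} (Ω : Set (RN N)) (δ₀ : ℝ) (f : RN N → ℝ) (x : RN N) : ℝ :=
  if h : ∃ q : RN N × ℝ, IsNormalCoord Ω δ₀ x q then
    if h.choose.2 < 0 then f x
    else 3 * f (h.choose.1 - h.choose.2 • outwardNormal Ω h.choose.1)
      - 2 * f (h.choose.1 - (2 * h.choose.2) • outwardNormal Ω h.choose.1)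
  else f x

/-! ### Sobolev spaces on open sets -/

/-- `g` is the weak derivative `∂_{I 0} ⋯ ∂_{I (m-1)} f` of order `m` on the open set `U`: both
functions are locally integrable on `U`, and
`∫_U f ∂_{I 0} ⋯ ∂_{I (m-1)} φ = (-1)^m ∫_U g φ` for every test function `φ ∈ C_c^∞(U)`. -/
def HasWeakDeriv {N m : ℕ} (U : Set (RN N)) (I : Fin m → Fin N) (f g : RN N → ℝ) : Prop :=
  LocallyIntegrableOn f U volume ∧ LocallyIntegrableOn g U volume ∧
  ∀ φ : RN N → ℝ, ContDiff ℝ ∞ φ → HasCompactSupport φ → tsupport φ ⊆ U →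
    ∫ x in U, f x * iteratedFDeriv ℝ m φ x (fun j => EuclideanSpace.single (I j) (1 : ℝ))
      = (-1) ^ m * ∫ x in U, g x * φ x

/-- `f ∈ W^{k,p}(U)`: `f` has weak derivatives in `L^p(U)` of all orders `m ≤ k`
(order `0` being `f` itself). -/
def MemSobolev {N : ℕ} (U : Set (RN N)) (k : ℕ) (p : ℝ≥0∞) (f : RN N → ℝ) : Prop :=
  MemLp f p (volume.restrict U) ∧
  ∀ m ≤ k, ∀ I : Fin m → Fin N, ∃ g, HasWeakDeriv U I f g ∧ MemLp g p (volume.restrict U)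

/-- The Sobolev norm `‖f‖_{W^{k,p}(U)} = ∑_{m ≤ k} ∑_{i₁,…,i_m} ‖∂_{i₁} ⋯ ∂_{i_m} f‖_{L^p(U)}`.
Weak derivatives are unique almost everywhere, so the infimum runs over representatives of one
`L^p`-class; it is `∞` if the weak derivative does not exist. -/
noncomputable def sobolevNorm {N : ℕ} (U : Set (RN N)) (k : ℕ) (p : ℝ≥0∞) (f : RN N → ℝ) : ℝ≥0∞ :=
  ∑ m ∈ Finset.range (k + 1), ∑ I : Fin m → Fin N,
    ⨅ (g : RN N → ℝ) (_ : HasWeakDeriv U I f g), eLpNorm g p (volume.restrict U)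

/-! ### The outward unit normal and local defining functions -/

section Geometry

variable {N : ℕ} {Ω : Set (RN N)}

/-! Geometry. Near `Γ = frontier Ω` the domain is a sublevel set of a smooth `ρ` without critical
points, so the outward normal is the normalised gradient of `ρ`. Taylor's formula and compactness
give `|⟪n x, y - x⟫| ≤ C ‖y - x‖ ^ 2` on `Γ`. Hence points on short normals have their foot as the
only nearest boundary point, and normal coordinates are unique; the inverse function theorem makes
them smooth (`exists_isTubularChart`).

Reflections. With `τ x = t x • n x` the maps in the definition of `P` are the dilations `x + (a - 1)
• τ x` of the normal variable for `a = -1` and `a = -2`. They carry the outer layer of width `δ`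
diffeomorphically onto the inner layers of width `δ` and `2 * δ`. Their Jacobians are controlled on
one fixed layer, which makes every constant independent of `δ`.

First derivatives. Take a function equal to `c f` inside and to `A (f ∘ R₁) + B (f ∘ R₂)` outside,
where `R₁`, `R₂` are the two reflections and `A`, `B` are smooth. The expected derivative is the
weak one as soon as `A + B = c` on `Γ` (`hasWeakDeriv_glue`). The proof uses neither traces nor
density of smooth functions. A change of variables moves the outer integrals into `Ω`, where the
test field `ψ eᵢ` becomes its Piola transform. The normal component of this transform on `Γ` is `-ψ
nᵢ`, whatever the dilation factor. The total field `c φ eᵢ + P1 + P2` therefore has normal component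
`(c - A - B) φ nᵢ = 0`. For tangential fields integration by parts on `Ω` has no boundary term
(`integral_mul_div`): a cutoff in the signed distance costs only a bounded divergence.

Second derivatives. The first derivatives of `P f` are sums of functions glued from the `∂ⱼ f`, with
coefficients `3 ∂ᵢ(R₁)ⱼ` and `-2 ∂ᵢ(R₂)ⱼ`. On `Γ` one has `D R₁ = 1 - 2 n ⊗ n` and `D R₂ = 1 - 3 n ⊗
n`, hence `3 D R₁ - 2 D R₂ = 1` (`reflection_coeff`), and the gluing lemma applies once more. The
norm bounds follow from the explicit formulas and the change of variables. -/

theorem IsOutwardUnitNormal.unique {x ν ν' : RN N} (h : IsOutwardUnitNormal Ω x ν)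
    (h' : IsOutwardUnitNormal Ω x ν') : ν = ν' := by
  by_contra hne
  have hlt : inner ℝ ν ν' < 1 := by
    rw [inner_lt_one_iff_real_of_norm_eq_one h.1 h'.1]
    exact hne
  -- The direction `ν' - ν` would point into `Ω` according to `ν` and out of its closure according
  -- to `ν'`.
  have h1 : inner ℝ ν (ν' - ν) < 0 := by
    rw [inner_sub_right, real_inner_self_eq_norm_sq, h.1]; linarith
  have h2 : 0 < inner ℝ ν' (ν' - ν) := by
    rw [inner_sub_right, real_inner_self_eq_norm_sq, h'.1, real_inner_comm]; linarith
  obtain ⟨s, hs1, hs2⟩ := ((h.2.1 _ h1).and (h'.2.2 _ h2)).exists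
  exact hs2 (subset_closure hs1)

theorem IsOutwardUnitNormal.outwardNormal_eq {x ν : RN N} (h : IsOutwardUnitNormal Ω x ν) :
    outwardNormal Ω x = ν := by
  have hex : ∃ ν, IsOutwardUnitNormal Ω x ν := ⟨ν, h⟩
  rw [outwardNormal, dif_pos hex]
  exact hex.choose_spec.unique h

/-- The gradient, in coordinates. -/
noncomputable def coordGrad (ρ : RN N → ℝ) (y : RN N) : RN N :=
  WithLp.toLp 2 fun i => fderiv ℝ ρ y (EuclideanSpace.single i 1)

theorem sum_smul_single (v : RN N) : ∑ i, v i • EuclideanSpace.single i (1 : ℝ) = v := by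
  ext j
  simp [Finset.sum_apply, Pi.single_apply]

theorem sum_mul_apply_single (L : RN N →L[ℝ] ℝ) (v : RN N) :
    ∑ i, v i * L (EuclideanSpace.single i 1) = L v := by
  conv_rhs => rw [← sum_smul_single v]
  simp [map_sum]

theorem inner_coordGrad (ρ : RN N → ℝ) (y v : RN N) :
    inner ℝ (coordGrad ρ y) v = fderiv ℝ ρ y v := by
  rw [← sum_mul_apply_single, PiLp.inner_apply]
  simp [coordGrad]

theorem contDiff_coordGrad {ρ : RN N → ℝ} (h : ContDiff ℝ ∞ ρ) : ContDiff ℝ ∞ (coordGrad ρ) := by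
  rw [contDiff_euclidean]
  intro i
  exact (h.fderiv_right (m := ∞) (by simp)).clm_apply contDiff_const

/-- A smooth function without critical points which defines `Ω` in a ball. -/
structure IsLocalDefining (Ω : Set (RN N)) (x₀ : RN N) (r : ℝ) (ρ : RN N → ℝ) : Prop where
  pos : 0 < r
  contDiff : ContDiff ℝ ∞ ρ
  ne_zero : ∀ y, coordGrad ρ y ≠ 0
  mem_iff : ∀ y ∈ Metric.ball x₀ r, (y ∈ Ω ↔ ρ y < 0)
  frontier_iff : ∀ y ∈ Metric.ball x₀ r, (y ∈ frontier Ω ↔ ρ y = 0)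

theorem eventually_line_neg {ρ : RN N → ℝ} {y v : RN N} (hρ : DifferentiableAt ℝ ρ y) (h0 : ρ y = 0)
    (hv : fderiv ℝ ρ y v < 0) : ∀ᶠ s : ℝ in 𝓝[>] 0, ρ (y + s • v) < 0 := by
  have hd : HasDerivAt (fun s : ℝ => ρ (y + s • v)) (fderiv ℝ ρ y v) 0 := by
    have h1 : HasFDerivAt ρ (fderiv ℝ ρ y) (y + (0 : ℝ) • v) := by
      simpa using hρ.hasFDerivAt
    have h2 : HasDerivAt (fun s : ℝ => y + s • v) v 0 := by
      simpa using ((hasDerivAt_id (0 : ℝ)).smul_const v).const_add y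
    exact h1.comp_hasDerivAt (0 : ℝ) h2
  have h := (hasDerivAt_iff_tendsto_slope.1 hd).eventually (Iio_mem_nhds hv)
  have h' := h.filter_mono (nhdsWithin_mono 0 (fun s (hs : s ∈ Ioi (0 : ℝ)) => hs.ne'))
  filter_upwards [h', self_mem_nhdsWithin] with s hs hs0
  simp only [slope, vsub_eq_sub, sub_zero, zero_smul, add_zero, h0, smul_eq_mul] at hs
  have hs0' : (0 : ℝ) < s := hs0
  by_contra hcon
  push Not at hcon
  exact absurd hs (not_lt.2 (mul_nonneg (inv_nonneg.2 hs0'.le) hcon))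

theorem eventually_line_mem_ball {x₀ y v : RN N} {r : ℝ} (hy : y ∈ Metric.ball x₀ r) :
    ∀ᶠ s : ℝ in 𝓝[>] 0, y + s • v ∈ Metric.ball x₀ r := by
  have hc : Continuous fun s : ℝ => y + s • v := by fun_prop
  have : Tendsto (fun s : ℝ => y + s • v) (𝓝 0) (𝓝 y) := by
    simpa using hc.tendsto 0
  exact (this.eventually (Metric.isOpen_ball.mem_nhds hy)).filter_mono nhdsWithin_le_nhds

theorem IsLocalDefining.notMem_closure {x₀ : RN N} {r : ℝ} {ρ : RN N → ℝ}
    (h : IsLocalDefining Ω x₀ r ρ) {y : RN N} (hy : y ∈ Metric.ball x₀ r) (hp : 0 < ρ y) :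
    y ∉ closure Ω := by
  intro hcl
  have hfr : y ∈ frontier Ω := by
    rw [frontier]
    refine ⟨hcl, fun hi => ?_⟩
    have := (h.mem_iff y hy).1 (interior_subset hi)
    linarith
  rw [h.frontier_iff y hy] at hfr
  linarith

theorem IsLocalDefining.isOutwardUnitNormal {x₀ : RN N} {r : ℝ} {ρ : RN N → ℝ}
    (h : IsLocalDefining Ω x₀ r ρ) {y : RN N} (hy : y ∈ Metric.ball x₀ r) (hf : y ∈ frontier Ω) :
    IsOutwardUnitNormal Ω y (‖coordGrad ρ y‖⁻¹ • coordGrad ρ y) := by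
  have hn : 0 < ‖coordGrad ρ y‖ := norm_pos_iff.2 (h.ne_zero y)
  have hd : Differentiable ℝ ρ := h.contDiff.differentiable (by simp)
  have h0 : ρ y = 0 := (h.frontier_iff y hy).1 hf
  refine ⟨?_, fun v hv => ?_, fun v hv => ?_⟩
  · rw [norm_smul, norm_inv, norm_norm, inv_mul_cancel₀ hn.ne']
  · rw [inner_smul_left, inner_coordGrad] at hv
    have hv' : fderiv ℝ ρ y v < 0 := by
      by_contra hc
      push Not at hc
      exact absurd hv (not_lt.2 (mul_nonneg (by simp) hc))
    filter_upwards [eventually_line_neg (hd y) h0 hv', eventually_line_mem_ball (v := v) hy]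
      with s hs hb
    exact (h.mem_iff _ hb).2 hs
  · rw [inner_smul_left, inner_coordGrad] at hv
    have hv' : fderiv ℝ (fun z => -ρ z) y v < 0 := by
      rw [fderiv_fun_neg]
      have : 0 < fderiv ℝ ρ y v := by
        by_contra hc
        push Not at hc
        exact absurd hv (not_lt.2 (mul_nonpos_of_nonneg_of_nonpos (by simp) hc))
      simpa using this
    filter_upwards [eventually_line_neg (hd y).neg (by simpa using h0) hv',
      eventually_line_mem_ball (v := v) hy] with s hs hb
    exact h.notMem_closure hb (by simpa using hs)

theorem IsLocalDefining.outwardNormal_eq {x₀ : RN N} {r : ℝ} {ρ : RN N → ℝ}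
    (h : IsLocalDefining Ω x₀ r ρ) {y : RN N} (hy : y ∈ Metric.ball x₀ r) (hf : y ∈ frontier Ω) :
    outwardNormal Ω y = ‖coordGrad ρ y‖⁻¹ • coordGrad ρ y :=
  (h.isOutwardUnitNormal hy hf).outwardNormal_eq

/-- The height above the graph grows with slope one along `e` at every point of space, so its
gradient vanishes nowhere, also outside the ball. -/
theorem IsSmoothBoundedDomain.exists_isLocalDefining (hΩ : IsSmoothBoundedDomain Ω) {x₀ : RN N}
    (hx₀ : x₀ ∈ frontier Ω) : ∃ r ρ, IsLocalDefining Ω x₀ r ρ := by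
  obtain ⟨r, e, φ, hr, he, hφ, hiff⟩ := hΩ.exists_graph x₀ hx₀
  set ρ : RN N → ℝ := fun y => inner ℝ e y - φ (y - inner ℝ e y • e) with hρdef
  have hρ : ContDiff ℝ ∞ ρ := by
    have h1 : ContDiff ℝ ∞ fun y : RN N => inner ℝ e y := contDiff_const.inner ℝ contDiff_id
    exact h1.sub (hφ.comp (contDiff_id.sub (h1.smul contDiff_const)))
  have hee : inner ℝ e e = (1 : ℝ) := by rw [real_inner_self_eq_norm_sq, he]; norm_num
  have hline : ∀ y (s : ℝ), ρ (y + s • e) = ρ y + s := by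
    intro y s
    simp only [hρdef, inner_add_right, inner_smul_right, hee, mul_one]
    rw [show y + s • e - (inner ℝ e y + s) • e = y - inner ℝ e y • e by module]
    ring
  have hmem : ∀ y ∈ Metric.ball x₀ r, (y ∈ Ω ↔ ρ y < 0) := by
    intro y hy
    rw [hiff y hy, hρdef, sub_neg]
  refine ⟨r, ρ, hr, hρ, fun y h0 => ?_, hmem, fun y hy => ⟨fun hf => ?_, fun h0 => ?_⟩⟩
  · have h1 : HasDerivAt (fun s : ℝ => ρ (y + s • e)) (fderiv ℝ ρ y e) 0 := by
      have h1 : HasFDerivAt ρ (fderiv ℝ ρ y) (y + (0 : ℝ) • e) := by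
        simpa using ((hρ.differentiable (by simp)) y).hasFDerivAt
      have h2 : HasDerivAt (fun s : ℝ => y + s • e) e 0 := by
        simpa using ((hasDerivAt_id (0 : ℝ)).smul_const e).const_add y
      exact h1.comp_hasDerivAt (0 : ℝ) h2
    have h2 : HasDerivAt (fun s : ℝ => ρ (y + s • e)) 1 0 := by
      simp only [hline]
      exact (hasDerivAt_id (0 : ℝ)).const_add _
    have h3 := h1.unique h2
    rw [← inner_coordGrad, h0, inner_zero_left] at h3
    exact zero_ne_one h3
  · rcases lt_trichotomy (ρ y) 0 with h | h | h
    · have : y ∈ Ω := (hmem y hy).2 h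
      rw [hΩ.isOpen.frontier_eq] at hf
      exact absurd this hf.2
    · exact h
    · exfalso
      have hop : {z | 0 < ρ z} ∩ Metric.ball x₀ r ∈ 𝓝 y :=
        inter_mem ((isOpen_lt continuous_const hρ.continuous).mem_nhds h)
          (Metric.isOpen_ball.mem_nhds hy)
      obtain ⟨z, hz, hzΩ⟩ := mem_closure_iff_nhds.1 (frontier_subset_closure hf) _ hop
      have := (hmem z hz.2).1 hzΩ
      have h' : 0 < ρ z := hz.1
      linarith
  · rw [hΩ.isOpen.frontier_eq]
    refine ⟨?_, fun hy' => by have := (hmem y hy).1 hy'; linarith⟩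
    have hev : ∀ᶠ s : ℝ in 𝓝[>] 0, y + s • (-e) ∈ Ω := by
      filter_upwards [eventually_line_mem_ball (v := -e) hy, self_mem_nhdsWithin] with s hs hs0
      rw [hmem _ hs, show y + s • (-e) = y + (-s) • e by module, hline, h0]
      have : (0 : ℝ) < s := hs0
      linarith
    have hc : Continuous fun s : ℝ => y + s • (-e) := by fun_prop
    have ht : Tendsto (fun s : ℝ => y + s • (-e)) (𝓝[>] 0) (𝓝 y) := by
      have := hc.tendsto 0
      simp only [zero_smul, add_zero] at this
      exact this.mono_left nhdsWithin_le_nhds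
    exact mem_closure_of_tendsto ht hev

theorem IsSmoothBoundedDomain.isOutwardUnitNormal (hΩ : IsSmoothBoundedDomain Ω) {x : RN N}
    (hx : x ∈ frontier Ω) : IsOutwardUnitNormal Ω x (outwardNormal Ω x) := by
  obtain ⟨r, ρ, h⟩ := hΩ.exists_isLocalDefining hx
  have := h.isOutwardUnitNormal (Metric.mem_ball_self h.pos) hx
  rwa [this.outwardNormal_eq]

theorem IsSmoothBoundedDomain.norm_outwardNormal (hΩ : IsSmoothBoundedDomain Ω) {x : RN N}
    (hx : x ∈ frontier Ω) : ‖outwardNormal Ω x‖ = 1 :=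
  (hΩ.isOutwardUnitNormal hx).1

theorem IsSmoothBoundedDomain.isCompact_frontier (hΩ : IsSmoothBoundedDomain Ω) :
    IsCompact (frontier Ω) :=
  Metric.isCompact_of_isClosed_isBounded isClosed_frontier
    (hΩ.isBounded.closure.subset frontier_subset_closure)

theorem IsSmoothBoundedDomain.frontier_nonempty (hN : 1 ≤ N) (hΩ : IsSmoothBoundedDomain Ω) :
    (frontier Ω).Nonempty := by
  have : Nonempty (Fin N) := ⟨⟨0, hN⟩⟩
  rw [nonempty_frontier_iff]
  refine ⟨hΩ.isConnected.nonempty, fun h => ?_⟩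
  have := hΩ.isBounded
  rw [h] at this
  exact NormedSpace.unbounded_univ ℝ (RN N) this

/-- A connected set which meets both `Ω` and its complement meets the boundary. -/
theorem IsPreconnected.exists_mem_frontier {α : Type*} [TopologicalSpace α] {s Ω : Set α}
    (hs : IsPreconnected s) (h1 : (s ∩ Ω).Nonempty) (h2 : (s ∩ Ωᶜ).Nonempty) :
    (s ∩ frontier Ω).Nonempty := by
  by_contra hcon
  rw [not_nonempty_iff_eq_empty] at hcon
  have hU : s ⊆ interior Ω ∪ (closure Ω)ᶜ := by
    intro x hx
    by_contra hx'
    simp only [mem_union, mem_compl_iff, not_or, not_not] at hx'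
    have : x ∈ s ∩ frontier Ω := ⟨hx, hx'.2, hx'.1⟩
    rw [hcon] at this
    exact this
  obtain ⟨a, ha, haΩ⟩ := h1
  obtain ⟨b, hb, hbΩ⟩ := h2
  have ha' : a ∈ interior Ω := (hU ha).resolve_right fun h => h (subset_closure haΩ)
  have hb' : b ∈ (closure Ω)ᶜ := (hU hb).resolve_left fun h => hbΩ (interior_subset h)
  obtain ⟨z, -, hz1, hz2⟩ := hs _ _ isOpen_interior isClosed_closure.isOpen_compl hU
    ⟨a, ha, ha'⟩ ⟨b, hb, hb'⟩
  exact hz2 (interior_subset_closure hz1)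

end Geometry

/-! ### Normal coordinates -/

section NormalCoordinates

variable {N : ℕ} {Ω : Set (RN N)}

/-- Both points are zeros of `ρ`, so the linear Taylor term at `x` equals the remainder, which is
quadratic because `fderiv ℝ ρ` is locally Lipschitz. Division by the gradient norm, bounded below
near `x₀`, turns this into a statement on the unit normal. -/
theorem IsLocalDefining.exists_quadratic_bound {x₀ : RN N} {r : ℝ} {ρ : RN N → ℝ}
    (h : IsLocalDefining Ω x₀ r ρ) : ∃ s > 0, ∃ C : ℝ, 0 ≤ C ∧
      ∀ x ∈ frontier Ω ∩ Metric.ball x₀ s, ∀ y ∈ frontier Ω ∩ Metric.ball x₀ s,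
        |inner ℝ (outwardNormal Ω x) (y - x)| ≤ C * ‖y - x‖ ^ 2 := by
  have hfd : ContDiffAt ℝ 1 (fderiv ℝ ρ) x₀ :=
    (h.contDiff.fderiv_right (m := 1) (by norm_cast)).contDiffAt
  obtain ⟨K, t, ht, hK⟩ := hfd.exists_lipschitzOnWith
  have hcont : Continuous (coordGrad ρ) := (contDiff_coordGrad h.contDiff).continuous
  have hn0 : 0 < ‖coordGrad ρ x₀‖ := norm_pos_iff.2 (h.ne_zero _)
  set m := ‖coordGrad ρ x₀‖ / 2 with hm
  have hm0 : 0 < m := by positivity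
  have hev : ∀ᶠ z in 𝓝 x₀, m < ‖coordGrad ρ z‖ :=
    hcont.norm.continuousAt.eventually (Ioi_mem_nhds (by rw [hm]; linarith))
  obtain ⟨s, hs, hsub⟩ := Metric.mem_nhds_iff.1
    (inter_mem (inter_mem ht hev) (Metric.ball_mem_nhds x₀ h.pos))
  refine ⟨s, hs, m⁻¹ * K, by positivity, fun x hx y hy => ?_⟩
  have hxr := (hsub hx.2).2
  have hyr := (hsub hy.2).2
  have key := Convex.norm_image_sub_le_of_norm_fderiv_le' (𝕜 := ℝ) (f := ρ) (C := K * ‖y - x‖)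
    (s := Metric.closedBall x ‖y - x‖ ∩ Metric.ball x₀ s) (x := x) (y := y) (φ := fderiv ℝ ρ x)
    (fun z _ => h.contDiff.differentiable (by simp) z)
    (fun z hz => by
      have h1 := hK.dist_le_mul z (hsub hz.2).1.1 x (hsub hx.2).1.1
      rw [dist_eq_norm] at h1
      have h2 : dist z x ≤ ‖y - x‖ := hz.1
      exact h1.trans (by gcongr))
    ((convex_closedBall _ _).inter (convex_ball _ _))
    ⟨Metric.mem_closedBall_self (norm_nonneg _), hx.2⟩
    ⟨by rw [Metric.mem_closedBall, dist_eq_norm], hy.2⟩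
  rw [(h.frontier_iff y hyr).1 hy.1, (h.frontier_iff x hxr).1 hx.1] at key
  simp only [sub_zero, zero_sub, norm_neg, Real.norm_eq_abs] at key
  rw [h.outwardNormal_eq hxr hx.1, inner_smul_left, inner_coordGrad, abs_mul]
  have h3 : |(starRingEnd ℝ) ‖coordGrad ρ x‖⁻¹| ≤ m⁻¹ := by
    simp only [conj_trivial, abs_inv, abs_norm]
    exact inv_anti₀ hm0 (le_of_lt (hsub hx.2).1.2)
  calc _ ≤ m⁻¹ * (K * ‖y - x‖ * ‖y - x‖) := by gcongr
    _ = _ := by ring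

theorem IsSmoothBoundedDomain.exists_quadratic_bound (hΩ : IsSmoothBoundedDomain Ω) :
    ∃ C : ℝ, 0 < C ∧ ∀ x ∈ frontier Ω, ∀ y ∈ frontier Ω,
      |inner ℝ (outwardNormal Ω x) (y - x)| ≤ C * ‖y - x‖ ^ 2 := by
  have key : ∃ C : ℝ, 0 < C ∧ ∀ x ∈ frontier Ω ∩ frontier Ω, ∀ y ∈ frontier Ω,
      |inner ℝ (outwardNormal Ω x) (y - x)| ≤ C * ‖y - x‖ ^ 2 := by
    refine hΩ.isCompact_frontier.induction_on (p := fun s => ∃ C : ℝ, 0 < C ∧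
      ∀ x ∈ s ∩ frontier Ω, ∀ y ∈ frontier Ω,
      |inner ℝ (outwardNormal Ω x) (y - x)| ≤ C * ‖y - x‖ ^ 2) ⟨1, one_pos, by simp⟩ ?_ ?_ ?_
    · rintro s t hst ⟨C, hC, h⟩
      exact ⟨C, hC, fun x hx => h x ⟨hst hx.1, hx.2⟩⟩
    · rintro s t ⟨C, hC, h⟩ ⟨C', hC', h'⟩
      refine ⟨max C C', lt_max_of_lt_left hC, ?_⟩
      rintro x ⟨hx | hx, hx'⟩ y hy
      · exact (h x ⟨hx, hx'⟩ y hy).trans (by gcongr; exact le_max_left _ _)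
      · exact (h' x ⟨hx, hx'⟩ y hy).trans (by gcongr; exact le_max_right _ _)
    · intro x₀ hx₀
      obtain ⟨r, ρ, hρ⟩ := hΩ.exists_isLocalDefining hx₀
      obtain ⟨s, hs, C, hC, hb⟩ := hρ.exists_quadratic_bound
      refine ⟨Metric.ball x₀ (s / 2), mem_nhdsWithin_of_mem_nhds
        -- For `y` outside the ball of radius `s` one has `‖y - x‖ ≥ s / 2`, and then Cauchy–Schwarz
        -- suffices since `‖y - x‖ ≤ (2 / s) * ‖y - x‖ ^ 2`.
        (Metric.ball_mem_nhds _ (by positivity)), C + 2 / s, by positivity, fun x hx y hy => ?_⟩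
      have hx1 : dist x x₀ < s / 2 := hx.1
      by_cases hys : dist y x₀ < s
      · refine (hb x ⟨hx.2, Metric.mem_ball.2 (by linarith)⟩ y ⟨hy, hys⟩).trans ?_
        gcongr
        have : 0 < 2 / s := by positivity
        linarith
      · push Not at hys
        have hxy : s / 2 ≤ ‖y - x‖ := by
          rw [← dist_eq_norm]
          have := dist_triangle y x x₀
          linarith
        have h1 : |inner ℝ (outwardNormal Ω x) (y - x)| ≤ ‖y - x‖ := by
          refine (abs_real_inner_le_norm _ _).trans ?_
          rw [hΩ.norm_outwardNormal hx.2, one_mul]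
        refine h1.trans ?_
        have h2 : ‖y - x‖ ≤ (2 / s) * ‖y - x‖ ^ 2 := by
          rw [div_mul_eq_mul_div, le_div_iff₀ hs]
          nlinarith [norm_nonneg (y - x)]
        nlinarith [sq_nonneg ‖y - x‖]
  simpa using key

/-- Inside the layer of width `r`, points on normals have their foot as the unique nearest point of
the boundary. -/
structure IsTubularRadius (Ω : Set (RN N)) (r : ℝ) : Prop where
  pos : 0 < r
  lt_dist : ∀ x ∈ frontier Ω, ∀ t : ℝ, |t| < r → ∀ y ∈ frontier Ω, y ≠ x →
    |t| < dist (x + t • outwardNormal Ω x) y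

theorem IsSmoothBoundedDomain.exists_isTubularRadius (hΩ : IsSmoothBoundedDomain Ω) :
    ∃ r, IsTubularRadius Ω r := by
  obtain ⟨C, hC, h⟩ := hΩ.exists_quadratic_bound
  -- Expanding the square, `‖x + t n - y‖ ^ 2 ≥ t ^ 2 + (1 - 2 * C * |t|) * ‖y - x‖ ^ 2`, which
  -- exceeds `t ^ 2` exactly under this restriction on `|t|`.
  refine ⟨1 / (2 * C), by positivity, fun x hx t ht y hy hne => ?_⟩
  have h1 : 0 < ‖y - x‖ := norm_pos_iff.2 (sub_ne_zero.2 hne)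
  have h2 := h x hx y hy
  have hn := hΩ.norm_outwardNormal hx
  rw [dist_eq_norm]
  refine lt_of_pow_lt_pow_left₀ 2 (norm_nonneg _) ?_
  have h3 : ‖x + t • outwardNormal Ω x - y‖ ^ 2
      = t ^ 2 - 2 * (t * inner ℝ (outwardNormal Ω x) (y - x)) + ‖y - x‖ ^ 2 := by
    rw [show x + t • outwardNormal Ω x - y = t • outwardNormal Ω x - (y - x) by abel,
      norm_sub_sq_real, norm_smul, hn, inner_smul_left]
    simp
  rw [h3, sq_abs]
  have h4 : t * inner ℝ (outwardNormal Ω x) (y - x) ≤ |t| * (C * ‖y - x‖ ^ 2) :=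
    (le_abs_self _).trans (by rw [abs_mul]; gcongr)
  have h5 : |t| * (2 * C) < 1 := by rwa [lt_div_iff₀ (by positivity)] at ht
  nlinarith [pow_pos h1 2]

theorem IsTubularRadius.infDist_eq {r : ℝ} (h : IsTubularRadius Ω r)
    (hΩ : IsSmoothBoundedDomain Ω) {x : RN N} (hx : x ∈ frontier Ω) {t : ℝ} (ht : |t| < r) :
    Metric.infDist (x + t • outwardNormal Ω x) (frontier Ω) = |t| := by
  have hd : dist (x + t • outwardNormal Ω x) x = |t| := by
    simp [dist_eq_norm, norm_smul, hΩ.norm_outwardNormal hx]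
  refine le_antisymm ((Metric.infDist_le_dist_of_mem hx).trans hd.le) ?_
  refine (Metric.le_infDist ⟨x, hx⟩).2 fun y hy => ?_
  rcases eq_or_ne y x with rfl | hne
  · exact hd.ge
  · exact (h.lt_dist x hx t ht y hy hne).le

theorem IsTubularRadius.injective {r : ℝ} (h : IsTubularRadius Ω r)
    (hΩ : IsSmoothBoundedDomain Ω) {x y : RN N} (hx : x ∈ frontier Ω) (hy : y ∈ frontier Ω)
    {t s : ℝ} (ht : |t| < r) (hs : |s| < r)
    (he : x + t • outwardNormal Ω x = y + s • outwardNormal Ω y) : x = y ∧ t = s := by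
  have h1 : |t| = |s| := by
    rw [← h.infDist_eq hΩ hx ht, ← h.infDist_eq hΩ hy hs, he]
  have hxy : x = y := by
    by_contra hne
    have h2 := h.lt_dist x hx t ht y hy (Ne.symm hne)
    rw [he] at h2
    have hd : dist (y + s • outwardNormal Ω y) y = |s| := by
      simp [dist_eq_norm, norm_smul, hΩ.norm_outwardNormal hy]
    linarith
  subst hxy
  refine ⟨rfl, ?_⟩
  have h3 : (t - s) • outwardNormal Ω x = 0 := by
    rw [sub_smul, sub_eq_zero]; exact add_left_cancel he
  rcases smul_eq_zero.1 h3 with h4 | h4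
  · linarith
  · have := hΩ.norm_outwardNormal hx
    rw [h4, norm_zero] at this
    exact absurd this zero_ne_one

theorem eventually_dist_lt {v w : RN N} (h : 0 < inner ℝ v w) :
    ∀ᶠ s : ℝ in 𝓝[>] 0, ‖s • w - v‖ < ‖v‖ := by
  have hc : Continuous fun s : ℝ => s * ‖w‖ ^ 2 - 2 * inner ℝ v w := by fun_prop
  have hev : ∀ᶠ s : ℝ in 𝓝 0, s * ‖w‖ ^ 2 - 2 * inner ℝ v w < 0 :=
    hc.continuousAt.eventually (Iio_mem_nhds (by linarith))
  filter_upwards [hev.filter_mono nhdsWithin_le_nhds, self_mem_nhdsWithin] with s hs hs0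
  have hs0' : (0 : ℝ) < s := hs0
  refine lt_of_pow_lt_pow_left₀ 2 (norm_nonneg _) ?_
  rw [norm_sub_sq_real, norm_smul, inner_smul_left, real_inner_comm]
  simp only [conj_trivial, mul_pow, Real.norm_eq_abs, sq_abs]
  nlinarith

/-- The foot is a nearest boundary point `y`. If `v = x - y` had a tangential part `w ≠ 0`, then
moving from `y` along `w - ε n` and `w + ε n` would reach points of `Ω` and of its exterior inside
the open ball of radius `‖v‖` about `x`. This ball is connected, so it would contain a boundary
point closer than `y`. -/
theorem IsSmoothBoundedDomain.exists_normal_coord (hN : 1 ≤ N) (hΩ : IsSmoothBoundedDomain Ω)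
    (x : RN N) : ∃ y ∈ frontier Ω, ∃ t : ℝ, |t| = Metric.infDist x (frontier Ω) ∧
      x = y + t • outwardNormal Ω y := by
  obtain ⟨y, hy, hd⟩ := hΩ.isCompact_frontier.exists_infDist_eq_dist (hΩ.frontier_nonempty hN) x
  have hn := hΩ.norm_outwardNormal hy
  have hO := hΩ.isOutwardUnitNormal hy
  set n := outwardNormal Ω y with hndef
  set v := x - y with hv
  have hnn : inner ℝ n n = (1 : ℝ) := by rw [real_inner_self_eq_norm_sq, hn]; norm_num
  suffices hpar : v = (inner ℝ n v : ℝ) • n by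
    refine ⟨y, hy, inner ℝ n v, ?_, ?_⟩
    · rw [hd, dist_eq_norm, ← hv]
      conv_rhs => rw [hpar, norm_smul, hn, mul_one, Real.norm_eq_abs]
    · rw [← hndef, ← hpar, hv]; abel
  by_contra hne
  set w := v - (inner ℝ n v : ℝ) • n with hw
  have hw0 : 0 < ‖w‖ ^ 2 := by
    have : w ≠ 0 := fun h0 => hne (sub_eq_zero.1 h0)
    positivity
  have hnw : inner ℝ n w = (0 : ℝ) := by
    rw [hw, inner_sub_right, inner_smul_right, hnn]; ring
  have hvw : inner ℝ v w = ‖w‖ ^ 2 := by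
    have : v = w + (inner ℝ n v : ℝ) • n := by rw [hw]; abel
    rw [this, inner_add_left, real_inner_self_eq_norm_sq, inner_smul_left, hnw]; simp
  -- So small that `w ± ε n` still make an acute angle with `v`; the summand `1` keeps the
  -- denominator positive.
  set ε := ‖w‖ ^ 2 / (2 * (|inner ℝ v n| + 1)) with hε
  have hε0 : 0 < ε := by positivity
  have hεv : ε * |inner ℝ v n| < ‖w‖ ^ 2 := by
    rw [hε, div_mul_eq_mul_div, div_lt_iff₀ (by positivity)]
    nlinarith [abs_nonneg (inner ℝ v n)]
  have hav := abs_le.1 (le_of_eq (abs_mul ε (inner ℝ v n)))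
  rw [abs_of_pos hε0] at hav
  have hin : ∀ᶠ s : ℝ in 𝓝[>] 0, y + s • (w - ε • n) ∈ Ω := by
    refine hO.2.1 _ ?_
    rw [inner_sub_right, inner_smul_right, hnw, hnn]; linarith
  have hout : ∀ᶠ s : ℝ in 𝓝[>] 0, y + s • (w + ε • n) ∉ closure Ω := by
    refine hO.2.2 _ ?_
    rw [inner_add_right, inner_smul_right, hnw, hnn]; linarith
  have hb1 : ∀ᶠ s : ℝ in 𝓝[>] 0, ‖s • (w - ε • n) - v‖ < ‖v‖ := by
    refine eventually_dist_lt ?_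
    rw [inner_sub_right, inner_smul_right, hvw]; linarith [hav.2]
  have hb2 : ∀ᶠ s : ℝ in 𝓝[>] 0, ‖s • (w + ε • n) - v‖ < ‖v‖ := by
    refine eventually_dist_lt ?_
    rw [inner_add_right, inner_smul_right, hvw]; linarith [hav.1]
  obtain ⟨s, ⟨h1, h2⟩, h3, h4⟩ := ((hin.and hout).and (hb1.and hb2)).exists
  have hball : ∀ u : RN N, ‖u - v‖ < ‖v‖ → y + u ∈ Metric.ball x ‖v‖ := by
    intro u hu
    rw [Metric.mem_ball, dist_eq_norm, show y + u - x = u - v by rw [hv]; abel]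
    exact hu
  obtain ⟨z, hz, hzf⟩ := (convex_ball x ‖v‖).isPreconnected.exists_mem_frontier
    ⟨_, hball _ h3, h1⟩ ⟨_, hball _ h4, fun h => h2 (subset_closure h)⟩
  have h5 := Metric.infDist_le_dist_of_mem (x := x) hzf
  rw [hd, dist_eq_norm x y, ← hv, dist_comm] at h5
  exact absurd (Metric.mem_ball.1 hz) (not_lt.2 h5)

/-- Just below the foot the normal line lies in `Ω`. Leaving `Ω` further down would need a boundary
point at some parameter `a < 0`, but the distance to the boundary there is `|a| > 0`. -/
theorem IsTubularRadius.mem_of_neg {r : ℝ} (h : IsTubularRadius Ω r)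
    (hΩ : IsSmoothBoundedDomain Ω) {x : RN N} (hx : x ∈ frontier Ω) {t : ℝ} (ht : |t| < r)
    (h0 : t < 0) : x + t • outwardNormal Ω x ∈ Ω := by
  by_contra hcon
  have hn := hΩ.norm_outwardNormal hx
  have hO := (hΩ.isOutwardUnitNormal hx).2.1 (-outwardNormal Ω x)
    (by rw [inner_neg_right, real_inner_self_eq_norm_sq, hn]; norm_num)
  have hlt : ∀ᶠ s : ℝ in 𝓝[>] 0, s < -t :=
    (eventually_lt_nhds (by linarith : (0 : ℝ) < -t)).filter_mono nhdsWithin_le_nhds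
  obtain ⟨s, ⟨hs, hst⟩, hs0⟩ := ((hO.and hlt).and self_mem_nhdsWithin).exists
  have hs0' : (0 : ℝ) < s := hs0
  have hpre : IsPreconnected ((fun a : ℝ => x + a • outwardNormal Ω x) '' Icc t (-s)) :=
    isPreconnected_Icc.image _ (by fun_prop)
  obtain ⟨_, ⟨a, ha, rfl⟩, hf⟩ := hpre.exists_mem_frontier (Ω := Ω)
    ⟨x + s • -outwardNormal Ω x, ⟨-s, ⟨by linarith, le_rfl⟩, by simp⟩, hs⟩
    ⟨_, ⟨t, ⟨le_rfl, by linarith⟩, rfl⟩, hcon⟩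
  have har : |a| < r := by
    rw [abs_of_neg (by linarith [ha.2])]
    rw [abs_of_neg h0] at ht
    linarith [ha.1]
  have h1 := h.infDist_eq hΩ hx har
  rw [Metric.infDist_zero_of_mem hf, eq_comm, abs_eq_zero] at h1
  linarith [ha.2]

theorem IsTubularRadius.notMem_closure_of_pos {r : ℝ} (h : IsTubularRadius Ω r)
    (hΩ : IsSmoothBoundedDomain Ω) {x : RN N} (hx : x ∈ frontier Ω) {t : ℝ} (ht : |t| < r)
    (h0 : 0 < t) : x + t • outwardNormal Ω x ∉ closure Ω := by
  have hnf : ∀ a : ℝ, 0 < a → a ≤ t → x + a • outwardNormal Ω x ∉ frontier Ω := by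
    intro a ha0 hat hf
    have har : |a| < r := by
      rw [abs_of_pos ha0]
      rw [abs_of_pos h0] at ht
      linarith
    have h1 := h.infDist_eq hΩ hx har
    rw [Metric.infDist_zero_of_mem hf, eq_comm, abs_eq_zero] at h1
    linarith
  intro hcon
  have hin : x + t • outwardNormal Ω x ∈ Ω := by
    by_contra hni
    exact hnf t h0 le_rfl ⟨hcon, fun hi => hni (interior_subset hi)⟩
  have hn := hΩ.norm_outwardNormal hx
  have hO := (hΩ.isOutwardUnitNormal hx).2.2 (outwardNormal Ω x)
    (by rw [real_inner_self_eq_norm_sq, hn]; norm_num)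
  have hlt : ∀ᶠ s : ℝ in 𝓝[>] 0, s < t := (eventually_lt_nhds h0).filter_mono nhdsWithin_le_nhds
  obtain ⟨s, ⟨hs, hst⟩, hs0⟩ := ((hO.and hlt).and self_mem_nhdsWithin).exists
  have hs0' : (0 : ℝ) < s := hs0
  have hpre : IsPreconnected ((fun a : ℝ => x + a • outwardNormal Ω x) '' Icc s t) :=
    isPreconnected_Icc.image _ (by fun_prop)
  obtain ⟨_, ⟨a, ha, rfl⟩, hf⟩ := hpre.exists_mem_frontier (Ω := Ω)
    ⟨_, ⟨t, ⟨hst.le, le_rfl⟩, rfl⟩, hin⟩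
    ⟨_, ⟨s, ⟨le_rfl, hst.le⟩, rfl⟩, fun h => hs (subset_closure h)⟩
  exact hnf a (by linarith [ha.1]) ha.2 hf

theorem IsTubularRadius.mem_iff {r : ℝ} (h : IsTubularRadius Ω r)
    (hΩ : IsSmoothBoundedDomain Ω) {x : RN N} (hx : x ∈ frontier Ω) {t : ℝ} (ht : |t| < r) :
    x + t • outwardNormal Ω x ∈ Ω ↔ t < 0 := by
  refine ⟨fun hm => ?_, h.mem_of_neg hΩ hx ht⟩
  by_contra hcon
  rcases (not_lt.1 hcon).eq_or_lt with h0 | h0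
  · subst h0
    rw [zero_smul, add_zero] at hm
    rw [hΩ.isOpen.frontier_eq] at hx
    exact hx.2 hm
  · exact h.notMem_closure_of_pos hΩ hx ht h0 (subset_closure hm)

/-- A point at distance exactly `δ` is not interior: moving it slightly away from its foot along the
normal increases the distance, which is the absolute normal coordinate as long as it stays below
`r`. -/
theorem IsTubularRadius.interior_tube (hN : 1 ≤ N) {r : ℝ} (h : IsTubularRadius Ω r)
    (hΩ : IsSmoothBoundedDomain Ω) {δ : ℝ} (hδ : 0 < δ) (hδr : δ < r) :
    interior (tube Ω δ) = {x | Metric.infDist x (frontier Ω) < δ} := by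
  have hsub : {x | Metric.infDist x (frontier Ω) < δ} ⊆ tube Ω δ := by
    intro x hx
    have h1 : Metric.infDist x (frontier Ω) < δ := hx
    exact h1.le
  refine subset_antisymm (fun x hx => ?_) (interior_maximal hsub
    (isOpen_lt (Metric.continuous_infDist_pt _) continuous_const))
  have hle : Metric.infDist x (frontier Ω) ≤ δ := interior_subset (s := tube Ω δ) hx
  refine lt_of_le_of_ne hle fun heq => ?_
  obtain ⟨y, hy, t, ht, hxy⟩ := hΩ.exists_normal_coord hN x
  rw [heq] at ht
  have hc : Continuous fun s : ℝ => y + (t + s * t) • outwardNormal Ω y := by fun_prop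
  have ht0 : Tendsto (fun s : ℝ => y + (t + s * t) • outwardNormal Ω y) (𝓝[>] 0) (𝓝 x) := by
    have := hc.tendsto 0
    simp only [zero_mul, add_zero, ← hxy] at this
    exact this.mono_left nhdsWithin_le_nhds
  have hlt : ∀ᶠ s : ℝ in 𝓝[>] 0, s < (r - δ) / δ :=
    (eventually_lt_nhds (div_pos (by linarith) hδ)).filter_mono nhdsWithin_le_nhds
  obtain ⟨s, ⟨hs, hsr⟩, hs0⟩ := (((ht0.eventually (isOpen_interior.mem_nhds hx)).and hlt).and
    self_mem_nhdsWithin).exists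
  have hs0' : (0 : ℝ) < s := hs0
  have habs : |t + s * t| = δ + s * δ := by
    rw [show t + s * t = (1 + s) * t by ring, abs_mul, ht, abs_of_pos (by linarith)]; ring
  rw [lt_div_iff₀ hδ] at hsr
  have h1 := h.infDist_eq hΩ hy (t := t + s * t) (by rw [habs]; linarith)
  have h2 : Metric.infDist (y + (t + s * t) • outwardNormal Ω y) (frontier Ω) ≤ δ :=
    interior_subset (s := tube Ω δ) hs
  rw [h1, habs] at h2
  nlinarith

end NormalCoordinates

/-! ### Smoothness of normal coordinates -/

section SmoothCoordinates

variable {N : ℕ} {Ω : Set (RN N)}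

theorem contDiff_normalize {E : Type*} [NormedAddCommGroup E] {F : Type*} [NormedAddCommGroup F]
    [InnerProductSpace ℝ F] [NormedSpace ℝ E] {g : E → F}
    (hg : ContDiff ℝ ∞ g) (h0 : ∀ y, g y ≠ 0) : ContDiff ℝ ∞ fun y => ‖g y‖⁻¹ • g y :=
  ((hg.norm ℝ h0).inv fun y => norm_ne_zero_iff.2 (h0 y)).smul hg

/-- The inverse function theorem for `Φ (y, s) = (y + s • ñ y, ρ y)` at `(x₀, 0)`. Solving `Φ (y, s)
= (x, 0)` forces `y` onto the boundary, so no parametrisation of the boundary is needed. -/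
theorem IsLocalDefining.exists_local_coord {x₀ : RN N} {r₀ r : ℝ} {ρ : RN N → ℝ}
    (h : IsLocalDefining Ω x₀ r₀ ρ) (hx₀ : x₀ ∈ frontier Ω) (hr : 0 < r) :
    ∃ W, IsOpen W ∧ x₀ ∈ W ∧ ∃ (p n : RN N → RN N) (t : RN N → ℝ), ContDiffOn ℝ ∞ p W ∧
      ContDiffOn ℝ ∞ n W ∧ ContDiffOn ℝ ∞ t W ∧ ∀ x ∈ W, p x ∈ frontier Ω ∧ |t x| < r ∧
      n x = outwardNormal Ω (p x) ∧ x = p x + t x • n x := by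
  set ñ : RN N → RN N := fun y => ‖coordGrad ρ y‖⁻¹ • coordGrad ρ y with hñ
  have hñs : ContDiff ℝ ∞ ñ := contDiff_normalize (contDiff_coordGrad h.contDiff) h.ne_zero
  set Φ : RN N × ℝ → RN N × ℝ := fun q => (q.1 + q.2 • ñ q.1, ρ q.1) with hΦ
  have hΦs : ContDiff ℝ ∞ Φ :=
    (contDiff_fst.add (contDiff_snd.smul (hñs.comp contDiff_fst))).prodMk
      (h.contDiff.comp contDiff_fst)
  have hinj : Function.Injective (fderiv ℝ Φ (x₀, 0)) := by
    rw [injective_iff_map_eq_zero]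
    rintro ⟨v, σ⟩ hv
    have hd1 : HasFDerivAt (fun q : RN N × ℝ => ρ q.1)
        ((fderiv ℝ ρ x₀).comp (ContinuousLinearMap.fst ℝ (RN N) ℝ)) (x₀, 0) :=
      HasFDerivAt.comp (x₀, (0 : ℝ)) (h.contDiff.differentiable (by simp) x₀).hasFDerivAt
        hasFDerivAt_fst
    have hd2 : HasFDerivAt (fun q : RN N × ℝ => ñ q.1)
        ((fderiv ℝ ñ x₀).comp (ContinuousLinearMap.fst ℝ (RN N) ℝ)) (x₀, 0) :=
      HasFDerivAt.comp (g := ñ) (x₀, (0 : ℝ)) (hñs.differentiable (by simp) x₀).hasFDerivAt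
        hasFDerivAt_fst
    have hd := ((hasFDerivAt_fst (𝕜 := ℝ) (p := (x₀, (0 : ℝ)))).add
      ((hasFDerivAt_snd (𝕜 := ℝ) (p := (x₀, (0 : ℝ)))).smul hd2)).prodMk hd1
    have hfd : fderiv ℝ Φ (x₀, 0) = _ := hd.fderiv
    rw [hfd] at hv
    simp only [ContinuousLinearMap.prod_apply, Prod.mk_eq_zero] at hv
    obtain ⟨hv1, hv2⟩ := hv
    simp at hv1 hv2
    have hg0 : coordGrad ρ x₀ ≠ 0 := h.ne_zero x₀
    -- A kernel vector satisfies `v + σ ñ = 0` and `Dρ v = 0`; applying `Dρ` to the first relation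
    -- leaves `σ` times a positive multiple of the squared gradient norm.
    have h3 : fderiv ℝ ρ x₀ (v + σ • ñ x₀) = 0 := by rw [hv1, map_zero]
    rw [map_add, hv2, zero_add, map_smul, hñ, ← inner_coordGrad, inner_smul_right,
      real_inner_self_eq_norm_sq, smul_eq_mul] at h3
    have hn : ‖coordGrad ρ x₀‖ ≠ 0 := norm_ne_zero_iff.2 hg0
    have hσ : σ = 0 := by
      rcases mul_eq_zero.1 h3 with h4 | h4
      · exact h4
      · exact absurd h4 (by positivity)
    subst hσ
    simp at hv1
    simp [hv1]
  set A : (RN N × ℝ) ≃L[ℝ] (RN N × ℝ) := (LinearEquiv.ofInjectiveEndo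
    (fderiv ℝ Φ (x₀, 0) : (RN N × ℝ) →ₗ[ℝ] (RN N × ℝ)) hinj).toContinuousLinearEquiv with hA
  have hAe : (A : (RN N × ℝ) →L[ℝ] (RN N × ℝ)) = fderiv ℝ Φ (x₀, 0) := by
    refine ContinuousLinearMap.ext fun z => ?_
    rfl
  have hder : HasFDerivAt Φ (A : (RN N × ℝ) →L[ℝ] (RN N × ℝ)) (x₀, 0) := by
    rw [hAe]; exact (hΦs.differentiable (by simp) _).hasFDerivAt
  set G := (hΦs.contDiffAt (x := (x₀, (0 : ℝ)))).toOpenPartialHomeomorph Φ hder (by simp) with hG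
  have hGc : ∀ q, G q = Φ q := fun q => rfl
  have hsrc : (x₀, (0 : ℝ)) ∈ G.source :=
    ContDiffAt.mem_toOpenPartialHomeomorph_source (hΦs.contDiffAt (x := (x₀, (0 : ℝ)))) hder
      (by simp)
  have hρ0 : ρ x₀ = 0 := (h.frontier_iff x₀ (Metric.mem_ball_self h.pos)).1 hx₀
  have hG0 : G (x₀, 0) = (x₀, 0) := by rw [hGc, hΦ]; simp [hρ0]
  have htgt : (x₀, (0 : ℝ)) ∈ G.target := by rw [← hG0]; exact G.map_source hsrc
  have hsymm0 : G.symm (x₀, 0) = (x₀, 0) := by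
    conv_lhs => rw [← hG0]
    exact G.left_inv hsrc
  -- Invertibility of the derivative is kept at all points of `S`, so that the inverse is smooth on
  -- a neighbourhood and not only at the base point.
  set S : Set (RN N × ℝ) := {q | fderiv ℝ Φ q ∈ range
    ((↑) : ((RN N × ℝ) ≃L[ℝ] (RN N × ℝ)) → ((RN N × ℝ) →L[ℝ] (RN N × ℝ)))} ∩
    {q | q.1 ∈ Metric.ball x₀ r₀ ∧ |q.2| < r} with hS
  have hSo : IsOpen S := by
    refine (ContinuousLinearEquiv.isOpen.preimage (hΦs.continuous_fderiv (by simp))).inter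
      (IsOpen.inter (Metric.isOpen_ball.preimage continuous_fst)
      (isOpen_lt (continuous_snd.abs) continuous_const))
  have hS0 : (x₀, (0 : ℝ)) ∈ S := by
    refine ⟨⟨A, hAe⟩, Metric.mem_ball_self h.pos, by simpa using hr⟩
  have hVo : IsOpen (G.target ∩ G.symm ⁻¹' S) := G.isOpen_inter_preimage_symm hSo
  refine ⟨(fun x => (x, (0 : ℝ))) ⁻¹' (G.target ∩ G.symm ⁻¹' S),
    hVo.preimage (by fun_prop), ⟨htgt, by rw [mem_preimage, hsymm0]; exact hS0⟩,
    fun x => (G.symm (x, 0)).1, fun x => ñ (G.symm (x, 0)).1, fun x => (G.symm (x, 0)).2, ?_⟩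
  have hsm : ContDiffOn ℝ ∞ (fun x => G.symm (x, (0 : ℝ)))
      ((fun x => (x, (0 : ℝ))) ⁻¹' (G.target ∩ G.symm ⁻¹' S)) := by
    intro x hx
    obtain ⟨B, hB⟩ := hx.2.1
    have h1 : ContDiffAt ℝ ∞ G.symm (x, (0 : ℝ)) := by
      refine G.contDiffAt_symm (f₀' := B) hx.1 ?_ hΦs.contDiffAt
      rw [hB]
      exact (hΦs.differentiable (by simp) _).hasFDerivAt
    have h2 : ContDiffAt ℝ ∞ (fun x : RN N => (x, (0 : ℝ))) x :=
      contDiffAt_id.prodMk contDiffAt_const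
    exact (ContDiffAt.comp x h1 h2).contDiffWithinAt
  refine ⟨contDiff_fst.comp_contDiffOn hsm,
    (hñs.comp contDiff_fst).comp_contDiffOn hsm, contDiff_snd.comp_contDiffOn hsm, ?_⟩
  intro x hx
  have h1 : Φ (G.symm (x, 0)) = (x, 0) := G.right_inv hx.1
  have h2 : ρ (G.symm (x, 0)).1 = 0 := congrArg Prod.snd h1
  have h3 : (G.symm (x, 0)).1 + (G.symm (x, 0)).2 • ñ (G.symm (x, 0)).1 = x :=
    congrArg Prod.fst h1
  have h4 : (G.symm (x, 0)).1 ∈ frontier Ω := (h.frontier_iff _ hx.2.2.1).2 h2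
  exact ⟨h4, hx.2.2.2, (h.outwardNormal_eq hx.2.2.1 h4).symm, h3.symm⟩

/-- Smooth normal coordinates `x = p x + t x • n x` in the open layer of width `r` around the
boundary: `p x` is the foot of `x` on the boundary, `t x` the signed distance, `n x` the outward
normal at the foot. -/
structure IsTubularChart (Ω : Set (RN N)) (r : ℝ) (p n : RN N → RN N) (t : RN N → ℝ) : Prop where
  pos : 0 < r
  frontier_nonempty : (frontier Ω).Nonempty
  foot_mem : ∀ x, Metric.infDist x (frontier Ω) < r → p x ∈ frontier Ω
  eq_add : ∀ x, Metric.infDist x (frontier Ω) < r → x = p x + t x • n x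
  normal_eq : ∀ x, Metric.infDist x (frontier Ω) < r → n x = outwardNormal Ω (p x)
  abs_eq : ∀ x, Metric.infDist x (frontier Ω) < r → |t x| = Metric.infDist x (frontier Ω)
  mem_iff : ∀ x, Metric.infDist x (frontier Ω) < r → (x ∈ Ω ↔ t x < 0)
  unique : ∀ y ∈ frontier Ω, ∀ s : ℝ, |s| < r →
    Metric.infDist (y + s • outwardNormal Ω y) (frontier Ω) < r ∧
    p (y + s • outwardNormal Ω y) = y ∧ t (y + s • outwardNormal Ω y) = s
  contDiffOn_t : ContDiffOn ℝ ∞ t {x | Metric.infDist x (frontier Ω) < r}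
  contDiffOn_n : ContDiffOn ℝ ∞ n {x | Metric.infDist x (frontier Ω) < r}
  interior_tube : ∀ δ, 0 < δ → δ < r →
    interior (tube Ω δ) = {x | Metric.infDist x (frontier Ω) < δ}

theorem IsSmoothBoundedDomain.exists_isTubularChart (hN : 1 ≤ N) (hΩ : IsSmoothBoundedDomain Ω) :
    ∃ r p n t, IsTubularChart Ω r p n t := by
  obtain ⟨r, hr⟩ := hΩ.exists_isTubularRadius
  have hloc : ∀ x₀ : frontier Ω, ∃ W, IsOpen W ∧ (x₀ : RN N) ∈ W ∧
      ∃ (p n : RN N → RN N) (t : RN N → ℝ), ContDiffOn ℝ ∞ p W ∧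
      ContDiffOn ℝ ∞ n W ∧ ContDiffOn ℝ ∞ t W ∧ ∀ x ∈ W, p x ∈ frontier Ω ∧ |t x| < r ∧
      n x = outwardNormal Ω (p x) ∧ x = p x + t x • n x := by
    intro x₀
    obtain ⟨r₀, ρ, hρ⟩ := hΩ.exists_isLocalDefining x₀.2
    exact hρ.exists_local_coord x₀.2 hr.pos
  choose W hWo hWm p' n' t' hp' hn' ht' hW using hloc
  -- A Lebesgue number gives a layer of uniform width covered by the local charts. The global
  -- coordinates are merely chosen pointwise; by uniqueness they agree with the smooth local ones.
  obtain ⟨ε, hε, hεW⟩ := lebesgue_number_lemma_of_metric hΩ.isCompact_frontier hWo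
    (fun x hx => mem_iUnion.2 ⟨⟨x, hx⟩, hWm ⟨x, hx⟩⟩)
  choose p hp t ht hpt using hΩ.exists_normal_coord hN
  set R := min r ε with hR
  have hRpos : 0 < R := lt_min hr.pos hε
  have hRr : R ≤ r := min_le_left _ _
  have huniq : ∀ y ∈ frontier Ω, ∀ s : ℝ, |s| < r →
      p (y + s • outwardNormal Ω y) = y ∧ t (y + s • outwardNormal Ω y) = s := by
    intro y hy s hs
    have h1 := hr.infDist_eq hΩ hy hs
    refine hr.injective hΩ (hp _) hy ?_ hs (hpt _).symm
    rw [ht, h1]; exact hs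
  have hnear : ∀ x, Metric.infDist x (frontier Ω) < R → ∃ i, x ∈ W i := by
    intro x hx
    obtain ⟨y, hy, hxy⟩ := (Metric.infDist_lt_iff (hΩ.frontier_nonempty hN)).1 hx
    obtain ⟨i, hi⟩ := hεW y hy
    exact ⟨i, hi (Metric.mem_ball.2 (hxy.trans_le (min_le_right _ _)))⟩
  have hcoinc : ∀ i, ∀ x ∈ W i, p x = p' i x ∧ t x = t' i x := by
    intro i x hx
    obtain ⟨h1, h2, h3, h4⟩ := hW i x hx
    have h5 := huniq _ h1 _ h2
    rw [← h3, ← h4] at h5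
    exact h5
  refine ⟨R, p, fun x => outwardNormal Ω (p x), t, hRpos, hΩ.frontier_nonempty hN,
    fun x _ => hp x, fun x _ => hpt x, fun _ _ => rfl,
    fun x _ => ht x, ?_, ?_, ?_, ?_, ?_⟩
  · intro x hx
    have := hr.mem_iff hΩ (hp x) (t := t x) (by rw [ht]; exact hx.trans_le hRr)
    rwa [← hpt] at this
  · intro y hy s hs
    refine ⟨?_, huniq y hy s (hs.trans_le hRr)⟩
    rw [hr.infDist_eq hΩ hy (hs.trans_le hRr)]; exact hs
  · intro x hx
    obtain ⟨i, hi⟩ := hnear x hx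
    refine ContDiffAt.contDiffWithinAt ?_
    refine ((ht' i).contDiffAt ((hWo i).mem_nhds hi)).congr_of_eventuallyEq ?_
    filter_upwards [(hWo i).mem_nhds hi] with z hz using (hcoinc i z hz).2
  · intro x hx
    obtain ⟨i, hi⟩ := hnear x hx
    refine ContDiffAt.contDiffWithinAt ?_
    refine ((hn' i).contDiffAt ((hWo i).mem_nhds hi)).congr_of_eventuallyEq ?_
    filter_upwards [(hWo i).mem_nhds hi] with z hz
    rw [(hW i z hz).2.2.1, (hcoinc i z hz).1]
  · exact fun δ hδ hδR => hr.interior_tube hN hΩ hδ (hδR.trans_le hRr)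

end SmoothCoordinates

/-! ### Reflections across the boundary -/

section Reflections

variable {N : ℕ} {Ω : Set (RN N)}

/-- The open layer of width `r` around the boundary of `Ω`. -/
def layer (Ω : Set (RN N)) (r : ℝ) : Set (RN N) := {x | Metric.infDist x (frontier Ω) < r}

theorem mem_layer {x : RN N} {r : ℝ} : x ∈ layer Ω r ↔ Metric.infDist x (frontier Ω) < r := Iff.rfl

theorem isOpen_layer (Ω : Set (RN N)) (r : ℝ) : IsOpen (layer Ω r) :=
  isOpen_lt (Metric.continuous_infDist_pt _) continuous_const

theorem layer_mono {r s : ℝ} (h : r ≤ s) : layer Ω r ⊆ layer Ω s :=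
  fun _ hx => lt_of_lt_of_le (mem_layer.1 hx) h

theorem frontier_subset_layer {r : ℝ} (hr : 0 < r) : frontier Ω ⊆ layer Ω r := by
  intro x hx
  rw [mem_layer, Metric.infDist_zero_of_mem hx]
  exact hr

theorem contDiff_of_tsupport_subset {E F : Type*} [NormedAddCommGroup E] [NormedSpace ℝ E]
    [NormedAddCommGroup F] [NormedSpace ℝ F] {f : E → F} {W : Set E} {n : WithTop ℕ∞}
    (hW : IsOpen W) (hf : ContDiffOn ℝ n f W) (hs : tsupport f ⊆ W) : ContDiff ℝ n f := by
  rw [contDiff_iff_contDiffAt]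
  intro x
  by_cases hx : x ∈ W
  · exact hf.contDiffAt (hW.mem_nhds hx)
  · have hx' : x ∉ tsupport f := fun h => hx (hs h)
    have h0 : f =ᶠ[𝓝 x] fun _ => 0 := notMem_tsupport_iff_eventuallyEq.1 hx'
    exact contDiffAt_const.congr_of_eventuallyEq h0

theorem exists_layer_cutoff (Ω : Set (RN N)) {r : ℝ} (hr : 0 < r) : ∃ χ : RN N → ℝ,
    ContDiff ℝ ∞ χ ∧ tsupport χ ⊆ layer Ω r ∧ ∀ x ∈ layer Ω (r / 2), χ x = 1 := by
  have hc := Metric.continuous_infDist_pt (frontier Ω)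
  obtain ⟨f, hf0, hf1, -⟩ := exists_contMDiffMap_zero_one_of_isClosed
    (n := (⊤ : ℕ∞)) (modelWithCornersSelf ℝ (RN N))
    (s := {x | 3 / 4 * r ≤ Metric.infDist x (frontier Ω)})
    (t := {x | Metric.infDist x (frontier Ω) ≤ r / 2})
    (isClosed_le continuous_const hc) (isClosed_le hc continuous_const)
    (by
      rw [Set.disjoint_left]
      intro x hx hx'
      have h1 : 3 / 4 * r ≤ Metric.infDist x (frontier Ω) := hx
      have h2 : Metric.infDist x (frontier Ω) ≤ r / 2 := hx'
      linarith)
  refine ⟨f, f.contMDiff.contDiff, ?_, fun x hx => ?_⟩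
  · have hsub : tsupport f ⊆ {x | Metric.infDist x (frontier Ω) ≤ 3 / 4 * r} := by
      refine closure_minimal (fun x hx => ?_) (isClosed_le hc continuous_const)
      by_contra hcon
      have h1 : ¬ Metric.infDist x (frontier Ω) ≤ 3 / 4 * r := hcon
      exact hx (hf0 (show 3 / 4 * r ≤ Metric.infDist x (frontier Ω) by linarith))
    intro x hx
    have h1 : Metric.infDist x (frontier Ω) ≤ 3 / 4 * r := hsub hx
    rw [mem_layer]
    linarith
  · exact hf1 (show Metric.infDist x (frontier Ω) ≤ r / 2 from (mem_layer.1 hx).le)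

/-- The dilation `x̄ + t n(x̄) ↦ x̄ + a t n(x̄)` by `a` of the normal variable, where `τ` is the field
`x̄ + t n(x̄) ↦ t n(x̄)`. -/
def dilate (τ : RN N → RN N) (a : ℝ) (x : RN N) : RN N := x + (a - 1) • τ x

theorem contDiff_dilate {τ : RN N → RN N} (h : ContDiff ℝ ∞ τ) (a : ℝ) :
    ContDiff ℝ ∞ (dilate τ a) := contDiff_id.add (h.const_smul _)

/-- The signed distance `t` and a smooth global extension `τ` of the field `x̄ + t n(x̄) ↦ t n(x̄)`
on the layer of width `r`, with their main properties. -/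
structure IsNormalField (Ω : Set (RN N)) (r : ℝ) (τ : RN N → RN N) (t : RN N → ℝ) : Prop where
  isOpen : IsOpen Ω
  isBounded : Bornology.IsBounded Ω
  frontier_nonempty : (frontier Ω).Nonempty
  zero : ∀ x ∈ frontier Ω, τ x = 0
  contDiff : ContDiff ℝ ∞ τ
  contDiffOn : ContDiffOn ℝ ∞ t (layer Ω r)
  abs_eq : ∀ x ∈ layer Ω r, |t x| = Metric.infDist x (frontier Ω)
  mem_iff : ∀ x ∈ layer Ω r, (x ∈ Ω ↔ t x < 0)
  dilate_apply : ∀ x ∈ layer Ω r, ∀ a : ℝ, |a| * Metric.infDist x (frontier Ω) < r →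
    dilate τ a x ∈ layer Ω r ∧ t (dilate τ a x) = a * t x ∧ τ (dilate τ a x) = a • τ x
  fderiv_eq : ∀ x ∈ frontier Ω, ∃ n : RN N, ‖n‖ = 1 ∧
    (∀ v, fderiv ℝ τ x v = (inner ℝ n v : ℝ) • n) ∧ ∀ v, fderiv ℝ t x v = inner ℝ n v

theorem IsTubularChart.foot_eq_self {r : ℝ} {p n : RN N → RN N} {t : RN N → ℝ}
    (h : IsTubularChart Ω r p n t) {x : RN N} (hx : x ∈ frontier Ω) : p x = x ∧ t x = 0 := by
  have := h.unique x hx 0 (by simpa using h.pos)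
  simpa using this.2

/-- Along the normal `t` is the parameter itself. Inward directions make `t` negative, so the
derivative is nonpositive on them and, in the limit, on tangential directions; replacing `w` by `-w`
makes it vanish there. -/
theorem IsTubularChart.fderiv_t {r : ℝ} {p n : RN N → RN N} {t : RN N → ℝ}
    (h : IsTubularChart Ω r p n t) (hΩ : IsSmoothBoundedDomain Ω) {x : RN N}
    (hx : x ∈ frontier Ω) (v : RN N) : fderiv ℝ t x v = inner ℝ (outwardNormal Ω x) v := by
  have hn := hΩ.norm_outwardNormal hx
  have hO := hΩ.isOutwardUnitNormal hx
  set n := outwardNormal Ω x with hndef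
  have hnn : inner ℝ n n = (1 : ℝ) := by rw [real_inner_self_eq_norm_sq, hn]; norm_num
  have hxl : x ∈ layer Ω r := frontier_subset_layer h.pos hx
  have hd : DifferentiableAt ℝ t x :=
    (h.contDiffOn_t.contDiffAt ((isOpen_layer Ω r).mem_nhds hxl)).differentiableAt (by simp)
  have hLn : fderiv ℝ t x n = 1 := by
    have h1 : HasDerivAt (fun s : ℝ => t (x + s • n)) (fderiv ℝ t x n) 0 := by
      have h1 : HasFDerivAt t (fderiv ℝ t x) (x + (0 : ℝ) • n) := by
        simpa using hd.hasFDerivAt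
      have h2 : HasDerivAt (fun s : ℝ => x + s • n) n 0 := by
        simpa using ((hasDerivAt_id (0 : ℝ)).smul_const n).const_add x
      exact h1.comp_hasDerivAt (0 : ℝ) h2
    have h2 : HasDerivAt (fun s : ℝ => t (x + s • n)) 1 0 := by
      refine (hasDerivAt_id (0 : ℝ)).congr_of_eventuallyEq ?_
      have hev : ∀ᶠ s : ℝ in 𝓝 0, |s| < r :=
        continuous_abs.continuousAt.eventually (Iio_mem_nhds (by simpa using h.pos))
      filter_upwards [hev] with s hs
      exact (h.unique x hx s hs).2.2
    exact h1.unique h2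
  have hneg : ∀ w : RN N, inner ℝ n w < 0 → fderiv ℝ t x w ≤ 0 := by
    intro w hw
    by_contra hcon
    push Not at hcon
    have h1 := eventually_line_neg hd.neg (v := w) (by simp [(h.foot_eq_self hx).2])
      (by rw [fderiv_neg]; simpa using hcon)
    have h2 : ∀ᶠ s : ℝ in 𝓝[>] 0, x + s • w ∈ layer Ω r := by
      have hc : Continuous fun s : ℝ => x + s • w := by fun_prop
      have : Tendsto (fun s : ℝ => x + s • w) (𝓝 0) (𝓝 x) := by simpa using hc.tendsto 0
      exact (this.eventually ((isOpen_layer Ω r).mem_nhds hxl)).filter_mono nhdsWithin_le_nhds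
    obtain ⟨s, ⟨h3, h4⟩, h5⟩ := ((h1.and h2).and (hO.2.1 w hw)).exists
    have h6 := (h.mem_iff _ h4).1 h5
    simp only [Pi.neg_apply] at h3
    linarith
  have hperp : ∀ w : RN N, inner ℝ n w = 0 → fderiv ℝ t x w ≤ 0 := by
    intro w hw
    refine le_of_forall_pos_le_add fun ε hε => ?_
    have := hneg (w - ε • n) (by rw [inner_sub_right, inner_smul_right, hw, hnn]; linarith)
    rw [map_sub, map_smul, hLn, smul_eq_mul] at this
    linarith
  set w := v - (inner ℝ n v : ℝ) • n with hw
  have hnw : inner ℝ n w = 0 := by rw [hw, inner_sub_right, inner_smul_right, hnn]; ring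
  have h1 := hperp w hnw
  have h2 := hperp (-w) (by rw [inner_neg_right, hnw, neg_zero])
  rw [map_neg] at h2
  have h3 : fderiv ℝ t x w = 0 := by linarith
  rw [hw, map_sub, map_smul, hLn, smul_eq_mul] at h3
  linarith

theorem IsTubularChart.exists_isNormalField {r : ℝ} {p n : RN N → RN N} {t : RN N → ℝ}
    (h : IsTubularChart Ω r p n t) (hΩ : IsSmoothBoundedDomain Ω) :
    ∃ τ, IsNormalField Ω (r / 2) τ t ∧ ∀ x ∈ layer Ω (r / 2), τ x = t x • n x := by
  have hr := h.pos
  obtain ⟨χ, hχ, hχs, hχ1⟩ := exists_layer_cutoff Ω hr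
  have hsub : layer Ω (r / 2) ⊆ layer Ω r := layer_mono (by linarith)
  have hτ : ∀ x ∈ layer Ω (r / 2), χ x • t x • n x = t x • n x := by
    intro x hx
    rw [hχ1 x hx, one_smul]
  -- The cutoff makes the field globally smooth. It equals one on the layer of half the width, where
  -- the exact identities for dilations survive.
  refine ⟨fun x => χ x • t x • n x, ⟨hΩ.isOpen, hΩ.isBounded, h.frontier_nonempty,
    fun x hx => by simp [(h.foot_eq_self hx).2], ?_,
    h.contDiffOn_t.mono hsub, fun x hx => h.abs_eq x (hsub hx), fun x hx => h.mem_iff x (hsub hx),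
    fun x hx a ha => ?_, fun x hx => ?_⟩, hτ⟩
  · refine contDiff_of_tsupport_subset (isOpen_layer Ω r)
      (hχ.contDiffOn.smul (h.contDiffOn_t.smul h.contDiffOn_n)) ?_
    exact (tsupport_smul_subset_left χ _).trans hχs
  · have hxr := hsub hx
    have h1 := h.eq_add x hxr
    have h2 := h.normal_eq x hxr
    have habs : |a * t x| < r / 2 := by rw [abs_mul, h.abs_eq x hxr]; exact ha
    have h3 := h.unique (p x) (h.foot_mem x hxr) (a * t x) (by linarith)
    have h4 : dilate (fun x => χ x • t x • n x) a x
        = p x + (a * t x) • outwardNormal Ω (p x) := by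
      rw [dilate, hτ x hx, ← h2]
      nth_rewrite 1 [h1]
      module
    have h5 := h.abs_eq _ h3.1
    rw [h3.2.2] at h5
    have h6 : p x + (a * t x) • outwardNormal Ω (p x) ∈ layer Ω (r / 2) := by
      rw [mem_layer, ← h5]; exact habs
    rw [h4]
    refine ⟨h6, h3.2.2, ?_⟩
    rw [hτ _ h6, hτ x hx, h.normal_eq _ h3.1, h3.2.1, h3.2.2, h2]
    module
  · have hxl : x ∈ layer Ω (r / 2) := frontier_subset_layer (by linarith) hx
    refine ⟨outwardNormal Ω x, hΩ.norm_outwardNormal hx, fun v => ?_, h.fderiv_t hΩ hx⟩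
    have hev : (fun x => χ x • t x • n x) =ᶠ[𝓝 x] fun x => t x • n x := by
      filter_upwards [(isOpen_layer Ω (r / 2)).mem_nhds hxl] with z hz using hτ z hz
    have hmem := (isOpen_layer Ω r).mem_nhds (hsub hxl)
    have hdt : DifferentiableAt ℝ t x := (h.contDiffOn_t.contDiffAt hmem).differentiableAt (by simp)
    have hdn : DifferentiableAt ℝ n x := (h.contDiffOn_n.contDiffAt hmem).differentiableAt (by simp)
    rw [hev.fderiv_eq, fderiv_fun_smul hdt hdn]
    have hp := h.foot_eq_self hx
    simp [hp.2, h.normal_eq x (hsub hxl), hp.1, h.fderiv_t hΩ hx]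

/-! ### Consequences for dilations -/

variable {r : ℝ} {τ : RN N → RN N} {t : RN N → ℝ}

theorem IsNormalField.infDist_dilate (h : IsNormalField Ω r τ t) {x : RN N} (hx : x ∈ layer Ω r)
    {a : ℝ} (ha : |a| * Metric.infDist x (frontier Ω) < r) :
    Metric.infDist (dilate τ a x) (frontier Ω) = |a| * Metric.infDist x (frontier Ω) := by
  obtain ⟨h1, h2, -⟩ := h.dilate_apply x hx a ha
  rw [← h.abs_eq _ h1, h2, abs_mul, h.abs_eq x hx]

theorem IsNormalField.dilate_dilate (h : IsNormalField Ω r τ t) {x : RN N} (hx : x ∈ layer Ω r)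
    {a : ℝ} (ha : |a| * Metric.infDist x (frontier Ω) < r) {b : ℝ} (hab : b * a = 1) :
    dilate τ b (dilate τ a x) = x := by
  obtain ⟨-, -, h3⟩ := h.dilate_apply x hx a ha
  rw [dilate, h3, dilate, smul_smul, show (b - 1) * a = 1 - a by linarith]
  module

theorem IsNormalField.dilate_eq_self (h : IsNormalField Ω r τ t) {x : RN N} (hx : x ∈ frontier Ω)
    (a : ℝ) : dilate τ a x = x := by
  rw [dilate, h.zero x hx, smul_zero, add_zero]

theorem IsNormalField.frontier_iff (h : IsNormalField Ω r τ t) {x : RN N} (hx : x ∈ layer Ω r) :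
    x ∈ frontier Ω ↔ t x = 0 := by
  rw [isClosed_frontier.mem_iff_infDist_zero h.frontier_nonempty, ← h.abs_eq x hx, abs_eq_zero]

theorem IsNormalField.notMem_closure_iff (h : IsNormalField Ω r τ t) {x : RN N}
    (hx : x ∈ layer Ω r) : x ∉ closure Ω ↔ 0 < t x := by
  rw [closure_eq_self_union_frontier, mem_union, h.mem_iff x hx, h.frontier_iff hx, not_or, not_lt]
  exact ⟨fun h' => lt_of_le_of_ne h'.1 (Ne.symm h'.2), fun h' => ⟨h'.le, h'.ne'⟩⟩

/-- The part of the layer of width `r` inside `Ω`. -/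
def innerLayer (Ω : Set (RN N)) (r : ℝ) : Set (RN N) := Ω ∩ layer Ω r

/-- The part of the layer of width `r` outside `Ω`. -/
def outerLayer (Ω : Set (RN N)) (r : ℝ) : Set (RN N) := layer Ω r ∩ (closure Ω)ᶜ

theorem isOpen_outerLayer (Ω : Set (RN N)) (r : ℝ) : IsOpen (outerLayer Ω r) :=
  (isOpen_layer Ω r).inter isClosed_closure.isOpen_compl

theorem IsNormalField.isOpen_innerLayer (h : IsNormalField Ω r τ t) (s : ℝ) :
    IsOpen (innerLayer Ω s) :=
  h.isOpen.inter (isOpen_layer Ω s)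

theorem IsNormalField.isBounded_layer (h : IsNormalField Ω r τ t) (s : ℝ) :
    Bornology.IsBounded (layer Ω s) := by
  have hb : Bornology.IsBounded (frontier Ω) := h.isBounded.closure.subset frontier_subset_closure
  refine (hb.thickening (δ := s)).subset fun x hx => ?_
  exact (Metric.mem_thickening_iff_infDist_lt h.frontier_nonempty).2 hx

/-! ### Reflections as bijections between the inner and the outer layers -/

section Bijection

variable {a δ : ℝ}

theorem IsNormalField.dilate_neg_mem_layer (h : IsNormalField Ω r τ t) (ha : 0 < a) (hδ : δ ≤ r)
    (haδ : a * δ ≤ r) {x : RN N} (hx : x ∈ layer Ω δ) :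
    dilate τ (-a) x ∈ layer Ω (a * δ) ∧ t (dilate τ (-a) x) = -(a * t x) ∧
      dilate τ (-a⁻¹) (dilate τ (-a) x) = x := by
  have hxr := layer_mono hδ hx
  have h1 : |-a| * Metric.infDist x (frontier Ω) < a * δ := by
    rw [abs_neg, abs_of_pos ha]
    exact mul_lt_mul_of_pos_left hx ha
  have h2 := h1.trans_le haδ
  refine ⟨?_, ?_, h.dilate_dilate hxr h2 (by field_simp)⟩
  · rw [mem_layer, h.infDist_dilate hxr h2]; exact h1
  · rw [(h.dilate_apply x hxr _ h2).2.1]; ring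

theorem IsNormalField.dilate_neg_inv_mem_layer (h : IsNormalField Ω r τ t) (ha : 0 < a)
    (hδ : δ ≤ r) (haδ : a * δ ≤ r) {x : RN N} (hx : x ∈ layer Ω (a * δ)) :
    dilate τ (-a⁻¹) x ∈ layer Ω δ ∧ t (dilate τ (-a⁻¹) x) = -(a⁻¹ * t x) ∧
      dilate τ (-a) (dilate τ (-a⁻¹) x) = x := by
  have h1 := h.dilate_neg_mem_layer (a := a⁻¹) (δ := a * δ) (inv_pos.2 ha) haδ
    (by rwa [inv_mul_cancel_left₀ ha.ne']) hx
  rwa [inv_inv, inv_mul_cancel_left₀ ha.ne'] at h1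

theorem IsNormalField.dilate_neg_mem_inner (h : IsNormalField Ω r τ t) (ha : 0 < a) (hδ : δ ≤ r)
    (haδ : a * δ ≤ r) {x : RN N} (hx : x ∈ outerLayer Ω δ) :
    dilate τ (-a) x ∈ innerLayer Ω (a * δ) := by
  obtain ⟨h1, h2, -⟩ := h.dilate_neg_mem_layer ha hδ haδ hx.1
  refine ⟨(h.mem_iff _ (layer_mono haδ h1)).2 ?_, h1⟩
  rw [h2]
  have := mul_pos ha ((h.notMem_closure_iff (layer_mono hδ hx.1)).1 hx.2)
  linarith

theorem IsNormalField.dilate_neg_inv_mem_outer (h : IsNormalField Ω r τ t) (ha : 0 < a)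
    (hδ : δ ≤ r) (haδ : a * δ ≤ r) {x : RN N} (hx : x ∈ innerLayer Ω (a * δ)) :
    dilate τ (-a⁻¹) x ∈ outerLayer Ω δ := by
  obtain ⟨h1, h2, -⟩ := h.dilate_neg_inv_mem_layer ha hδ haδ hx.2
  refine ⟨h1, (h.notMem_closure_iff (layer_mono hδ h1)).2 ?_⟩
  rw [h2]
  have := mul_neg_of_pos_of_neg (inv_pos.2 ha) ((h.mem_iff _ (layer_mono haδ hx.2)).1 hx.1)
  linarith

theorem IsNormalField.injOn_dilate (h : IsNormalField Ω r τ t) (ha : 0 < a)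
    (hδ : δ ≤ r) (haδ : a * δ ≤ r) : InjOn (dilate τ (-a⁻¹)) (layer Ω (a * δ)) := by
  intro x hx y hy hxy
  rw [← (h.dilate_neg_inv_mem_layer ha hδ haδ hx).2.2,
    ← (h.dilate_neg_inv_mem_layer ha hδ haδ hy).2.2, hxy]

theorem IsNormalField.image_layer (h : IsNormalField Ω r τ t) (ha : 0 < a)
    (hδ : δ ≤ r) (haδ : a * δ ≤ r) : dilate τ (-a⁻¹) '' layer Ω (a * δ) = layer Ω δ := by
  refine subset_antisymm ?_ fun x hx => ?_
  · rintro _ ⟨x, hx, rfl⟩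
    exact (h.dilate_neg_inv_mem_layer ha hδ haδ hx).1
  · obtain ⟨h1, -, h2⟩ := h.dilate_neg_mem_layer ha hδ haδ hx
    exact ⟨_, h1, h2⟩

theorem IsNormalField.image_innerLayer (h : IsNormalField Ω r τ t) (ha : 0 < a)
    (hδ : δ ≤ r) (haδ : a * δ ≤ r) :
    dilate τ (-a⁻¹) '' innerLayer Ω (a * δ) = outerLayer Ω δ := by
  refine subset_antisymm ?_ fun x hx => ?_
  · rintro _ ⟨x, hx, rfl⟩
    exact h.dilate_neg_inv_mem_outer ha hδ haδ hx
  · exact ⟨_, h.dilate_neg_mem_inner ha hδ haδ hx, (h.dilate_neg_mem_layer ha hδ haδ hx.1).2.2⟩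

end Bijection

/-! ### Jacobians of dilations -/

/-- The Jacobian determinant of a dilation. -/
noncomputable def dilateDet (τ : RN N → RN N) (a : ℝ) (x : RN N) : ℝ :=
  (fderiv ℝ (dilate τ a) x).det

/-- The Leibniz formula exhibits the determinant as a polynomial in the first partial derivatives.
-/
theorem contDiff_det_fderiv {g : RN N → RN N} (hg : ContDiff ℝ ∞ g) :
    ContDiff ℝ ∞ fun x => (fderiv ℝ g x).det := by
  set b := (EuclideanSpace.basisFun (Fin N) ℝ).toBasis
  have hdet : ∀ x, (fderiv ℝ g x).det
      = ∑ σ : Equiv.Perm (Fin N), ((Equiv.Perm.sign σ : ℤ) : ℝ) *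
        ∏ i, (fderiv ℝ g x (EuclideanSpace.single i 1)) (σ i) := by
    intro x
    rw [ContinuousLinearMap.det, ← LinearMap.det_toMatrix b, Matrix.det_apply']
    refine Finset.sum_congr rfl fun σ _ => ?_
    congr 1
  simp only [hdet]
  refine ContDiff.sum fun σ _ => contDiff_const.mul (contDiff_prod fun i _ => ?_)
  have h1 : ContDiff ℝ ∞ fun x => fderiv ℝ g x (EuclideanSpace.single i 1) :=
    (hg.fderiv_right (m := ∞) (by simp)).clm_apply contDiff_const
  exact contDiff_euclidean.1 h1 (σ i)

theorem fderiv_dilate (hτ : ContDiff ℝ ∞ τ) (a : ℝ) (x v : RN N) :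
    fderiv ℝ (dilate τ a) x v = v + (a - 1) • fderiv ℝ τ x v := by
  have hd : HasFDerivAt (dilate τ a)
      (ContinuousLinearMap.id ℝ (RN N) + (a - 1) • fderiv ℝ τ x) x :=
    (hasFDerivAt_id x).add ((hτ.differentiable (by simp) x).hasFDerivAt.fun_const_smul _)
  rw [hd.fderiv]
  simp

/-- On the boundary the derivative is `1 + (a - 1) n ⊗ n`, a transvection with determinant `1 + (a -
1) * ‖n‖ ^ 2`. -/
theorem IsNormalField.dilateDet_frontier (h : IsNormalField Ω r τ t) {x : RN N}
    (hx : x ∈ frontier Ω) (a : ℝ) : dilateDet τ a x = a := by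
  obtain ⟨n, hn, hn', -⟩ := h.fderiv_eq x hx
  have h1 : (fderiv ℝ (dilate τ a) x : RN N →ₗ[ℝ] RN N)
      = LinearMap.transvection (innerSL ℝ n : RN N →ₗ[ℝ] ℝ) ((a - 1) • n) := by
    refine LinearMap.ext fun v => ?_
    simp [fderiv_dilate h.contDiff, hn', LinearMap.transvection.apply, smul_smul, mul_comm]
  rw [dilateDet, ContinuousLinearMap.det, h1, LinearMap.transvection.det]
  simp [hn]

/-- The dilation by `0` fixes the boundary pointwise but has vanishing Jacobian there, so the
boundary is the image of a set of critical points and is null. -/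
theorem IsNormalField.volume_frontier (h : IsNormalField Ω r τ t) : volume (frontier Ω) = 0 := by
  have himg : dilate τ 0 '' frontier Ω = frontier Ω := by
    refine subset_antisymm ?_ fun x hx => ⟨x, hx, h.dilate_eq_self hx 0⟩
    rintro _ ⟨x, hx, rfl⟩
    rwa [h.dilate_eq_self hx]
  rw [← himg]
  refine addHaar_image_eq_zero_of_det_fderivWithin_eq_zero volume
    (f' := fun x => fderiv ℝ (dilate τ 0) x) (fun x _ =>
      ((contDiff_dilate h.contDiff 0).differentiable (by simp) x).hasFDerivAt.hasFDerivWithinAt)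
    fun x hx => h.dilateDet_frontier hx 0

theorem IsNormalField.dilateDet_ne_zero (h : IsNormalField Ω r τ t) {a δ : ℝ} (ha : 0 < a)
    (hδ : δ ≤ r) (haδ : a * δ ≤ r) {x : RN N} (hx : x ∈ layer Ω (a * δ)) :
    dilateDet τ (-a⁻¹) x ≠ 0 := by
  have hd : ∀ b : ℝ, Differentiable ℝ (dilate τ b) := fun b =>
    (contDiff_dilate h.contDiff b).differentiable (by simp)
  have hev : (dilate τ (-a) ∘ dilate τ (-a⁻¹)) =ᶠ[𝓝 x] id := by
    filter_upwards [(isOpen_layer Ω (a * δ)).mem_nhds hx] with z hz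
    exact (h.dilate_neg_inv_mem_layer ha hδ haδ hz).2.2
  have h1 := hev.fderiv_eq (𝕜 := ℝ)
  rw [fderiv_id, fderiv_comp x (hd _ _) (hd _ _)] at h1
  have h2 : (fderiv ℝ (dilate τ (-a)) (dilate τ (-a⁻¹) x)).det
      * (fderiv ℝ (dilate τ (-a⁻¹)) x).det = 1 := by
    have h3 := congrArg ContinuousLinearMap.det h1
    simpa [ContinuousLinearMap.det, ContinuousLinearMap.toLinearMap_comp, LinearMap.det_comp] using h3
  intro h0
  rw [dilateDet] at h0
  rw [h0, mul_zero] at h2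
  exact zero_ne_one h2

end Reflections

/-! ### Weak derivatives -/

section WeakDerivatives

variable {N : ℕ}

/-- The partial derivative `∂ᵢ φ`. -/
noncomputable def partialDeriv (i : Fin N) (φ : RN N → ℝ) (x : RN N) : ℝ :=
  fderiv ℝ φ x (EuclideanSpace.single i 1)

theorem contDiff_partialDeriv {φ : RN N → ℝ} (h : ContDiff ℝ ∞ φ) (i : Fin N) :
    ContDiff ℝ ∞ (partialDeriv i φ) :=
  (h.fderiv_right (m := ∞) (by simp)).clm_apply contDiff_const

theorem tsupport_partialDeriv_subset (i : Fin N) (φ : RN N → ℝ) :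
    tsupport (partialDeriv i φ) ⊆ tsupport φ := by
  refine closure_minimal (fun x hx => ?_) (isClosed_tsupport φ)
  by_contra hcon
  refine hx ?_
  rw [partialDeriv, fderiv_of_notMem_tsupport ℝ hcon]
  rfl

theorem hasCompactSupport_partialDeriv {φ : RN N → ℝ} (h : HasCompactSupport φ) (i : Fin N) :
    HasCompactSupport (partialDeriv i φ) :=
  h.of_isClosed_subset (isClosed_tsupport _) (tsupport_partialDeriv_subset i φ)

/-- First order weak derivatives, tested with partial derivatives. -/
theorem hasWeakDeriv_one_iff {U : Set (RN N)} {I : Fin 1 → Fin N} {f g : RN N → ℝ} :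
    HasWeakDeriv U I f g ↔ LocallyIntegrableOn f U volume ∧ LocallyIntegrableOn g U volume ∧
      ∀ φ : RN N → ℝ, ContDiff ℝ ∞ φ → HasCompactSupport φ → tsupport φ ⊆ U →
        ∫ x in U, f x * partialDeriv (I 0) φ x = -∫ x in U, g x * φ x := by
  simp only [HasWeakDeriv, iteratedFDeriv_one_apply, partialDeriv, pow_one, neg_one_mul]

theorem iteratedFDeriv_two_eq_partialDeriv {φ : RN N → ℝ} (h : ContDiff ℝ ∞ φ)
    (I : Fin 2 → Fin N) (x : RN N) :
    iteratedFDeriv ℝ 2 φ x (fun j => EuclideanSpace.single (I j) (1 : ℝ))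
      = partialDeriv (I 0) (partialDeriv (I 1) φ) x := by
  rw [iteratedFDeriv_two_apply, partialDeriv]
  have h1 : DifferentiableAt ℝ (fderiv ℝ φ) x :=
    (h.fderiv_right (m := ∞) (by simp)).differentiable (by simp) x
  have h2 : HasFDerivAt (partialDeriv (I 1) φ)
      ((ContinuousLinearMap.apply ℝ ℝ (EuclideanSpace.single (I 1) (1 : ℝ))).comp
        (fderiv ℝ (fderiv ℝ φ) x)) x :=
    ((ContinuousLinearMap.apply ℝ ℝ (EuclideanSpace.single (I 1) (1 : ℝ))).hasFDerivAt).comp x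
      h1.hasFDerivAt
  rw [h2.fderiv]
  rfl

theorem HasWeakDeriv.of_one_of_one {U : Set (RN N)} {I : Fin 2 → Fin N} {f g₀ g : RN N → ℝ}
    (h₀ : HasWeakDeriv U (fun _ : Fin 1 => I 0) f g₀)
    (h₁ : HasWeakDeriv U (fun _ : Fin 1 => I 1) g₀ g) : HasWeakDeriv U I f g := by
  rw [hasWeakDeriv_one_iff] at h₀ h₁
  refine ⟨h₀.1, h₁.2.1, fun φ hφ hc hs => ?_⟩
  simp only [iteratedFDeriv_two_eq_partialDeriv hφ]
  rw [h₀.2.2 _ (contDiff_partialDeriv hφ _) (hasCompactSupport_partialDeriv hc _)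
    ((tsupport_partialDeriv_subset _ _).trans hs), h₁.2.2 φ hφ hc hs]
  ring

/-- Membership in `W^{2,p}` provides second derivatives of `f` only; this makes them first
derivatives of the chosen `∂ⱼ f`, as a second application of the gluing lemma requires. -/
theorem HasWeakDeriv.one_of_two {U : Set (RN N)} {I : Fin 2 → Fin N} {f g₀ g : RN N → ℝ}
    (h₀ : HasWeakDeriv U (fun _ : Fin 1 => I 0) f g₀) (h : HasWeakDeriv U I f g) :
    HasWeakDeriv U (fun _ : Fin 1 => I 1) g₀ g := by
  rw [hasWeakDeriv_one_iff] at h₀ ⊢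
  refine ⟨h₀.2.1, h.2.1, fun φ hφ hc hs => ?_⟩
  have h1 := h.2.2 φ hφ hc hs
  simp only [iteratedFDeriv_two_eq_partialDeriv hφ] at h1
  rw [h₀.2.2 _ (contDiff_partialDeriv hφ _) (hasCompactSupport_partialDeriv hc _)
    ((tsupport_partialDeriv_subset _ _).trans hs)] at h1
  linarith

theorem hasWeakDeriv_zero_self {U : Set (RN N)} {I : Fin 0 → Fin N} {f : RN N → ℝ}
    (h : LocallyIntegrableOn f U volume) : HasWeakDeriv U I f f := by
  refine ⟨h, h, fun φ _ _ _ => ?_⟩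
  simp

theorem setIntegral_mul_eq_of_subset {U V : Set (RN N)} (hV : MeasurableSet V)
    (hUV : U ⊆ V) (f : RN N → ℝ) {φ : RN N → ℝ} (hs : tsupport φ ⊆ U) :
    ∫ x in V, f x * φ x = ∫ x in U, f x * φ x := by
  refine setIntegral_eq_of_subset_of_forall_sdiff_eq_zero hV hUV fun x hx => ?_
  rw [image_eq_zero_of_notMem_tsupport fun h => hx.2 (hs h), mul_zero]

theorem HasWeakDeriv.mono {m : ℕ} {U V : Set (RN N)} {I : Fin m → Fin N} {f g : RN N → ℝ}
    (h : HasWeakDeriv V I f g) (hV : IsOpen V) (hUV : U ⊆ V) : HasWeakDeriv U I f g := by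
  refine ⟨h.1.mono_set hUV, h.2.1.mono_set hUV, fun φ hφ hc hs => ?_⟩
  have h1 := h.2.2 φ hφ hc (hs.trans hUV)
  rw [setIntegral_mul_eq_of_subset hV.measurableSet hUV g hs] at h1
  rw [← h1]
  symm
  refine setIntegral_mul_eq_of_subset hV.measurableSet hUV f
    (φ := fun x => iteratedFDeriv ℝ m φ x fun j => EuclideanSpace.single (I j) (1 : ℝ)) ?_
  refine (closure_mono fun x hx => ?_).trans ((tsupport_iteratedFDeriv_subset m (𝕜 := ℝ)).trans hs)
  intro h0
  refine hx ?_
  simp only [h0]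
  rfl

theorem MeasureTheory.LocallyIntegrableOn.integrableOn_mul_test {U : Set (RN N)}
    {u φ : RN N → ℝ} (hu : LocallyIntegrableOn u U volume) (hφ : Continuous φ)
    (hc : HasCompactSupport φ) (hs : tsupport φ ⊆ U) :
    IntegrableOn (fun x => u x * φ x) U volume := by
  have h3 := (hu.integrableOn_compact_subset hs hc).mul_continuousOn hφ.continuousOn hc
  refine (IntegrableOn.integrable_of_forall_notMem_eq_zero h3 fun x hx => ?_).integrableOn
  rw [image_eq_zero_of_notMem_tsupport hx, mul_zero]

theorem HasWeakDeriv.ae_eq {m : ℕ} {U : Set (RN N)} {I : Fin m → Fin N} {f g g' : RN N → ℝ}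
    (h : HasWeakDeriv U I f g) (h' : HasWeakDeriv U I f g') (hU : IsOpen U) :
    g =ᵐ[volume.restrict U] g' := by
  have key : ∀ᵐ x ∂volume, x ∈ U → (g - g') x = 0 := by
    refine hU.ae_eq_zero_of_integral_contDiff_smul_eq_zero (h.2.1.sub h'.2.1)
      fun φ hφ hc hs => ?_
    have h1 : ∫ x in U, g x * φ x = ∫ x in U, g' x * φ x := by
      have h2 := (h.2.2 φ hφ hc hs).symm.trans (h'.2.2 φ hφ hc hs)
      exact mul_left_cancel₀ (pow_ne_zero m (by norm_num)) h2
    have h4 : ∫ x, φ x • (g - g') x = ∫ x in U, φ x • (g - g') x := by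
      refine (setIntegral_eq_integral_of_forall_compl_eq_zero fun x hx => ?_).symm
      rw [image_eq_zero_of_notMem_tsupport fun h => hx (hs h), zero_smul]
    rw [h4]
    have h5 : ∀ x, φ x • (g - g') x = g x * φ x - g' x * φ x := by
      intro x; simp only [Pi.sub_apply, smul_eq_mul]; ring
    simp only [h5]
    rw [integral_sub (h.2.1.integrableOn_mul_test hφ.continuous hc hs)
      (h'.2.1.integrableOn_mul_test hφ.continuous hc hs), h1, sub_self]
  rw [EventuallyEq, ae_restrict_iff' hU.measurableSet]
  filter_upwards [key] with x hx hxU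
  exact sub_eq_zero.1 (hx hxU)

theorem HasWeakDeriv.iInf_eLpNorm_eq {m : ℕ} {U : Set (RN N)} {I : Fin m → Fin N}
    {f g : RN N → ℝ} (h : HasWeakDeriv U I f g) (hU : IsOpen U) (p : ℝ≥0∞) :
    ⨅ (g' : RN N → ℝ) (_ : HasWeakDeriv U I f g'), eLpNorm g' p (volume.restrict U)
      = eLpNorm g p (volume.restrict U) := by
  refine le_antisymm (iInf₂_le g h) (le_iInf₂ fun g' h' => ?_)
  exact (eLpNorm_congr_ae (h.ae_eq h' hU)).le

theorem integrableOn_of_memLp {U : Set (RN N)} (hb : Bornology.IsBounded U) {p : ℝ≥0∞}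
    (hp : 1 ≤ p) {f : RN N → ℝ} (hf : MemLp f p (volume.restrict U)) : IntegrableOn f U volume := by
  have : IsFiniteMeasure (volume.restrict U) := ⟨by
    rw [Measure.restrict_apply_univ]; exact hb.measure_lt_top⟩
  exact hf.integrable hp

theorem integral_mul_partialDeriv {i : Fin N} {φ ψ : RN N → ℝ} (hφ : ContDiff ℝ ∞ φ)
    (hψ : ContDiff ℝ ∞ ψ) (hc : HasCompactSupport φ) :
    ∫ x, φ x * partialDeriv i ψ x = -∫ x, partialDeriv i φ x * ψ x := by
  refine integral_mul_fderiv_eq_neg_fderiv_mul_of_integrable ?_ ?_ ?_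
    (fun x _ => hφ.differentiable (by simp) x) (fun x _ => hψ.differentiable (by simp) x)
  · exact ((contDiff_partialDeriv hφ i).continuous.mul hψ.continuous).integrable_of_hasCompactSupport
      (hasCompactSupport_partialDeriv hc i).mul_right
  · exact (hφ.continuous.mul
      (contDiff_partialDeriv hψ i).continuous).integrable_of_hasCompactSupport hc.mul_right
  · exact (hφ.continuous.mul hψ.continuous).integrable_of_hasCompactSupport hc.mul_right

end WeakDerivatives

/-! ### Change of variables under dilations -/

section ChangeOfVariables

variable {N : ℕ} {Ω : Set (RN N)} {r : ℝ} {τ : RN N → RN N} {t : RN N → ℝ}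

theorem exists_bound_of_isBounded {E : Type*} [NormedAddCommGroup E] [ProperSpace E]
    {u : E → ℝ} (hu : Continuous u) {s : Set E} (hs : Bornology.IsBounded s) :
    ∃ M : ℝ≥0, 1 ≤ M ∧ ∀ x ∈ s, |u x| ≤ M := by
  obtain ⟨C, hC⟩ := hs.isCompact_closure.exists_bound_of_continuousOn hu.continuousOn
  refine ⟨max 1 C.toNNReal, le_max_left _ _, fun x hx => ?_⟩
  refine (hC x (subset_closure hx)).trans ?_
  rw [NNReal.coe_max]
  exact (Real.le_coe_toNNReal C).trans (le_max_right _ _)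

theorem continuous_dilateDet (hτ : ContDiff ℝ ∞ τ) (a : ℝ) : Continuous (dilateDet τ a) :=
  (contDiff_det_fderiv (contDiff_dilate hτ a)).continuous

theorem IsNormalField.setIntegral_layer (h : IsNormalField Ω r τ t) {a δ : ℝ} (ha : 0 < a)
    (hδ : δ ≤ r) (haδ : a * δ ≤ r) (g : RN N → ℝ) :
    ∫ x in layer Ω δ, g x
      = ∫ y in layer Ω (a * δ), |dilateDet τ (-a⁻¹) y| * g (dilate τ (-a⁻¹) y) := by
  rw [← h.image_layer ha hδ haδ]
  exact integral_image_eq_integral_abs_det_fderiv_smul volume (isOpen_layer Ω _).measurableSet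
    (fun x _ => ((contDiff_dilate h.contDiff _).differentiable
      (by simp) x).hasFDerivAt.hasFDerivWithinAt) (h.injOn_dilate ha hδ haδ) g

theorem IsNormalField.setIntegral_outerLayer (h : IsNormalField Ω r τ t) {a δ : ℝ} (ha : 0 < a)
    (hδ : δ ≤ r) (haδ : a * δ ≤ r) (g : RN N → ℝ) :
    ∫ x in outerLayer Ω δ, g x
      = ∫ y in innerLayer Ω (a * δ), |dilateDet τ (-a⁻¹) y| * g (dilate τ (-a⁻¹) y) := by
  rw [← h.image_innerLayer ha hδ haδ]
  exact integral_image_eq_integral_abs_det_fderiv_smul volume (h.isOpen_innerLayer _).measurableSet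
    (fun x _ => ((contDiff_dilate h.contDiff _).differentiable
      (by simp) x).hasFDerivAt.hasFDerivWithinAt)
    ((h.injOn_dilate ha hδ haδ).mono inter_subset_right) g

/-- The density of the pushforward is the Jacobian of the inverse reflection, bounded on the whole
layer of width `r`; hence `M` serves all `δ`. -/
theorem IsNormalField.exists_map_le (h : IsNormalField Ω r τ t) {a : ℝ} (ha : 0 < a) :
    ∃ M : ℝ≥0, 1 ≤ M ∧ ∀ δ, δ ≤ r → a * δ ≤ r →
      (volume.restrict (outerLayer Ω δ)).map (dilate τ (-a))
        ≤ (M : ℝ≥0∞) • volume.restrict (innerLayer Ω (a * δ)) := by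
  obtain ⟨M, hM1, hM⟩ := exists_bound_of_isBounded (continuous_dilateDet h.contDiff (-a⁻¹))
    (h.isBounded_layer r)
  refine ⟨M, hM1, fun δ hδ haδ => Measure.le_iff.2 fun E hE => ?_⟩
  have hmeas : Measurable (dilate τ (-a)) := (contDiff_dilate h.contDiff (-a)).continuous.measurable
  rw [Measure.map_apply hmeas hE, Measure.restrict_apply (hmeas hE), Measure.smul_apply,
    Measure.restrict_apply hE, smul_eq_mul]
  have hsub : dilate τ (-a) ⁻¹' E ∩ outerLayer Ω δ
      ⊆ dilate τ (-a⁻¹) '' (E ∩ innerLayer Ω (a * δ)) := by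
    rintro x ⟨hxE, hx⟩
    exact ⟨dilate τ (-a) x, ⟨hxE, h.dilate_neg_mem_inner ha hδ haδ hx⟩,
      (h.dilate_neg_mem_layer ha hδ haδ hx.1).2.2⟩
  have hms : MeasurableSet (E ∩ innerLayer Ω (a * δ)) :=
    hE.inter (h.isOpen_innerLayer _).measurableSet
  refine (measure_mono hsub).trans ?_
  rw [← lintegral_abs_det_fderiv_eq_addHaar_image volume hms
    (fun x _ => ((contDiff_dilate h.contDiff _).differentiable
      (by simp) x).hasFDerivAt.hasFDerivWithinAt)
    ((h.injOn_dilate ha hδ haδ).mono (inter_subset_right.trans inter_subset_right))]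
  calc _ ≤ ∫⁻ _ in E ∩ innerLayer Ω (a * δ), (M : ℝ≥0∞) := by
        refine setLIntegral_mono measurable_const fun x hx => ?_
        refine (ENNReal.ofReal_le_ofReal (hM x (layer_mono haδ hx.2.2))).trans ?_
        rw [ENNReal.ofReal_coe_nnreal]
    _ = _ := by rw [setLIntegral_const]

theorem IsNormalField.exists_eLpNorm_dilate_le (h : IsNormalField Ω r τ t) {a : ℝ} (ha : 0 < a) :
    ∃ M : ℝ≥0, ∀ δ, δ ≤ r → a * δ ≤ r → ∀ p : ℝ≥0∞, 1 ≤ p → ∀ f : RN N → ℝ,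
      AEStronglyMeasurable f (volume.restrict (innerLayer Ω (a * δ))) →
      AEStronglyMeasurable (fun x => f (dilate τ (-a) x)) (volume.restrict (outerLayer Ω δ)) ∧
      eLpNorm (fun x => f (dilate τ (-a) x)) p (volume.restrict (outerLayer Ω δ))
        ≤ M * eLpNorm f p (volume.restrict (innerLayer Ω (a * δ))) := by
  obtain ⟨M, hM1, hM⟩ := h.exists_map_le ha
  refine ⟨M, fun δ hδ haδ p hp f hf => ?_⟩
  have hle := hM δ hδ haδ
  have hmeas : Measurable (dilate τ (-a)) := (contDiff_dilate h.contDiff (-a)).continuous.measurable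
  have hM0 : (M : ℝ≥0∞) ≠ 0 := by
    have : (1 : ℝ≥0∞) ≤ M := by exact_mod_cast hM1
    exact (zero_lt_one.trans_le this).ne'
  have hf' : AEStronglyMeasurable f ((volume.restrict (outerLayer Ω δ)).map (dilate τ (-a))) :=
    (hf.mono_ac Measure.smul_absolutelyContinuous).mono_measure hle
  refine ⟨hf'.comp_measurable hmeas, ?_⟩
  have h1 : eLpNorm (fun x => f (dilate τ (-a) x)) p (volume.restrict (outerLayer Ω δ))
      = eLpNorm f p ((volume.restrict (outerLayer Ω δ)).map (dilate τ (-a))) :=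
    (eLpNorm_map_measure hf' hmeas.aemeasurable).symm
  rw [h1]
  refine (eLpNorm_mono_measure f hle).trans ?_
  rw [eLpNorm_smul_measure_of_ne_zero hM0, smul_eq_mul]
  gcongr
  conv_rhs => rw [← ENNReal.rpow_one (M : ℝ≥0∞)]
  -- The factor is `M ^ (1 / p)`. As `1 ≤ M` and `1 / p ≤ 1`, it is at most `M`, uniformly in `p`
  -- including `p = ∞`.
  refine ENNReal.rpow_le_rpow_of_exponent_le (by exact_mod_cast hM1) ?_
  rw [one_div, ENNReal.toReal_inv]
  rcases eq_or_ne p ∞ with rfl | hpt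
  · simp
  · exact inv_le_one_of_one_le₀ ((ENNReal.toReal_le_toReal ENNReal.one_ne_top hpt).2 hp)

end ChangeOfVariables

/-! ### Integration by parts with tangential vector fields -/

section Divergence

variable {N : ℕ} {Ω : Set (RN N)} {r : ℝ} {τ : RN N → RN N} {t : RN N → ℝ}

theorem deriv_smoothTransition_eq_zero {u : ℝ} (hu : u ∉ Icc (0 : ℝ) 1) :
    deriv Real.smoothTransition u = 0 := by
  rw [mem_Icc, not_and_or, not_le, not_le] at hu
  rcases hu with hu | hu
  · have : Real.smoothTransition =ᶠ[𝓝 u] fun _ => 0 := by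
      filter_upwards [Iio_mem_nhds hu] with z hz using
        Real.smoothTransition.zero_of_nonpos (le_of_lt hz)
    rw [this.deriv_eq, deriv_const]
  · have : Real.smoothTransition =ᶠ[𝓝 u] fun _ => 1 := by
      filter_upwards [Ioi_mem_nhds hu] with z hz using
        Real.smoothTransition.one_of_one_le (le_of_lt hz)
    rw [this.deriv_eq, deriv_const]

/-- With `u = -(k * t) - 1` the factor `u + 1` is `-(k * t)`. Thus the gradient of the cutoff, of
size `k`, is harmless after multiplication by a quantity of order `|t|`. -/
theorem exists_bound_deriv_smoothTransition :
    ∃ K : ℝ, 0 ≤ K ∧ ∀ u : ℝ, |deriv Real.smoothTransition u| * |u + 1| ≤ K := by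
  have hc : Continuous fun u : ℝ => deriv Real.smoothTransition u * (u + 1) :=
    ((Real.smoothTransition.contDiff (n := 1)).continuous_deriv le_rfl).mul (by fun_prop)
  obtain ⟨K, hK⟩ := (isCompact_Icc (a := (0 : ℝ)) (b := 1)).exists_bound_of_continuousOn
    hc.continuousOn
  refine ⟨max K 0, le_max_right _ _, fun u => ?_⟩
  by_cases hu : u ∈ Icc (0 : ℝ) 1
  · rw [← abs_mul]
    exact (hK u hu).trans (le_max_left _ _)
  · rw [deriv_smoothTransition_eq_zero hu, abs_zero, zero_mul]
    exact le_max_right _ _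

theorem partialDeriv_eq_zero_of_notMem {φ : RN N → ℝ} {x : RN N} (hx : x ∉ tsupport φ)
    (i : Fin N) : partialDeriv i φ x = 0 :=
  image_eq_zero_of_notMem_tsupport fun h => hx (tsupport_partialDeriv_subset i φ h)

theorem IsNormalField.contDiffOn_partialDeriv (h : IsNormalField Ω r τ t) (i : Fin N) :
    ContDiffOn ℝ ∞ (partialDeriv i t) (layer Ω r) :=
  (h.contDiffOn.fderiv_of_isOpen (m := ∞) (isOpen_layer Ω r) (by simp)).clm_apply contDiffOn_const

variable {V : Fin N → RN N → ℝ}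

/-- The component of a field supported in the layer along the gradient of the signed distance
vanishes at least linearly at the boundary if it vanishes there. -/
theorem IsNormalField.exists_normal_component_bound (h : IsNormalField Ω r τ t)
    (hV : ∀ j, ContDiff ℝ ∞ (V j)) (hVc : ∀ j, HasCompactSupport (V j))
    (hVs : ∀ j, tsupport (V j) ⊆ layer Ω r)
    (hV0 : ∀ y ∈ frontier Ω, ∑ j, V j y * partialDeriv j t y = 0) :
    ∃ L : ℝ, 0 ≤ L ∧ ∀ x ∈ layer Ω r, |∑ j, V j x * partialDeriv j t x| ≤ L * |t x| := by
  set D : RN N → ℝ := fun x => ∑ j, V j x * partialDeriv j t x with hD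
  have hcl : IsCompact (⋃ j, tsupport (V j)) := isCompact_iUnion fun j => hVc j
  have hDs : tsupport D ⊆ ⋃ j, tsupport (V j) := by
    refine closure_minimal (fun x hx => ?_) hcl.isClosed
    by_contra hcon
    simp only [mem_iUnion, not_exists] at hcon
    refine hx ?_
    simp only [hD]
    refine Finset.sum_eq_zero fun j _ => ?_
    rw [image_eq_zero_of_notMem_tsupport (hcon j), zero_mul]
  have hDc : HasCompactSupport D := hcl.of_isClosed_subset (isClosed_tsupport D) hDs
  have hDd : ContDiff ℝ ∞ D := by
    refine contDiff_of_tsupport_subset (isOpen_layer Ω r) ?_ (hDs.trans (iUnion_subset hVs))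
    exact ContDiffOn.sum fun j _ => (hV j).contDiffOn.mul (h.contDiffOn_partialDeriv j)
  obtain ⟨L, hL⟩ := hDd.lipschitzWith_of_hasCompactSupport hDc (by simp)
  refine ⟨L, L.2, fun x hx => ?_⟩
  have hcomp : IsCompact (frontier Ω) := Metric.isCompact_of_isClosed_isBounded isClosed_frontier
    (h.isBounded.closure.subset frontier_subset_closure)
  obtain ⟨y, hy, hxy⟩ := hcomp.exists_infDist_eq_dist h.frontier_nonempty x
  have h1 := hL.dist_le_mul x y
  rw [Real.dist_eq, show D y = 0 from hV0 y hy, sub_zero, ← hxy, ← h.abs_eq x hx] at h1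
  exact h1

/-- A cutoff in the signed distance, which vanishes near the boundary. -/
noncomputable def distCutoff (t : RN N → ℝ) (k : ℝ) (x : RN N) : ℝ :=
  Real.smoothTransition (-(k * t x) - 1)

theorem IsNormalField.contDiffOn_distCutoff (h : IsNormalField Ω r τ t) (k : ℝ) :
    ContDiffOn ℝ ∞ (distCutoff t k) (layer Ω r) :=
  Real.smoothTransition.contDiff.comp_contDiffOn
    (((contDiffOn_const.mul h.contDiffOn).neg).sub contDiffOn_const)

theorem IsNormalField.partialDeriv_distCutoff (h : IsNormalField Ω r τ t) (k : ℝ) {x : RN N}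
    (hx : x ∈ layer Ω r) (j : Fin N) : partialDeriv j (distCutoff t k) x
      = -(deriv Real.smoothTransition (-(k * t x) - 1) * (k * partialDeriv j t x)) := by
  have hd : DifferentiableAt ℝ t x :=
    (h.contDiffOn.contDiffAt ((isOpen_layer Ω r).mem_nhds hx)).differentiableAt (by simp)
  have h1 : HasFDerivAt (fun z => -(k * t z) - 1) (-(k • fderiv ℝ t x)) x :=
    ((hd.hasFDerivAt.const_mul k).neg).sub_const 1
  have h2 : HasDerivAt Real.smoothTransition (deriv Real.smoothTransition (-(k * t x) - 1))
      (-(k * t x) - 1) :=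
    ((Real.smoothTransition.contDiff (n := 1)).differentiable (by simp) _).hasDerivAt
  have h3 : HasFDerivAt (distCutoff t k) _ x := h2.comp_hasFDerivAt x h1
  rw [partialDeriv, h3.fderiv]
  simp [partialDeriv]

theorem IsNormalField.contDiff_distCutoff_mul (h : IsNormalField Ω r τ t) (k : ℝ)
    {v : RN N → ℝ} (hv : ContDiff ℝ ∞ v) (hvs : tsupport v ⊆ layer Ω r) :
    ContDiff ℝ ∞ fun x => distCutoff t k x * v x :=
  contDiff_of_tsupport_subset (isOpen_layer Ω r)
    ((h.contDiffOn_distCutoff k).mul hv.contDiffOn) ((tsupport_mul_subset_right).trans hvs)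

/-- The cutoff vanishes where `t ≥ -1 / k`, a neighbourhood of the part of the layer outside `Ω`;
the product is thus an admissible test function on `Ω`. -/
theorem IsNormalField.tsupport_distCutoff_mul (h : IsNormalField Ω r τ t) {k : ℝ} (hk : 0 < k)
    {v : RN N → ℝ} (hvs : tsupport v ⊆ layer Ω r) :
    tsupport (fun x => distCutoff t k x * v x) ⊆ Ω := by
  intro x hx
  have hxl : x ∈ layer Ω r := hvs (tsupport_mul_subset_right hx)
  rw [h.mem_iff x hxl]
  by_contra hcon
  push Not at hcon
  have hct : ContinuousAt t x := (h.contDiffOn.contDiffAt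
    ((isOpen_layer Ω r).mem_nhds hxl)).continuousAt
  have hev : ∀ᶠ z in 𝓝 x, -(1 / k) < t z :=
    hct.eventually (Ioi_mem_nhds (by have : 0 < 1 / k := by positivity
                                     linarith))
  have h0 : (fun z => distCutoff t k z * v z) =ᶠ[𝓝 x] fun _ => 0 := by
    filter_upwards [hev] with z hz
    have : -(k * t z) - 1 ≤ 0 := by
      have h1 : k * (-(1 / k)) < k * t z := mul_lt_mul_of_pos_left hz hk
      have h2 : k * (-(1 / k)) = -1 := by field_simp
      linarith
    rw [distCutoff, Real.smoothTransition.zero_of_nonpos this, zero_mul]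
  exact notMem_tsupport_iff_eventuallyEq.2 h0 hx

theorem integrable_mul_of_hasCompactSupport {μ : Measure (RN N)} {f v : RN N → ℝ}
    (hf : Integrable f μ) (hv : Continuous v) (hc : HasCompactSupport v) :
    Integrable (fun x => f x * v x) μ := by
  obtain ⟨C, hC⟩ := hv.bounded_above_of_compact_support hc
  exact hf.mul_bdd hv.aestronglyMeasurable (ae_of_all _ hC)

theorem partialDeriv_mul {u v : RN N → ℝ} {x : RN N} (hu : DifferentiableAt ℝ u x)
    (hv : DifferentiableAt ℝ v x) (j : Fin N) :
    partialDeriv j (fun z => u z * v z) x = partialDeriv j u x * v x + u x * partialDeriv j v x := by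
  rw [partialDeriv, fderiv_fun_mul hu hv]
  simp [partialDeriv]
  ring

/-- The divergence of a cut off field, estimated uniformly. -/
theorem IsNormalField.exists_div_distCutoff_bound (h : IsNormalField Ω r τ t)
    (hV : ∀ j, ContDiff ℝ ∞ (V j)) (hVc : ∀ j, HasCompactSupport (V j))
    (hVs : ∀ j, tsupport (V j) ⊆ layer Ω r)
    (hV0 : ∀ y ∈ frontier Ω, ∑ j, V j y * partialDeriv j t y = 0) :
    ∃ M : ℝ, ∀ k : ℝ, 0 < k → ∀ x,
      |∑ j, partialDeriv j (fun z => distCutoff t k z * V j z) x| ≤ M := by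
  obtain ⟨L, hL0, hL⟩ := h.exists_normal_component_bound hV hVc hVs hV0
  obtain ⟨K, hK0, hK⟩ := exists_bound_deriv_smoothTransition
  have hB : ∀ j, ∃ B : ℝ, ∀ x, ‖partialDeriv j (V j) x‖ ≤ B := fun j =>
    (contDiff_partialDeriv (hV j) j).continuous.bounded_above_of_compact_support
      (hasCompactSupport_partialDeriv (hVc j) j)
  choose B hB using hB
  have hB0 : 0 ≤ ∑ j, B j := Finset.sum_nonneg fun j _ => (norm_nonneg _).trans (hB j 0)
  refine ⟨∑ j, B j + L * K, fun k hk x => ?_⟩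
  by_cases hx : x ∈ layer Ω r
  · have hmem := (isOpen_layer Ω r).mem_nhds hx
    -- The gradient of the cutoff is parallel to that of `t`, so it only sees the normal component
    -- of `V`, which is at most `L * |t|`.
    have heq : ∑ j, partialDeriv j (fun z => distCutoff t k z * V j z) x
        = distCutoff t k x * ∑ j, partialDeriv j (V j) x
          - deriv Real.smoothTransition (-(k * t x) - 1) * k *
            ∑ j, V j x * partialDeriv j t x := by
      rw [Finset.mul_sum, Finset.mul_sum, ← Finset.sum_sub_distrib]
      refine Finset.sum_congr rfl fun j _ => ?_
      rw [partialDeriv_mul (((h.contDiffOn_distCutoff k).contDiffAt hmem).differentiableAt (by simp))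
        ((hV j).differentiable (by simp) x), h.partialDeriv_distCutoff k hx]
      ring
    rw [heq]
    refine (abs_sub _ _).trans (add_le_add ?_ ?_)
    · rw [abs_mul]
      have h1 : |distCutoff t k x| ≤ 1 := by
        rw [distCutoff, abs_of_nonneg (Real.smoothTransition.nonneg _)]
        exact Real.smoothTransition.le_one _
      refine (mul_le_of_le_one_left (abs_nonneg _) h1).trans ?_
      exact (Finset.abs_sum_le_sum_abs _ _).trans (Finset.sum_le_sum fun j _ => hB j x)
    · rw [abs_mul, abs_mul, abs_of_pos hk]
      have h1 := hK (-(k * t x) - 1)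
      rw [sub_add_cancel, abs_neg, abs_mul, abs_of_pos hk] at h1
      calc _ ≤ |deriv Real.smoothTransition (-(k * t x) - 1)| * k * (L * |t x|) := by
            gcongr
            exact hL x hx
        _ = L * (|deriv Real.smoothTransition (-(k * t x) - 1)| * (k * |t x|)) := by ring
        _ ≤ _ := by gcongr
  · have h0 : ∑ j, partialDeriv j (fun z => distCutoff t k z * V j z) x = 0 := by
      refine Finset.sum_eq_zero fun j _ => partialDeriv_eq_zero_of_notMem ?_ j
      exact fun h' => hx (hVs j (tsupport_mul_subset_right h'))
    rw [h0, abs_zero]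
    positivity

/-- The cutoff equals one where `t ≤ -2 / (n + 1)`. Equality of germs, rather than of values, also
identifies the derivatives; the threshold `4 / -t x` secures it on the neighbourhood where `t z < t
x / 2`. -/
theorem IsNormalField.eventually_distCutoff_mul_eq (h : IsNormalField Ω r τ t)
    (hVs : ∀ j, tsupport (V j) ⊆ layer Ω r) {x : RN N} (hx : x ∈ Ω) :
    ∀ᶠ n : ℕ in atTop, ∀ j, (fun z => distCutoff t (n + 1) z * V j z) =ᶠ[𝓝 x] V j := by
  by_cases hxl : x ∈ layer Ω r
  · have hneg := (h.mem_iff x hxl).1 hx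
    have hct : ContinuousAt t x := (h.contDiffOn.contDiffAt
      ((isOpen_layer Ω r).mem_nhds hxl)).continuousAt
    have hev : ∀ᶠ z in 𝓝 x, t z < t x / 2 := hct.eventually (Iio_mem_nhds (by linarith))
    obtain ⟨n₀, hn₀⟩ := exists_nat_gt (4 / -t x)
    filter_upwards [eventually_ge_atTop n₀] with n hn j
    filter_upwards [hev] with z hz
    have hn' : (n₀ : ℝ) ≤ n := by exact_mod_cast hn
    rw [div_lt_iff₀ (by linarith)] at hn₀
    have h1 : (1 : ℝ) ≤ -((n + 1) * t z) - 1 := by nlinarith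
    rw [distCutoff, Real.smoothTransition.one_of_one_le h1, one_mul]
  · refine Eventually.of_forall fun n j => ?_
    have hx' : x ∉ tsupport (V j) := fun h' => hxl (hVs j h')
    have h0 := notMem_tsupport_iff_eventuallyEq.1 hx'
    filter_upwards [h0] with z hz
    rw [hz, Pi.zero_apply, mul_zero]

/-- Integration by parts on `Ω` for fields supported in the layer which are tangential on the
boundary. -/
theorem IsNormalField.integral_mul_div (h : IsNormalField Ω r τ t)
    (hV : ∀ j, ContDiff ℝ ∞ (V j)) (hVc : ∀ j, HasCompactSupport (V j))
    (hVs : ∀ j, tsupport (V j) ⊆ layer Ω r)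
    (hV0 : ∀ y ∈ frontier Ω, ∑ j, V j y * partialDeriv j t y = 0)
    {f : RN N → ℝ} {g : Fin N → RN N → ℝ} (hf : IntegrableOn f Ω volume)
    (hg : ∀ j, IntegrableOn (g j) Ω volume)
    (hw : ∀ j, HasWeakDeriv Ω (fun _ : Fin 1 => j) f (g j)) :
    ∫ x in Ω, f x * ∑ j, partialDeriv j (V j) x = -∫ x in Ω, ∑ j, g j x * V j x := by
  obtain ⟨M, hM⟩ := h.exists_div_distCutoff_bound hV hVc hVs hV0
  have hwd : ∀ (k : ℝ) j, ContDiff ℝ ∞ fun z => distCutoff t k z * V j z := fun k j =>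
    h.contDiff_distCutoff_mul k (hV j) (hVs j)
  have hwc : ∀ (k : ℝ) j, HasCompactSupport fun z => distCutoff t k z * V j z := fun k j =>
    (hVc j).mul_left
  have hk : ∀ n : ℕ, (0 : ℝ) < n + 1 := fun n => by positivity
  have hstep : ∀ n : ℕ,
      ∫ x in Ω, f x * ∑ j, partialDeriv j (fun z => distCutoff t (n + 1) z * V j z) x
        = -∫ x in Ω, ∑ j, g j x * (distCutoff t (n + 1) x * V j x) := by
    intro n
    simp only [Finset.mul_sum]
    rw [integral_finsetSum _ fun j _ => integrable_mul_of_hasCompactSupport hf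
        (contDiff_partialDeriv (hwd _ j) j).continuous (hasCompactSupport_partialDeriv (hwc _ j) j),
      integral_finsetSum _ fun j _ => integrable_mul_of_hasCompactSupport (hg j)
        (hwd _ j).continuous (hwc _ j), ← Finset.sum_neg_distrib]
    refine Finset.sum_congr rfl fun j _ => ?_
    exact (hasWeakDeriv_one_iff.1 (hw j)).2.2 _ (hwd _ j) (hwc _ j)
      (h.tsupport_distCutoff_mul (hk n) (hVs j))
  have hev : ∀ᵐ x ∂(volume.restrict Ω), ∀ᶠ n : ℕ in atTop, ∀ j,
      (fun z => distCutoff t (n + 1) z * V j z) =ᶠ[𝓝 x] V j := by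
    filter_upwards [ae_restrict_mem h.isOpen.measurableSet] with x hx
      using h.eventually_distCutoff_mul_eq hVs hx
  have hl : Tendsto (fun n : ℕ => ∫ x in Ω,
      f x * ∑ j, partialDeriv j (fun z => distCutoff t (n + 1) z * V j z) x) atTop
      (𝓝 (∫ x in Ω, f x * ∑ j, partialDeriv j (V j) x)) := by
    -- The uniform divergence bound supplies the majorant; here the tangency of `V` replaces a trace
    -- argument.
    refine tendsto_integral_of_dominated_convergence (fun x => |f x| * M) (fun n => ?_)
      (hf.abs.mul_const M) (fun n => ae_of_all _ fun x => ?_) ?_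
    · exact hf.aestronglyMeasurable.mul (continuous_finsetSum _ fun j _ =>
        (contDiff_partialDeriv (hwd _ j) j).continuous).aestronglyMeasurable
    · rw [Real.norm_eq_abs, abs_mul]
      gcongr
      exact hM _ (hk n) x
    · filter_upwards [hev] with x hx
      refine tendsto_const_nhds.congr' ?_
      filter_upwards [hx] with n hn
      congr 1
      refine Finset.sum_congr rfl fun j _ => ?_
      rw [partialDeriv, partialDeriv, (hn j).fderiv_eq]
  have hr : Tendsto (fun n : ℕ => -∫ x in Ω, ∑ j, g j x * (distCutoff t (n + 1) x * V j x)) atTop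
      (𝓝 (-∫ x in Ω, ∑ j, g j x * V j x)) := by
    refine Tendsto.neg ?_
    refine tendsto_integral_of_dominated_convergence (fun x => ∑ j, |g j x * V j x|) (fun n => ?_)
      ?_ (fun n => ae_of_all _ fun x => ?_) ?_
    · exact (integrable_finsetSum _ fun j _ => integrable_mul_of_hasCompactSupport (hg j)
        (hwd _ j).continuous (hwc _ j)).aestronglyMeasurable
    · exact integrable_finsetSum _ fun j _ => (integrable_mul_of_hasCompactSupport (hg j)
        (hV j).continuous (hVc j)).abs
    · refine (Finset.abs_sum_le_sum_abs _ _).trans (Finset.sum_le_sum fun j _ => ?_)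
      rw [show g j x * (distCutoff t (n + 1) x * V j x) = distCutoff t (n + 1) x * (g j x * V j x)
        by ring, abs_mul]
      refine mul_le_of_le_one_left (abs_nonneg _) ?_
      rw [distCutoff, abs_of_nonneg (Real.smoothTransition.nonneg _)]
      exact Real.smoothTransition.le_one _
    · filter_upwards [hev] with x hx
      refine tendsto_const_nhds.congr' ?_
      filter_upwards [hx] with n hn
      refine Finset.sum_congr rfl fun j _ => ?_
      exact congrArg (g j x * ·) (hn j).eq_of_nhds.symm
  exact tendsto_nhds_unique hl (hr.congr fun n => (hstep n).symm)

end Divergence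

/-! ### The Piola transform under dilations -/

section Piola

variable {N : ℕ} {Ω : Set (RN N)} {r : ℝ} {τ : RN N → RN N} {t : RN N → ℝ}

/-- The partial derivative `∂ᵢ` of the `j`-th component of the dilation by `-a`. -/
noncomputable def dilatePartial (τ : RN N → RN N) (a : ℝ) (i j : Fin N) (x : RN N) : ℝ :=
  fderiv ℝ (dilate τ (-a)) x (EuclideanSpace.single i 1) j

theorem contDiff_dilatePartial (hτ : ContDiff ℝ ∞ τ) (a : ℝ) (i j : Fin N) :
    ContDiff ℝ ∞ (dilatePartial τ a i j) := by
  have h1 : ContDiff ℝ ∞ fun x => fderiv ℝ (dilate τ (-a)) x (EuclideanSpace.single i 1) :=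
    ((contDiff_dilate hτ _).fderiv_right (m := ∞) (by simp)).clm_apply contDiff_const
  exact contDiff_euclidean.1 h1 j

theorem partialDeriv_comp_dilate (hτ : ContDiff ℝ ∞ τ) (a : ℝ) {w : RN N → ℝ}
    (hw : ContDiff ℝ ∞ w) (i : Fin N) (x : RN N) :
    partialDeriv i (fun z => w (dilate τ (-a) z)) x
      = ∑ j, dilatePartial τ a i j x * partialDeriv j w (dilate τ (-a) x) := by
  have h1 := fderiv_comp x (hw.differentiable (by simp) (dilate τ (-a) x))
    ((contDiff_dilate hτ (-a)).differentiable (by simp) x)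
  have h2 : partialDeriv i (fun z => w (dilate τ (-a) z)) x
      = fderiv ℝ w (dilate τ (-a) x) (fderiv ℝ (dilate τ (-a)) x (EuclideanSpace.single i 1)) := by
    rw [partialDeriv]
    exact congrArg (fun L : RN N →L[ℝ] ℝ => L (EuclideanSpace.single i 1)) h1
  rw [h2, ← sum_mul_apply_single]
  rfl

/-- The Piola transform of the field `ψ eᵢ` under the dilation by `-a`. -/
noncomputable def piola (Ω : Set (RN N)) (τ : RN N → RN N) (a δ : ℝ) (i : Fin N) (ψ : RN N → ℝ)
    (j : Fin N) : RN N → ℝ :=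
  (layer Ω (a * δ)).indicator fun y => |dilateDet τ (-a⁻¹) y| *
    (ψ (dilate τ (-a⁻¹) y) * dilatePartial τ a i j (dilate τ (-a⁻¹) y))

variable {a δ : ℝ} {ψ : RN N → ℝ}

theorem piola_apply {y : RN N} (hy : y ∈ layer Ω (a * δ)) (i j : Fin N) :
    piola Ω τ a δ i ψ j y = |dilateDet τ (-a⁻¹) y| *
      (ψ (dilate τ (-a⁻¹) y) * dilatePartial τ a i j (dilate τ (-a⁻¹) y)) :=
  indicator_of_mem hy _

theorem IsNormalField.tsupport_piola (h : IsNormalField Ω r τ t) (ha : 0 < a) (hδ : δ ≤ r)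
    (haδ : a * δ ≤ r) (hc : HasCompactSupport ψ) (i j : Fin N) :
    tsupport (piola Ω τ a δ i ψ j) ⊆ dilate τ (-a) '' tsupport ψ := by
  refine closure_minimal (fun y hy => ?_)
    (hc.image (contDiff_dilate h.contDiff (-a)).continuous).isClosed
  have hyl : y ∈ layer Ω (a * δ) := by
    by_contra hcon
    exact hy (indicator_of_notMem hcon _)
  refine ⟨dilate τ (-a⁻¹) y, ?_, (h.dilate_neg_inv_mem_layer ha hδ haδ hyl).2.2⟩
  by_contra hcon
  refine hy ?_
  rw [piola_apply hyl, image_eq_zero_of_notMem_tsupport hcon, zero_mul, mul_zero]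

theorem IsNormalField.tsupport_piola_layer (h : IsNormalField Ω r τ t) (ha : 0 < a) (hδ : δ ≤ r)
    (haδ : a * δ ≤ r) (hc : HasCompactSupport ψ) (hs : tsupport ψ ⊆ layer Ω δ) (i j : Fin N) :
    tsupport (piola Ω τ a δ i ψ j) ⊆ layer Ω (a * δ) := by
  refine (h.tsupport_piola ha hδ haδ hc i j).trans ?_
  rintro _ ⟨x, hx, rfl⟩
  exact (h.dilate_neg_mem_layer ha hδ haδ (hs hx)).1

theorem IsNormalField.hasCompactSupport_piola (h : IsNormalField Ω r τ t) (ha : 0 < a)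
    (hδ : δ ≤ r) (haδ : a * δ ≤ r) (hc : HasCompactSupport ψ) (i j : Fin N) :
    HasCompactSupport (piola Ω τ a δ i ψ j) :=
  (hc.image (contDiff_dilate h.contDiff (-a)).continuous).of_isClosed_subset (isClosed_tsupport _)
    (h.tsupport_piola ha hδ haδ hc i j)

theorem IsNormalField.contDiffOn_abs_dilateDet (h : IsNormalField Ω r τ t) (ha : 0 < a)
    (hδ : δ ≤ r) (haδ : a * δ ≤ r) :
    ContDiffOn ℝ ∞ (fun y => |dilateDet τ (-a⁻¹) y|) (layer Ω (a * δ)) := fun _ hy =>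
  ((contDiff_det_fderiv (contDiff_dilate h.contDiff (-a⁻¹))).contDiffAt.abs
    (h.dilateDet_ne_zero ha hδ haδ hy)).contDiffWithinAt

theorem IsNormalField.contDiff_piola (h : IsNormalField Ω r τ t) (ha : 0 < a) (hδ : δ ≤ r)
    (haδ : a * δ ≤ r) (hψ : ContDiff ℝ ∞ ψ) (hc : HasCompactSupport ψ)
    (hs : tsupport ψ ⊆ layer Ω δ) (i j : Fin N) : ContDiff ℝ ∞ (piola Ω τ a δ i ψ j) := by
  refine contDiff_of_tsupport_subset (isOpen_layer Ω (a * δ)) ?_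
    (h.tsupport_piola_layer ha hδ haδ hc hs i j)
  have hS := contDiff_dilate h.contDiff (-a⁻¹)
  refine ((h.contDiffOn_abs_dilateDet ha hδ haδ).mul ((hψ.comp hS).mul
    ((contDiff_dilatePartial h.contDiff a i j).comp hS)).contDiffOn).congr fun y hy => ?_
  exact piola_apply hy i j

/-- The Piola identity, obtained weakly and without differentiating determinants. Against a test
function `w`, one integrates by parts, changes variables, uses the chain rule for `w ∘ dilate τ
(-a)`, integrates by parts again and changes variables back. Both sides are continuous, so the
fundamental lemma applies. -/
theorem IsNormalField.div_piola (h : IsNormalField Ω r τ t) (ha : 0 < a) (hδ : δ ≤ r)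
    (haδ : a * δ ≤ r) (hψ : ContDiff ℝ ∞ ψ) (hc : HasCompactSupport ψ)
    (hs : tsupport ψ ⊆ layer Ω δ) (i : Fin N) : ∀ᵐ y ∂volume, y ∈ layer Ω (a * δ) →
      ∑ j, partialDeriv j (piola Ω τ a δ i ψ j) y
        = |dilateDet τ (-a⁻¹) y| * partialDeriv i ψ (dilate τ (-a⁻¹) y) := by
  have hS := contDiff_dilate h.contDiff (-a⁻¹)
  have hR := contDiff_dilate h.contDiff (-a)
  have hp := h.contDiff_piola ha hδ haδ hψ hc hs i
  have hpc := h.hasCompactSupport_piola ha hδ haδ hc i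
  have hpd : ∀ j, Continuous (partialDeriv j (piola Ω τ a δ i ψ j)) := fun j =>
    (contDiff_partialDeriv (hp j) j).continuous
  have hmeas : MeasurableSet (layer Ω (a * δ)) := (isOpen_layer Ω _).measurableSet
  have hdet : Continuous fun y => |dilateDet τ (-a⁻¹) y| := (continuous_dilateDet h.contDiff _).abs
  have hψS : Continuous fun y => partialDeriv i ψ (dilate τ (-a⁻¹) y) :=
    (contDiff_partialDeriv hψ i).continuous.comp hS.continuous
  have hcont : Continuous fun y => ∑ j, partialDeriv j (piola Ω τ a δ i ψ j) y
      - |dilateDet τ (-a⁻¹) y| * partialDeriv i ψ (dilate τ (-a⁻¹) y) :=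
    (continuous_finsetSum _ fun j _ => hpd j).sub (hdet.mul hψS)
  have key := (isOpen_layer Ω (a * δ)).ae_eq_zero_of_integral_contDiff_smul_eq_zero (μ := volume)
    (hcont.locallyIntegrable.locallyIntegrableOn _) fun w hw hwc hws => ?_
  · filter_upwards [key] with y hy hyl
    exact sub_eq_zero.1 (hy hyl)
  have hoff : ∀ y, y ∉ layer Ω (a * δ) → w y = 0 := fun y hy =>
    image_eq_zero_of_notMem_tsupport fun h' => hy (hws h')
  have hψoff : ∀ x, x ∉ layer Ω δ → x ∉ tsupport ψ := fun x hx h' => hx (hs h')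
  have e1 : ∫ y, w y * ∑ j, partialDeriv j (piola Ω τ a δ i ψ j) y
      = -∫ y, ∑ j, partialDeriv j w y * piola Ω τ a δ i ψ j y := by
    simp only [Finset.mul_sum]
    have hi1 : ∀ j, Integrable fun y => w y * partialDeriv j (piola Ω τ a δ i ψ j) y := fun j =>
      (hw.continuous.mul (hpd j)).integrable_of_hasCompactSupport hwc.mul_right
    have hi2 : ∀ j, Integrable fun y => partialDeriv j w y * piola Ω τ a δ i ψ j y := fun j =>
      ((contDiff_partialDeriv hw j).continuous.mul
        (hp j).continuous).integrable_of_hasCompactSupport (hpc j).mul_left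
    rw [integral_finsetSum _ fun j _ => hi1 j, integral_finsetSum _ fun j _ => hi2 j,
      ← Finset.sum_neg_distrib]
    exact Finset.sum_congr rfl fun j _ => integral_mul_partialDeriv hw (hp j) hwc
  have e2 : ∫ y, ∑ j, partialDeriv j w y * piola Ω τ a δ i ψ j y
      = ∫ x, ψ x * partialDeriv i (fun z => w (dilate τ (-a) z)) x := by
    refine (setIntegral_eq_integral_of_forall_compl_eq_zero (s := layer Ω (a * δ))
      fun y hy => ?_).symm.trans (Eq.trans ?_ (setIntegral_eq_integral_of_forall_compl_eq_zero
        (s := layer Ω δ) fun x hx => ?_))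
    · exact Finset.sum_eq_zero fun j _ => by rw [piola, indicator_of_notMem hy, mul_zero]
    · rw [h.setIntegral_layer ha hδ haδ]
      refine setIntegral_congr_fun hmeas fun y hy => ?_
      have h1 := (h.dilate_neg_inv_mem_layer ha hδ haδ hy).2.2
      simp only [partialDeriv_comp_dilate h.contDiff a hw, h1, piola_apply hy, Finset.mul_sum]
      exact Finset.sum_congr rfl fun j _ => by ring
    · rw [image_eq_zero_of_notMem_tsupport (hψoff x hx), zero_mul]
  have e3 : ∫ x, partialDeriv i ψ x * w (dilate τ (-a) x)
      = ∫ y, w y * (|dilateDet τ (-a⁻¹) y| * partialDeriv i ψ (dilate τ (-a⁻¹) y)) := by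
    refine (setIntegral_eq_integral_of_forall_compl_eq_zero (s := layer Ω δ)
      fun x hx => ?_).symm.trans (Eq.trans ?_ (setIntegral_eq_integral_of_forall_compl_eq_zero
        (s := layer Ω (a * δ)) fun y hy => ?_))
    · rw [partialDeriv_eq_zero_of_notMem (hψoff x hx), zero_mul]
    · rw [h.setIntegral_layer ha hδ haδ]
      refine setIntegral_congr_fun hmeas fun y hy => ?_
      have h1 := (h.dilate_neg_inv_mem_layer ha hδ haδ hy).2.2
      simp only [h1]
      ring
    · rw [hoff y hy, zero_mul]
  have e4 := integral_mul_partialDeriv (i := i) hψ (hw.comp hR) hc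
  have hi1 : Integrable fun y => w y * ∑ j, partialDeriv j (piola Ω τ a δ i ψ j) y :=
    (hw.continuous.mul (continuous_finsetSum _ fun j _ =>
      hpd j)).integrable_of_hasCompactSupport hwc.mul_right
  have hi2 : Integrable fun y =>
      w y * (|dilateDet τ (-a⁻¹) y| * partialDeriv i ψ (dilate τ (-a⁻¹) y)) :=
    (hw.continuous.mul (hdet.mul hψS)).integrable_of_hasCompactSupport hwc.mul_right
  simp only [smul_eq_mul, mul_sub]
  rw [integral_sub hi1 hi2, e1, e2, ← e3]
  have e5 : ∫ x, ψ x * partialDeriv i (fun z => w (dilate τ (-a) z)) x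
      = -∫ x, partialDeriv i ψ x * w (dilate τ (-a) x) := e4
  rw [e5]
  ring

/-- On the boundary the Jacobian contributes `a⁻¹`, while the derivative `1 - (a + 1) n ⊗ n`
multiplies the normal by `-a`. The product does not depend on `a`, so fields coming from different
reflections can cancel. -/
theorem IsNormalField.piola_normal_component (h : IsNormalField Ω r τ t) (ha : 0 < a)
    (hδ0 : 0 < δ) (i : Fin N) {y : RN N} (hy : y ∈ frontier Ω) :
    ∑ j, piola Ω τ a δ i ψ j y * partialDeriv j t y = -(ψ y * partialDeriv i t y) := by
  obtain ⟨n, hn, hn', hnt⟩ := h.fderiv_eq y hy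
  have hyl : y ∈ layer Ω (a * δ) := frontier_subset_layer (by positivity) hy
  have hpt : ∀ j, partialDeriv j t y = n j := by
    intro j
    rw [partialDeriv, hnt, EuclideanSpace.inner_single_right]
    simp
  have hdp : ∀ j, dilatePartial τ a i j y
      = (EuclideanSpace.single i (1 : ℝ) : RN N) j + (-a - 1) * (n i * n j) := by
    intro j
    rw [dilatePartial, fderiv_dilate h.contDiff, hn', EuclideanSpace.inner_single_right]
    simp
  have hnn : ∑ j, n j * n j = 1 := by
    have h1 : inner ℝ n n = (1 : ℝ) := by rw [real_inner_self_eq_norm_sq, hn]; norm_num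
    rw [PiLp.inner_apply] at h1
    simpa [pow_two] using h1
  have hsum : ∑ j, dilatePartial τ a i j y * n j = -(a * n i) := by
    simp only [hdp, add_mul, Finset.sum_add_distrib]
    have h1 : ∑ j, (EuclideanSpace.single i (1 : ℝ) : RN N) j * n j = n i := by
      simp
    have h2 : ∑ j, (-a - 1) * (n i * n j) * n j = (-a - 1) * n i * ∑ j, n j * n j := by
      rw [Finset.mul_sum]
      exact Finset.sum_congr rfl fun j _ => by ring
    rw [h1, h2, hnn]
    ring
  simp only [hpt, piola_apply hyl, h.dilateDet_frontier hy, h.dilate_eq_self hy, abs_neg,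
    abs_of_pos (inv_pos.2 ha)]
  have h3 : ∑ j, a⁻¹ * (ψ y * dilatePartial τ a i j y) * n j
      = a⁻¹ * ψ y * ∑ j, dilatePartial τ a i j y * n j := by
    rw [Finset.mul_sum]
    exact Finset.sum_congr rfl fun j _ => by ring
  rw [h3, hsum]
  field_simp

theorem IsNormalField.integral_outer_partialDeriv (h : IsNormalField Ω r τ t) (ha : 0 < a)
    (hδ : δ ≤ r) (haδ : a * δ ≤ r) (hψ : ContDiff ℝ ∞ ψ) (hc : HasCompactSupport ψ)
    (hs : tsupport ψ ⊆ layer Ω δ) (i : Fin N) (f : RN N → ℝ) :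
    ∫ x in outerLayer Ω δ, f (dilate τ (-a) x) * partialDeriv i ψ x
      = ∫ y in Ω, f y * ∑ j, partialDeriv j (piola Ω τ a δ i ψ j) y := by
  rw [h.setIntegral_outerLayer ha hδ haδ,
    setIntegral_eq_of_subset_of_forall_sdiff_eq_zero (s := innerLayer Ω (a * δ))
      h.isOpen.measurableSet inter_subset_left fun y hy => ?_]
  · refine setIntegral_congr_ae (h.isOpen_innerLayer _).measurableSet ?_
    filter_upwards [h.div_piola ha hδ haδ hψ hc hs i] with y hy hyl
    rw [hy hyl.2, (h.dilate_neg_inv_mem_layer ha hδ haδ hyl.2).2.2]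
    ring
  · rw [Finset.sum_eq_zero fun j _ => partialDeriv_eq_zero_of_notMem (fun h' =>
      hy.2 ⟨hy.1, h.tsupport_piola_layer ha hδ haδ hc hs i j h'⟩) j, mul_zero]

theorem IsNormalField.integral_outer_mul (h : IsNormalField Ω r τ t) (ha : 0 < a)
    (hδ : δ ≤ r) (haδ : a * δ ≤ r) (ψ : RN N → ℝ) (i : Fin N) (g : Fin N → RN N → ℝ) :
    ∫ x in outerLayer Ω δ, ∑ j, g j (dilate τ (-a) x) * (ψ x * dilatePartial τ a i j x)
      = ∫ y in Ω, ∑ j, g j y * piola Ω τ a δ i ψ j y := by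
  rw [h.setIntegral_outerLayer ha hδ haδ,
    setIntegral_eq_of_subset_of_forall_sdiff_eq_zero (s := innerLayer Ω (a * δ))
      h.isOpen.measurableSet inter_subset_left fun y hy => ?_]
  · refine setIntegral_congr_fun (h.isOpen_innerLayer _).measurableSet fun y hy => ?_
    simp only [(h.dilate_neg_inv_mem_layer ha hδ haδ hy.2).2.2, piola_apply hy.2, Finset.mul_sum]
    exact Finset.sum_congr rfl fun j _ => by ring
  · exact Finset.sum_eq_zero fun j _ => by
      rw [piola, indicator_of_notMem (fun h' => hy.2 ⟨hy.1, h'⟩), mul_zero]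

end Piola

/-! ### Gluing across the boundary -/

section Glue

variable {N : ℕ} {Ω : Set (RN N)} {r : ℝ} {τ : RN N → RN N} {t : RN N → ℝ}

open Classical in
/-- The function equal to `c f` in `Ω` and to the combination of two reflections of `f` with
coefficients `A` and `B` outside `Ω`. -/
noncomputable def glue (Ω : Set (RN N)) (τ : RN N → RN N) (c : ℝ) (A B f : RN N → ℝ) (x : RN N) :
    ℝ :=
  if x ∈ Ω then c * f x else A x * f (dilate τ (-1) x) + B x * f (dilate τ (-2) x)

theorem glue_inner {c : ℝ} {A B f : RN N → ℝ} {x : RN N} (hx : x ∈ Ω) :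
    glue Ω τ c A B f x = c * f x := if_pos hx

theorem glue_outer {c : ℝ} {A B f : RN N → ℝ} {x : RN N} (hx : x ∉ closure Ω) :
    glue Ω τ c A B f x = A x * f (dilate τ (-1) x) + B x * f (dilate τ (-2) x) :=
  if_neg fun h => hx (subset_closure h)

theorem IsNormalField.ae_mem_or (h : IsNormalField Ω r τ t) :
    ∀ᵐ x ∂(volume : Measure (RN N)), x ∈ Ω ∨ x ∉ closure Ω := by
  filter_upwards [measure_eq_zero_iff_ae_notMem.1 h.volume_frontier] with x hx
  by_contra hcon
  simp only [not_or, not_not] at hcon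
  exact hx ⟨hcon.2, fun hi => hcon.1 (interior_subset hi)⟩

theorem IsNormalField.setIntegral_layer_eq_add (h : IsNormalField Ω r τ t) {δ : ℝ} {F : RN N → ℝ}
    (hi : IntegrableOn F (innerLayer Ω δ) volume) (ho : IntegrableOn F (outerLayer Ω δ) volume) :
    ∫ x in layer Ω δ, F x = (∫ x in innerLayer Ω δ, F x) + ∫ x in outerLayer Ω δ, F x := by
  have hae : (layer Ω δ : Set (RN N)) =ᵐ[volume] (innerLayer Ω δ ∪ outerLayer Ω δ : Set (RN N)) := by
    filter_upwards [h.ae_mem_or] with x hx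
    refine propext ⟨fun hl => ?_, fun hl => ?_⟩
    · exact hx.elim (fun h1 => Or.inl ⟨h1, hl⟩) fun h1 => Or.inr ⟨hl, h1⟩
    · rcases hl with hl | hl
      · exact hl.2
      · exact hl.1
  rw [setIntegral_congr_set hae]
  refine setIntegral_union ?_ (isOpen_outerLayer Ω δ).measurableSet hi ho
  rw [Set.disjoint_left]
  exact fun x hx hx' => hx'.2 (subset_closure hx.1)

theorem eLpNorm_mul_le_of_bound {μ : Measure (RN N)} {A u : RN N → ℝ} {M : ℝ≥0} (p : ℝ≥0∞)
    (hM : ∀ᵐ x ∂μ, |A x| ≤ M) : eLpNorm (fun x => A x * u x) p μ ≤ M * eLpNorm u p μ := by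
  have h1 := eLpNorm_le_nnreal_smul_eLpNorm_of_ae_le_mul (p := p) (μ := μ)
    (f := fun x => A x * u x) (g := u) (c := M) ?_
  · exact h1
  · filter_upwards [hM] with x hx
    rw [nnnorm_mul]
    gcongr
    exact hx

theorem IsNormalField.exists_glue_bound (h : IsNormalField Ω r τ t) (c : ℝ) {A B : RN N → ℝ}
    (hA : Continuous A) (hB : Continuous B) : ∃ C : ℝ≥0, ∀ δ, 0 < δ → 2 * δ ≤ r →
      ∀ p : ℝ≥0∞, 1 ≤ p → ∀ f : RN N → ℝ,
      AEStronglyMeasurable f (volume.restrict (innerLayer Ω (2 * δ))) →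
      AEStronglyMeasurable (glue Ω τ c A B f) (volume.restrict (layer Ω δ)) ∧
      eLpNorm (glue Ω τ c A B f) p (volume.restrict (layer Ω δ))
        ≤ C * eLpNorm f p (volume.restrict (innerLayer Ω (2 * δ))) := by
  obtain ⟨MA, -, hMA⟩ := exists_bound_of_isBounded hA (h.isBounded_layer r)
  obtain ⟨MB, -, hMB⟩ := exists_bound_of_isBounded hB (h.isBounded_layer r)
  obtain ⟨M₁, hM₁⟩ := h.exists_eLpNorm_dilate_le (a := 1) one_pos
  obtain ⟨M₂, hM₂⟩ := h.exists_eLpNorm_dilate_le (a := 2) two_pos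
  refine ⟨‖c‖₊ + (MA * M₁ + MB * M₂), fun δ hδ hδr p hp f hf => ?_⟩
  have hδr' : δ ≤ r := by linarith
  have hsub : innerLayer Ω δ ⊆ innerLayer Ω (2 * δ) :=
    inter_subset_inter_right _ (layer_mono (by linarith))
  have hres : volume.restrict (innerLayer Ω δ) ≤ volume.restrict (innerLayer Ω (2 * δ)) :=
    Measure.restrict_mono_set _ hsub
  obtain ⟨m1, b1⟩ := hM₁ δ hδr' (by linarith) p hp f (by rw [one_mul]; exact hf.mono_measure hres)
  obtain ⟨m2, b2⟩ := hM₂ δ hδr' hδr p hp f hf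
  rw [one_mul] at b1
  have hΩm : MeasurableSet Ω := h.isOpen.measurableSet
  have hOm : MeasurableSet (closure Ω)ᶜ := isClosed_closure.measurableSet.compl
  have hrΩ : (volume.restrict (layer Ω δ)).restrict Ω = volume.restrict (innerLayer Ω δ) :=
    Measure.restrict_restrict hΩm
  have hrO : (volume.restrict (layer Ω δ)).restrict (closure Ω)ᶜ
      = volume.restrict (outerLayer Ω δ) := by
    rw [Measure.restrict_restrict hOm, inter_comm]; rfl
  set u : RN N → ℝ := fun x => c * f x with hu
  set v₁ : RN N → ℝ := fun x => A x * f (dilate τ (-1) x) with hv₁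
  set v₂ : RN N → ℝ := fun x => B x * f (dilate τ (-2) x) with hv₂
  have hum : AEStronglyMeasurable u (volume.restrict (innerLayer Ω δ)) :=
    (hf.mono_measure hres).const_mul c
  have hv₁m : AEStronglyMeasurable v₁ (volume.restrict (outerLayer Ω δ)) :=
    hA.aestronglyMeasurable.mul m1
  have hv₂m : AEStronglyMeasurable v₂ (volume.restrict (outerLayer Ω δ)) :=
    hB.aestronglyMeasurable.mul m2
  have hae : glue Ω τ c A B f =ᵐ[volume.restrict (layer Ω δ)]
      Ω.indicator u + (closure Ω)ᶜ.indicator (v₁ + v₂) := by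
    filter_upwards [ae_restrict_of_ae h.ae_mem_or] with x hx
    rcases hx with hx | hx
    · have : x ∉ (closure Ω)ᶜ := fun h' => h' (subset_closure hx)
      simp [glue_inner hx, hx, this, hu, indicator]
    · have : x ∉ Ω := fun h' => hx (subset_closure h')
      simp [glue_outer hx, hx, this, hv₁, hv₂, indicator]
  have hi1 : AEStronglyMeasurable (Ω.indicator u) (volume.restrict (layer Ω δ)) := by
    rw [aestronglyMeasurable_indicator_iff hΩm, hrΩ]; exact hum
  have hi2 : AEStronglyMeasurable ((closure Ω)ᶜ.indicator (v₁ + v₂))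
      (volume.restrict (layer Ω δ)) := by
    rw [aestronglyMeasurable_indicator_iff hOm, hrO]; exact hv₁m.add hv₂m
  refine ⟨(hi1.add hi2).congr hae.symm, ?_⟩
  rw [eLpNorm_congr_ae hae]
  refine (eLpNorm_add_le hi1 hi2 hp).trans ?_
  rw [eLpNorm_indicator_eq_eLpNorm_restrict hΩm, eLpNorm_indicator_eq_eLpNorm_restrict hOm,
    hrΩ, hrO, ENNReal.coe_add, ENNReal.coe_add, ENNReal.coe_mul, ENNReal.coe_mul, add_mul, add_mul]
  have hout : ∀ᵐ x ∂(volume.restrict (outerLayer Ω δ)), x ∈ layer Ω r := by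
    filter_upwards [ae_restrict_mem (isOpen_outerLayer Ω δ).measurableSet] with x hx
      using layer_mono hδr' hx.1
  refine add_le_add ?_ ((eLpNorm_add_le hv₁m hv₂m hp).trans (add_le_add ?_ ?_))
  · refine (eLpNorm_mul_le_of_bound p (M := ‖c‖₊) (ae_of_all _ fun x => ?_)).trans ?_
    · simp
    · gcongr
  · refine (eLpNorm_mul_le_of_bound p (M := MA) ?_).trans ?_
    · filter_upwards [hout] with x hx using hMA x hx
    · rw [mul_assoc]
      gcongr
      exact b1.trans (by gcongr)
  · refine (eLpNorm_mul_le_of_bound p (M := MB) ?_).trans ?_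
    · filter_upwards [hout] with x hx using hMB x hx
    · rw [mul_assoc]
      gcongr

theorem IsNormalField.integrableOn_dilate (h : IsNormalField Ω r τ t) {a δ : ℝ} (ha : 0 < a)
    (hδ : δ ≤ r) (haδ : a * δ ≤ r) {f : RN N → ℝ} (hf : IntegrableOn f Ω volume) :
    IntegrableOn (fun x => f (dilate τ (-a) x)) (outerLayer Ω δ) volume := by
  obtain ⟨M, hM⟩ := h.exists_eLpNorm_dilate_le ha
  have hf' : IntegrableOn f (innerLayer Ω (a * δ)) volume := hf.mono_set inter_subset_left
  obtain ⟨h1, h2⟩ := hM δ hδ haδ 1 le_rfl f hf'.aestronglyMeasurable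
  refine memLp_one_iff_integrable.1 ⟨h1, h2.trans_lt ?_⟩
  exact ENNReal.mul_lt_top ENNReal.coe_lt_top (memLp_one_iff_integrable.2 hf').2

theorem IsNormalField.integrableOn_glue (h : IsNormalField Ω r τ t) (c : ℝ) {A B : RN N → ℝ}
    (hA : Continuous A) (hB : Continuous B) {δ : ℝ} (hδ : 0 < δ) (hδr : 2 * δ ≤ r)
    {f : RN N → ℝ} (hf : IntegrableOn f Ω volume) :
    IntegrableOn (glue Ω τ c A B f) (layer Ω δ) volume := by
  obtain ⟨M, hM⟩ := h.exists_glue_bound c hA hB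
  have hf' : IntegrableOn f (innerLayer Ω (2 * δ)) volume := hf.mono_set inter_subset_left
  obtain ⟨h1, h2⟩ := hM δ hδ hδr 1 le_rfl f hf'.aestronglyMeasurable
  refine memLp_one_iff_integrable.1 ⟨h1, h2.trans_lt ?_⟩
  exact ENNReal.mul_lt_top ENNReal.coe_lt_top (memLp_one_iff_integrable.2 hf').2

/-- The `i`-th weak derivative of a glued function. -/
noncomputable def glueDeriv (Ω : Set (RN N)) (τ : RN N → RN N) (c : ℝ) (A B f : RN N → ℝ)
    (g : Fin N → RN N → ℝ) (i : Fin N) (x : RN N) : ℝ :=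
  glue Ω τ 0 (partialDeriv i A) (partialDeriv i B) f x
    + ∑ j, glue Ω τ (if j = i then c else 0) (fun z => A z * dilatePartial τ 1 i j z)
        (fun z => B z * dilatePartial τ 2 i j z) (g j) x

theorem setIntegral_inner_eq {δ : ℝ} (hΩ : IsOpen Ω) {φ : RN N → ℝ} (hs : tsupport φ ⊆ layer Ω δ)
    (f : RN N → ℝ) : ∫ x in innerLayer Ω δ, f x * φ x = ∫ x in Ω, f x * φ x := by
  refine (setIntegral_eq_of_subset_of_forall_sdiff_eq_zero hΩ.measurableSet
    inter_subset_left fun x hx => ?_).symm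
  rw [image_eq_zero_of_notMem_tsupport fun h => hx.2 ⟨hx.1, hs h⟩, mul_zero]

/-- The inner term and the two pulled-back outer terms are tested together on `Ω` with the single
field `Q + P1 + P2`, which `hAB` makes tangential on the boundary. Variable coefficients are allowed
so that the lemma can be applied again to its own output. -/
theorem IsNormalField.hasWeakDeriv_glue (h : IsNormalField Ω r τ t) {c δ : ℝ} {A B : RN N → ℝ}
    (hA : ContDiff ℝ ∞ A) (hB : ContDiff ℝ ∞ B) (hAB : ∀ y ∈ frontier Ω, A y + B y = c)
    (hδ : 0 < δ) (hδr : 2 * δ ≤ r) {f : RN N → ℝ} {g : Fin N → RN N → ℝ}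
    (hf : IntegrableOn f Ω volume) (hg : ∀ j, IntegrableOn (g j) Ω volume)
    (hw : ∀ j, HasWeakDeriv Ω (fun _ : Fin 1 => j) f (g j)) (i : Fin N) :
    HasWeakDeriv (layer Ω δ) (fun _ : Fin 1 => i) (glue Ω τ c A B f)
      (glueDeriv Ω τ c A B f g i) := by
  have hδ1 : δ ≤ r := by linarith
  have hδ1' : 1 * δ ≤ r := by linarith
  have hD := fun a j => contDiff_dilatePartial h.contDiff a i j
  have hG : IntegrableOn (glueDeriv Ω τ c A B f g i) (layer Ω δ) volume := by
    refine (h.integrableOn_glue 0 (contDiff_partialDeriv hA i).continuous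
      (contDiff_partialDeriv hB i).continuous hδ hδr hf).add (integrable_finsetSum _ fun j _ => ?_)
    exact h.integrableOn_glue _ (hA.mul (hD 1 j)).continuous (hB.mul (hD 2 j)).continuous hδ hδr
      (hg j)
  have hF := h.integrableOn_glue c hA.continuous hB.continuous hδ hδr hf
  refine hasWeakDeriv_one_iff.2 ⟨hF.locallyIntegrableOn, hG.locallyIntegrableOn,
    fun φ hφ hc hs => ?_⟩
  set ψA : RN N → ℝ := fun x => A x * φ x with hψA
  set ψB : RN N → ℝ := fun x => B x * φ x with hψB
  have hψAd : ContDiff ℝ ∞ ψA := hA.mul hφ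
  have hψBd : ContDiff ℝ ∞ ψB := hB.mul hφ
  have hψAc : HasCompactSupport ψA := hc.mul_left
  have hψBc : HasCompactSupport ψB := hc.mul_left
  have hψAs : tsupport ψA ⊆ layer Ω δ := tsupport_mul_subset_right.trans hs
  have hψBs : tsupport ψB ⊆ layer Ω δ := tsupport_mul_subset_right.trans hs
  set P1 := piola Ω τ 1 δ i ψA with hP1
  set P2 := piola Ω τ 2 δ i ψB with hP2
  have hP1d := h.contDiff_piola one_pos hδ1 hδ1' hψAd hψAc hψAs i
  have hP2d := h.contDiff_piola two_pos hδ1 hδr hψBd hψBc hψBs i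
  have hP1c := h.hasCompactSupport_piola one_pos hδ1 hδ1' hψAc i
  have hP2c := h.hasCompactSupport_piola two_pos hδ1 hδr hψBc i
  have hP1s := h.tsupport_piola_layer one_pos hδ1 hδ1' hψAc hψAs i
  have hP2s := h.tsupport_piola_layer two_pos hδ1 hδr hψBc hψBs i
  set Q : Fin N → RN N → ℝ := fun j x => (if j = i then c else 0) * φ x with hQ
  have hQd : ∀ j, ContDiff ℝ ∞ (Q j) := fun j => contDiff_const.mul hφ
  have hQc : ∀ j, HasCompactSupport (Q j) := fun j => hc.mul_left
  have hQs : ∀ j, tsupport (Q j) ⊆ layer Ω r := fun j =>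
    (tsupport_mul_subset_right.trans hs).trans (layer_mono hδ1)
  have key := h.integral_mul_div (V := fun j x => Q j x + P1 j x + P2 j x)
    (fun j => ((hQd j).add (hP1d j)).add (hP2d j))
    (fun j => ((hQc j).add (hP1c j)).add (hP2c j))
    (fun j => ?_) (fun y hy => ?_) hf hg hw
  rotate_left
  · refine (closure_mono (Function.support_add _ _)).trans ?_
    rw [closure_union]
    refine union_subset ((closure_mono (Function.support_add _ _)).trans ?_)
      ((hP2s j).trans (layer_mono hδr))
    rw [closure_union]
    exact union_subset (hQs j) ((hP1s j).trans (layer_mono hδ1'))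
  · simp only [add_mul, Finset.sum_add_distrib]
    rw [h.piola_normal_component one_pos hδ i hy, h.piola_normal_component two_pos hδ i hy]
    have h1 : ∑ j, Q j y * partialDeriv j t y = c * φ y * partialDeriv i t y := by
      rw [Finset.sum_eq_single i (fun j _ hj => by simp [hQ, hj]) (by simp)]
      simp [hQ]
    rw [h1, ← hAB y hy]
    simp only [hψA, hψB]
    ring
  have hRf : ∀ u : RN N → ℝ, IntegrableOn u Ω volume → ∀ v : RN N → ℝ, Continuous v →
      HasCompactSupport v → IntegrableOn (fun x => u (dilate τ (-1) x) * v x)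
        (outerLayer Ω δ) volume ∧ IntegrableOn (fun x => u (dilate τ (-2) x) * v x)
        (outerLayer Ω δ) volume := fun u hu v hv hvc =>
    ⟨integrable_mul_of_hasCompactSupport (h.integrableOn_dilate one_pos hδ1 hδ1' hu) hv hvc,
      integrable_mul_of_hasCompactSupport (h.integrableOn_dilate two_pos hδ1 hδr hu) hv hvc⟩
  have hsplit : ∀ u : RN N → ℝ, IntegrableOn u (layer Ω δ) volume → ∀ v : RN N → ℝ,
      Continuous v → HasCompactSupport v → ∫ x in layer Ω δ, u x * v x
        = (∫ x in innerLayer Ω δ, u x * v x) + ∫ x in outerLayer Ω δ, u x * v x := by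
    intro u hu v hv hvc
    have hi : IntegrableOn (fun x => u x * v x) (layer Ω δ) volume :=
      integrable_mul_of_hasCompactSupport hu hv hvc
    exact h.setIntegral_layer_eq_add (hi.mono_set inter_subset_right)
      (hi.mono_set inter_subset_left)
  have hdφ := contDiff_partialDeriv hφ i
  have hdφc := hasCompactSupport_partialDeriv hc i
  have hinc : ∀ u : RN N → ℝ, ∀ v : RN N → ℝ, tsupport v ⊆ layer Ω δ → ∀ w : RN N → ℝ,
      (∀ x ∈ Ω, w x = u x) → ∫ x in innerLayer Ω δ, w x * v x = ∫ x in Ω, u x * v x := by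
    intro u v hv w hwu
    rw [← setIntegral_inner_eq h.isOpen hv]
    refine setIntegral_congr_fun (h.isOpen_innerLayer δ).measurableSet fun x hx => ?_
    simp only [hwu x hx.1]
  -- The product rule `A ∂ᵢφ = ∂ᵢ(A φ) - (∂ᵢA) φ` prepares the Piola transform of `A φ eᵢ`; the
  -- correction terms match those with `∂ᵢA` and `∂ᵢB` in `glueDeriv`.
  have eF : ∫ x in layer Ω δ, glue Ω τ c A B f x * partialDeriv i φ x
      = (∫ x in Ω, c * f x * partialDeriv i φ x)
        + ((∫ x in outerLayer Ω δ, f (dilate τ (-1) x) * partialDeriv i ψA x)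
          + (∫ x in outerLayer Ω δ, f (dilate τ (-2) x) * partialDeriv i ψB x)
          - ((∫ x in outerLayer Ω δ, f (dilate τ (-1) x) * (partialDeriv i A x * φ x))
            + ∫ x in outerLayer Ω δ, f (dilate τ (-2) x) * (partialDeriv i B x * φ x))) := by
    rw [hsplit _ hF _ hdφ.continuous hdφc, hinc (fun x => c * f x) _
      ((tsupport_partialDeriv_subset i φ).trans hs) _ fun x hx => glue_inner hx]
    congr 1
    have j1 := (hRf f hf _ (contDiff_partialDeriv hψAd i).continuous
      (hasCompactSupport_partialDeriv hψAc i)).1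
    have j2 := (hRf f hf _ (contDiff_partialDeriv hψBd i).continuous
      (hasCompactSupport_partialDeriv hψBc i)).2
    have j3 := (hRf f hf (fun x => partialDeriv i A x * φ x)
      ((contDiff_partialDeriv hA i).mul hφ).continuous hc.mul_left).1
    have j4 := (hRf f hf (fun x => partialDeriv i B x * φ x)
      ((contDiff_partialDeriv hB i).mul hφ).continuous hc.mul_left).2
    rw [← integral_add' j1 j2, ← integral_add' j3 j4, ← integral_sub' (j1.add j2) (j3.add j4)]
    refine setIntegral_congr_fun (isOpen_outerLayer Ω δ).measurableSet fun x hx => ?_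
    simp only [glue_outer hx.2, hψA, hψB, Pi.add_apply, Pi.sub_apply]
    rw [partialDeriv_mul (hA.differentiable (by simp) x) (hφ.differentiable (by simp) x),
      partialDeriv_mul (hB.differentiable (by simp) x) (hφ.differentiable (by simp) x)]
    ring
  have eG : ∫ x in layer Ω δ, glueDeriv Ω τ c A B f g i x * φ x
      = (∫ x in Ω, c * g i x * φ x)
        + ((∫ x in outerLayer Ω δ, f (dilate τ (-1) x) * (partialDeriv i A x * φ x))
          + (∫ x in outerLayer Ω δ, f (dilate τ (-2) x) * (partialDeriv i B x * φ x))
          + ((∫ x in outerLayer Ω δ,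
              ∑ j, g j (dilate τ (-1) x) * (ψA x * dilatePartial τ 1 i j x))
            + ∫ x in outerLayer Ω δ,
              ∑ j, g j (dilate τ (-2) x) * (ψB x * dilatePartial τ 2 i j x))) := by
    rw [hsplit _ hG _ hφ.continuous hc, hinc (fun x => c * g i x) _ hs _ fun x hx => ?_]
    · congr 1
      have j3 := (hRf f hf (fun x => partialDeriv i A x * φ x)
        ((contDiff_partialDeriv hA i).mul hφ).continuous hc.mul_left).1
      have j4 := (hRf f hf (fun x => partialDeriv i B x * φ x)
        ((contDiff_partialDeriv hB i).mul hφ).continuous hc.mul_left).2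
      have j1 : IntegrableOn (fun x => ∑ j, g j (dilate τ (-1) x) *
          (ψA x * dilatePartial τ 1 i j x)) (outerLayer Ω δ) volume :=
        integrable_finsetSum _ fun j _ => (hRf (g j) (hg j)
          (fun x => ψA x * dilatePartial τ 1 i j x) (hψAd.mul (hD 1 j)).continuous
          hψAc.mul_right).1
      have j2 : IntegrableOn (fun x => ∑ j, g j (dilate τ (-2) x) *
          (ψB x * dilatePartial τ 2 i j x)) (outerLayer Ω δ) volume :=
        integrable_finsetSum _ fun j _ => (hRf (g j) (hg j)
          (fun x => ψB x * dilatePartial τ 2 i j x) (hψBd.mul (hD 2 j)).continuous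
          hψBc.mul_right).2
      rw [← integral_add' j3 j4, ← integral_add' j1 j2, ← integral_add' (j3.add j4) (j1.add j2)]
      refine setIntegral_congr_fun (isOpen_outerLayer Ω δ).measurableSet fun x hx => ?_
      simp only [glueDeriv, glue_outer hx.2, hψA, hψB, Pi.add_apply]
      rw [← Finset.sum_add_distrib, add_mul, Finset.sum_mul]
      congr 1
      · ring
      · exact Finset.sum_congr rfl fun j _ => by ring
    · rw [glueDeriv, glue_inner hx, Finset.sum_eq_single i (fun j _ hj => by
        rw [glue_inner hx, if_neg hj, zero_mul]) (by simp), glue_inner hx, if_pos rfl]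
      ring
  have eK1 : ∫ x in Ω, f x * ∑ j, partialDeriv j (fun x => Q j x + P1 j x + P2 j x) x
      = (∫ x in Ω, c * f x * partialDeriv i φ x)
        + ((∫ x in Ω, f x * ∑ j, partialDeriv j (P1 j) x)
          + ∫ x in Ω, f x * ∑ j, partialDeriv j (P2 j) x) := by
    have hsum : ∀ P : Fin N → RN N → ℝ, (∀ j, ContDiff ℝ ∞ (P j)) →
        (∀ j, HasCompactSupport (P j)) →
        IntegrableOn (fun x => f x * ∑ j, partialDeriv j (P j) x) Ω volume := by
      intro P hPd hPc
      simp only [Finset.mul_sum]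
      exact integrable_finsetSum _ fun j _ => integrable_mul_of_hasCompactSupport hf
        (contDiff_partialDeriv (hPd j) j).continuous (hasCompactSupport_partialDeriv (hPc j) j)
    have j0 : IntegrableOn (fun x => c * f x * partialDeriv i φ x) Ω volume :=
      integrable_mul_of_hasCompactSupport (hf.const_mul c) hdφ.continuous hdφc
    rw [← integral_add' (hsum P1 hP1d hP1c) (hsum P2 hP2d hP2c),
      ← integral_add' j0 ((hsum P1 hP1d hP1c).add (hsum P2 hP2d hP2c))]
    refine setIntegral_congr_fun h.isOpen.measurableSet fun x _ => ?_
    have d1 : ∀ j, partialDeriv j (fun x => Q j x + P1 j x + P2 j x) x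
        = partialDeriv j (Q j) x + partialDeriv j (P1 j) x + partialDeriv j (P2 j) x := by
      intro j
      have q1 := (hQd j).differentiable (by simp) x
      have q2 := (hP1d j).differentiable (by simp) x
      have q3 := (hP2d j).differentiable (by simp) x
      have q4 : fderiv ℝ (fun x => Q j x + P1 j x + P2 j x) x = _ :=
        ((q1.hasFDerivAt.add q2.hasFDerivAt).add q3.hasFDerivAt).fderiv
      rw [partialDeriv, q4]
      rfl
    have d2 : ∑ j, partialDeriv j (Q j) x = c * partialDeriv i φ x := by
      have d3 : ∀ j, partialDeriv j (Q j) x = (if j = i then c else 0) * partialDeriv j φ x := by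
        intro j
        simp only [partialDeriv, hQ]
        rw [fderiv_const_mul (hφ.differentiable (by simp) x)]
        rfl
      simp only [d3]
      rw [Finset.sum_eq_single i (fun j _ hj => by rw [if_neg hj, zero_mul]) (by simp), if_pos rfl]
    simp only [d1, Finset.sum_add_distrib, d2, Pi.add_apply]
    ring
  have eK2 : ∫ x in Ω, ∑ j, g j x * (Q j x + P1 j x + P2 j x)
      = (∫ x in Ω, c * g i x * φ x)
        + ((∫ x in Ω, ∑ j, g j x * P1 j x) + ∫ x in Ω, ∑ j, g j x * P2 j x) := by
    have hsum : ∀ P : Fin N → RN N → ℝ, (∀ j, ContDiff ℝ ∞ (P j)) →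
        (∀ j, HasCompactSupport (P j)) →
        IntegrableOn (fun x => ∑ j, g j x * P j x) Ω volume := fun P hPd hPc =>
      integrable_finsetSum _ fun j _ => integrable_mul_of_hasCompactSupport (hg j)
        (hPd j).continuous (hPc j)
    have j0 : IntegrableOn (fun x => c * g i x * φ x) Ω volume :=
      integrable_mul_of_hasCompactSupport ((hg i).const_mul c) hφ.continuous hc
    rw [← integral_add' (hsum P1 hP1d hP1c) (hsum P2 hP2d hP2c),
      ← integral_add' j0 ((hsum P1 hP1d hP1c).add (hsum P2 hP2d hP2c))]
    refine setIntegral_congr_fun h.isOpen.measurableSet fun x _ => ?_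
    have d2 : ∑ j, g j x * Q j x = c * g i x * φ x := by
      rw [Finset.sum_eq_single i (fun j _ hj => by simp [hQ, hj]) (by simp)]
      simp only [hQ, if_true]
      ring
    simp only [mul_add, Finset.sum_add_distrib, d2, Pi.add_apply]
    ring
  rw [eK1, eK2, ← h.integral_outer_partialDeriv one_pos hδ1 hδ1' hψAd hψAc hψAs i f,
    ← h.integral_outer_partialDeriv two_pos hδ1 hδr hψBd hψBc hψBs i f,
    ← h.integral_outer_mul one_pos hδ1 hδ1' ψA i g,
    ← h.integral_outer_mul two_pos hδ1 hδr ψB i g] at key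
  rw [eF, eG]
  linarith

end Glue

/-! ### Sobolev norms -/

section Sobolev

variable {N : ℕ}

theorem HasWeakDeriv.add_one {U : Set (RN N)} {I : Fin 1 → Fin N} {f g f' g' : RN N → ℝ}
    (h : HasWeakDeriv U I f g) (h' : HasWeakDeriv U I f' g') :
    HasWeakDeriv U I (f + f') (g + g') := by
  rw [hasWeakDeriv_one_iff] at h h' ⊢
  refine ⟨h.1.add h'.1, h.2.1.add h'.2.1, fun φ hφ hc hs => ?_⟩
  have hd := (contDiff_partialDeriv hφ (I 0)).continuous
  have hdc := hasCompactSupport_partialDeriv hc (I 0)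
  have hds := (tsupport_partialDeriv_subset (I 0) φ).trans hs
  simp only [Pi.add_apply, add_mul]
  rw [integral_add (h.1.integrableOn_mul_test hd hdc hds) (h'.1.integrableOn_mul_test hd hdc hds),
    integral_add (h.2.1.integrableOn_mul_test hφ.continuous hc hs)
      (h'.2.1.integrableOn_mul_test hφ.continuous hc hs), h.2.2 φ hφ hc hs, h'.2.2 φ hφ hc hs]
  ring

theorem hasWeakDeriv_zero_one (U : Set (RN N)) (I : Fin 1 → Fin N) :
    HasWeakDeriv U I (0 : RN N → ℝ) 0 := by
  have h0 : LocallyIntegrableOn (0 : RN N → ℝ) U volume :=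
    (locallyIntegrable_zero).locallyIntegrableOn U
  exact hasWeakDeriv_one_iff.2 ⟨h0, h0, fun φ _ _ _ => by simp⟩

theorem HasWeakDeriv.sum_one {ι : Type*} (s : Finset ι) {U : Set (RN N)} {I : Fin 1 → Fin N}
    {f g : ι → RN N → ℝ} (h : ∀ j, HasWeakDeriv U I (f j) (g j)) :
    HasWeakDeriv U I (∑ j ∈ s, f j) (∑ j ∈ s, g j) := by
  classical
  induction s using Finset.induction_on with
  | empty => exact hasWeakDeriv_zero_one U I
  | insert a s ha ih =>
    rw [Finset.sum_insert ha, Finset.sum_insert ha]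
    exact (h a).add_one ih

theorem HasWeakDeriv.congr_left {m : ℕ} {U : Set (RN N)} {I : Fin m → Fin N} {f f' g : RN N → ℝ}
    (h : HasWeakDeriv U I f g) (hf : IntegrableOn f U volume) (hU : MeasurableSet U)
    (he : EqOn f f' U) : HasWeakDeriv U I f' g := by
  refine ⟨((integrableOn_congr_fun he hU).1 hf).locallyIntegrableOn, h.2.1,
    fun φ hφ hc hs => ?_⟩
  rw [← h.2.2 φ hφ hc hs]
  refine setIntegral_congr_fun hU fun x hx => ?_
  simp only [he hx]

theorem MemSobolev.mono_order {U : Set (RN N)} {k m : ℕ} (hmk : m ≤ k) {p : ℝ≥0∞} {f : RN N → ℝ}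
    (h : MemSobolev U k p f) : MemSobolev U m p f :=
  ⟨h.1, fun l hl I => h.2 l (hl.trans hmk) I⟩

theorem MemSobolev.mono_set {U V : Set (RN N)} {k : ℕ} {p : ℝ≥0∞} {f : RN N → ℝ}
    (h : MemSobolev V k p f) (hV : IsOpen V) (hUV : U ⊆ V) : MemSobolev U k p f := by
  refine ⟨h.1.mono_measure (Measure.restrict_mono_set _ hUV), fun m hm I => ?_⟩
  obtain ⟨g, hg, hgp⟩ := h.2 m hm I
  exact ⟨g, hg.mono hV hUV, hgp.mono_measure (Measure.restrict_mono_set _ hUV)⟩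

theorem MemSobolev.sobolevNorm_lt_top {U : Set (RN N)} {k : ℕ} {p : ℝ≥0∞} {f : RN N → ℝ}
    (h : MemSobolev U k p f) : sobolevNorm U k p f < ⊤ := by
  refine ENNReal.sum_lt_top.2 fun m hm => ENNReal.sum_lt_top.2 fun I _ => ?_
  obtain ⟨g, hg, hgp⟩ := h.2 m (Nat.lt_succ_iff.1 (Finset.mem_range.1 hm)) I
  exact (iInf₂_le g hg).trans_lt hgp.2

theorem sobolevNorm_mono_order {U : Set (RN N)} {k m : ℕ} (hmk : m ≤ k) (p : ℝ≥0∞)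
    (f : RN N → ℝ) : sobolevNorm U m p f ≤ sobolevNorm U k p f :=
  Finset.sum_le_sum_of_subset (Finset.range_mono (by omega))

theorem HasWeakDeriv.eLpNorm_le_sobolevNorm {U : Set (RN N)} {k m : ℕ} (hmk : m ≤ k)
    {I : Fin m → Fin N} {f g : RN N → ℝ} (h : HasWeakDeriv U I f g) (hU : IsOpen U) (p : ℝ≥0∞) :
    eLpNorm g p (volume.restrict U) ≤ sobolevNorm U k p f := by
  rw [← h.iInf_eLpNorm_eq hU p]
  refine le_trans ?_ (Finset.single_le_sum
    (f := fun m => ∑ I : Fin m → Fin N, ⨅ (g : RN N → ℝ) (_ : HasWeakDeriv U I f g),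
      eLpNorm g p (volume.restrict U)) (fun _ _ => zero_le)
    (Finset.mem_range.2 (Nat.lt_succ_of_le hmk)))
  exact Finset.single_le_sum
    (f := fun I : Fin m → Fin N => ⨅ (g : RN N → ℝ) (_ : HasWeakDeriv U I f g),
      eLpNorm g p (volume.restrict U)) (fun _ _ => zero_le) (Finset.mem_univ I)

end Sobolev

/-! ### The estimate for the reflection -/

section Estimate

variable {N : ℕ} {Ω : Set (RN N)} {r : ℝ} {τ : RN N → RN N} {t : RN N → ℝ}

theorem IsNormalField.exists_glueDeriv_bound (h : IsNormalField Ω r τ t) (c : ℝ)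
    {A B : RN N → ℝ} (hA : ContDiff ℝ ∞ A) (hB : ContDiff ℝ ∞ B) (i : Fin N) :
    ∃ C : ℝ≥0, ∀ δ, 0 < δ → 2 * δ ≤ r → ∀ p : ℝ≥0∞, 1 ≤ p →
      ∀ (f : RN N → ℝ) (g : Fin N → RN N → ℝ) (S : ℝ≥0∞),
      AEStronglyMeasurable f (volume.restrict (innerLayer Ω (2 * δ))) →
      (∀ j, AEStronglyMeasurable (g j) (volume.restrict (innerLayer Ω (2 * δ)))) →
      eLpNorm f p (volume.restrict (innerLayer Ω (2 * δ))) ≤ S →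
      (∀ j, eLpNorm (g j) p (volume.restrict (innerLayer Ω (2 * δ))) ≤ S) →
      AEStronglyMeasurable (glueDeriv Ω τ c A B f g i) (volume.restrict (layer Ω δ)) ∧
      eLpNorm (glueDeriv Ω τ c A B f g i) p (volume.restrict (layer Ω δ)) ≤ C * S := by
  have hD := fun a j => contDiff_dilatePartial h.contDiff a i j
  obtain ⟨C₀, hC₀⟩ := h.exists_glue_bound 0 (contDiff_partialDeriv hA i).continuous
    (contDiff_partialDeriv hB i).continuous
  choose C hC using fun j => h.exists_glue_bound (if j = i then c else 0)
    (hA.mul (hD 1 j)).continuous (hB.mul (hD 2 j)).continuous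
  refine ⟨C₀ + ∑ j, C j, fun δ hδ hδr p hp f g S hf hg hfS hgS => ?_⟩
  obtain ⟨m0, b0⟩ := hC₀ δ hδ hδr p hp f hf
  have hb := fun j => hC j δ hδ hδr p hp (g j) (hg j)
  have heq : glueDeriv Ω τ c A B f g i = glue Ω τ 0 (partialDeriv i A) (partialDeriv i B) f
      + ∑ j, glue Ω τ (if j = i then c else 0) (fun z => A z * dilatePartial τ 1 i j z)
        (fun z => B z * dilatePartial τ 2 i j z) (g j) := by
    funext x
    simp [glueDeriv]
  have hm := Finset.aestronglyMeasurable_sum Finset.univ fun j _ => (hb j).1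
  rw [heq]
  refine ⟨m0.add hm, (eLpNorm_add_le m0 hm hp).trans ?_⟩
  push_cast
  rw [add_mul, Finset.sum_mul]
  refine add_le_add (b0.trans (by gcongr)) ((eLpNorm_sum_le (fun j _ => (hb j).1) hp).trans ?_)
  exact Finset.sum_le_sum fun j _ => (hb j).2.trans (by gcongr; exact hgS j)

/-- The place where the weights matter for second derivatives: `3 - 2 = 1` handles tangential
directions and `3 * (-1) - 2 * (-2) = 1` the normal one. It is the boundary condition for gluing the
first derivatives. -/
theorem IsNormalField.reflection_coeff (h : IsNormalField Ω r τ t) (i j : Fin N) {y : RN N}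
    (hy : y ∈ frontier Ω) :
    3 * dilatePartial τ 1 i j y + -2 * dilatePartial τ 2 i j y = if j = i then 1 else 0 := by
  obtain ⟨n, -, hn', -⟩ := h.fderiv_eq y hy
  simp only [dilatePartial, fderiv_dilate h.contDiff, hn', EuclideanSpace.inner_single_right,
    PiLp.add_apply, PiLp.smul_apply, PiLp.single_apply, smul_eq_mul]
  ring

theorem glueDeriv_const (c a b : ℝ) (f : RN N → ℝ) (g : Fin N → RN N → ℝ) (i : Fin N) :
    glueDeriv Ω τ c (fun _ => a) (fun _ => b) f g i
      = ∑ j, glue Ω τ (if j = i then c else 0) (fun z => a * dilatePartial τ 1 i j z)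
        (fun z => b * dilatePartial τ 2 i j z) (g j) := by
  funext x
  rw [glueDeriv, Finset.sum_apply]
  have h0 : glue Ω τ 0 (partialDeriv i fun _ => a) (partialDeriv i fun _ => b) f x = 0 := by
    simp [glue, partialDeriv]
  rw [h0, zero_add]

/-- The restriction `m ≤ 2` stands behind the quantifier on `C`, so that constants can be chosen for
all orders and then summed. -/
theorem IsNormalField.exists_weakDeriv_bound (h : IsNormalField Ω r τ t) (m : ℕ)
    (I : Fin m → Fin N) : ∃ C : ℝ≥0, m ≤ 2 → ∀ δ, 0 < δ → 2 * δ ≤ r → ∀ p : ℝ≥0∞, 1 ≤ p →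
      ∀ f : RN N → ℝ, MemSobolev Ω m p f → ∃ g,
        HasWeakDeriv (layer Ω δ) I (glue Ω τ 1 (fun _ => 3) (fun _ => -2) f) g ∧
        AEStronglyMeasurable g (volume.restrict (layer Ω δ)) ∧
        eLpNorm g p (volume.restrict (layer Ω δ))
          ≤ C * sobolevNorm (innerLayer Ω (2 * δ)) m p f := by
  by_cases hm : m ≤ 2
  swap
  · exact ⟨0, fun h' => absurd h' hm⟩
  have hio := fun δ => h.isOpen_innerLayer (2 * δ)
  have hsub : ∀ δ, innerLayer Ω (2 * δ) ⊆ Ω := fun δ => inter_subset_left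
  have hres : ∀ (δ : ℝ) (u : RN N → ℝ) (p : ℝ≥0∞), MemLp u p (volume.restrict Ω) →
      AEStronglyMeasurable u (volume.restrict (innerLayer Ω (2 * δ))) := fun δ u p hu =>
    hu.1.mono_measure (Measure.restrict_mono_set _ (hsub δ))
  have hf0 : ∀ (k : ℕ) (δ : ℝ) (p : ℝ≥0∞) (f : RN N → ℝ), 1 ≤ p → MemLp f p (volume.restrict Ω) →
      eLpNorm f p (volume.restrict (innerLayer Ω (2 * δ)))
        ≤ sobolevNorm (innerLayer Ω (2 * δ)) k p f := by
    intro k δ p f hp hf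
    have hw : HasWeakDeriv Ω (fun l : Fin 0 => l.elim0) f f := hasWeakDeriv_zero_self
      (integrableOn_of_memLp h.isBounded hp hf).locallyIntegrableOn
    exact (hw.mono h.isOpen (hsub δ)).eLpNorm_le_sobolevNorm (Nat.zero_le k) (hio δ) p
  have h3 : ContDiff ℝ ∞ fun _ : RN N => (3 : ℝ) := contDiff_const
  have h2 : ContDiff ℝ ∞ fun _ : RN N => (-2 : ℝ) := contDiff_const
  have hfst : ∀ (δ : ℝ), 0 < δ → 2 * δ ≤ r → ∀ (f : RN N → ℝ) (g : Fin N → RN N → ℝ),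
      IntegrableOn f Ω volume → (∀ j, IntegrableOn (g j) Ω volume) →
      (∀ j, HasWeakDeriv Ω (fun _ : Fin 1 => j) f (g j)) → ∀ i,
      HasWeakDeriv (layer Ω δ) (fun _ : Fin 1 => i) (glue Ω τ 1 (fun _ => 3) (fun _ => -2) f)
        (glueDeriv Ω τ 1 (fun _ => 3) (fun _ => -2) f g i) := fun δ hδ hδr f g hf hg hw i =>
    h.hasWeakDeriv_glue h3 h2 (fun y _ => by norm_num) hδ hδr hf hg hw i
  interval_cases m
  · obtain ⟨C, hC⟩ := h.exists_glue_bound 1 h3.continuous h2.continuous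
    refine ⟨C, fun _ δ hδ hδr p hp f hf => ⟨glue Ω τ 1 (fun _ => 3) (fun _ => -2) f, ?_, ?_⟩⟩
    · exact hasWeakDeriv_zero_self (h.integrableOn_glue 1 h3.continuous h2.continuous hδ hδr
        (integrableOn_of_memLp h.isBounded hp hf.1)).locallyIntegrableOn
    · obtain ⟨m0, b0⟩ := hC δ hδ hδr p hp f (hres δ f p hf.1)
      exact ⟨m0, b0.trans (by gcongr; exact hf0 0 δ p f hp hf.1)⟩
  · obtain ⟨C, hC⟩ := h.exists_glueDeriv_bound 1 h3 h2 (I 0)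
    refine ⟨C, fun _ δ hδ hδr p hp f hf => ?_⟩
    choose g hg hgp using fun j => hf.2 1 le_rfl (fun _ => j)
    refine ⟨glueDeriv Ω τ 1 (fun _ => 3) (fun _ => -2) f g (I 0), ?_, ?_⟩
    · have hI : I = fun _ => I 0 := funext fun l => by rw [Subsingleton.elim l 0]
      rw [hI]
      exact hfst δ hδ hδr f g (integrableOn_of_memLp h.isBounded hp hf.1)
        (fun j => integrableOn_of_memLp h.isBounded hp (hgp j)) hg (I 0)
    · exact hC δ hδ hδr p hp f g _ (hres δ f p hf.1) (fun j => hres δ _ p (hgp j))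
        (hf0 1 δ p f hp hf.1) fun j =>
          ((hg j).mono h.isOpen (hsub δ)).eLpNorm_le_sobolevNorm le_rfl (hio δ) p
  · have hA := fun j => h3.mul (contDiff_dilatePartial h.contDiff 1 (I 0) j)
    have hB := fun j => h2.mul (contDiff_dilatePartial h.contDiff 2 (I 0) j)
    choose C hC using fun j => h.exists_glueDeriv_bound (if j = I 0 then 1 else 0) (hA j) (hB j)
      (I 1)
    refine ⟨∑ j, C j, fun _ δ hδ hδr p hp f hf => ?_⟩
    choose g hg hgp using fun j => hf.2 1 one_le_two (fun _ => j)
    choose gg hgg hggp using fun j l => hf.2 2 le_rfl ![j, l]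
    have hgi := fun j => integrableOn_of_memLp h.isBounded hp (hgp j)
    have hggi := fun j l => integrableOn_of_memLp h.isBounded hp (hggp j l)
    have hgw : ∀ j l, HasWeakDeriv Ω (fun _ : Fin 1 => l) (g j) (gg j l) := fun j l =>
      HasWeakDeriv.one_of_two (I := ![j, l]) (hg j) (hgg j l)
    have hfirst := hfst δ hδ hδr f g (integrableOn_of_memLp h.isBounded hp hf.1) hgi hg (I 0)
    -- For constant coefficients the term without derivatives of `f` drops out, so each first
    -- derivative is a sum of glued functions to which `hasWeakDeriv_glue` applies again.
    rw [glueDeriv_const] at hfirst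
    have hsecond := HasWeakDeriv.sum_one Finset.univ fun j => h.hasWeakDeriv_glue (hA j) (hB j)
      (fun y hy => h.reflection_coeff (I 0) j hy) hδ hδr (hgi j) (hggi j) (hgw j) (I 1)
    have hb := fun j => hC j δ hδ hδr p hp (g j) (gg j)
      (sobolevNorm (innerLayer Ω (2 * δ)) 2 p f) (hres δ _ p (hgp j))
      (fun l => hres δ _ p (hggp j l))
      (((hg j).mono h.isOpen (hsub δ)).eLpNorm_le_sobolevNorm one_le_two (hio δ) p)
      fun l => ((hgg j l).mono h.isOpen (hsub δ)).eLpNorm_le_sobolevNorm le_rfl (hio δ) p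
    refine ⟨_, hfirst.of_one_of_one hsecond,
      Finset.aestronglyMeasurable_sum Finset.univ fun j _ => (hb j).1,
      (eLpNorm_sum_le (fun j _ => (hb j).1) hp).trans ?_⟩
    push_cast
    rw [Finset.sum_mul]
    exact Finset.sum_le_sum fun j _ => (hb j).2

theorem IsTubularChart.existsUnique_normalCoord {p n : RN N → RN N} (h : IsTubularChart Ω r p n t)
    {δ₀ : ℝ} (hδ : δ₀ < r) {x : RN N} (hx : x ∈ tube Ω δ₀) :
    IsNormalCoord Ω δ₀ x (p x, t x) ∧ ∀ q, IsNormalCoord Ω δ₀ x q → q = (p x, t x) := by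
  have hx' : Metric.infDist x (frontier Ω) ≤ δ₀ := hx
  have hxr : Metric.infDist x (frontier Ω) < r := hx'.trans_lt hδ
  refine ⟨⟨h.foot_mem x hxr, ?_, ?_⟩, fun q hq => ?_⟩
  · exact abs_le.1 ((h.abs_eq x hxr).le.trans hx')
  · rw [← h.normal_eq x hxr]; exact h.eq_add x hxr
  · obtain ⟨h1, h2, h3⟩ := hq
    have h4 := h.unique q.1 h1 q.2 ((abs_le.2 h2).trans_lt hδ)
    rw [← h3] at h4
    exact Prod.ext h4.2.1.symm h4.2.2.symm

/-- The equality is pointwise, boundary included: there `t x = 0`, and both definitions take the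
reflected branch. -/
theorem IsTubularChart.reflectionExt_eq_glue {p n : RN N → RN N} (h : IsTubularChart Ω r p n t)
    {δ₀ : ℝ} (hδ : δ₀ < r) {x : RN N} (hx : x ∈ tube Ω δ₀) (hτ : τ x = t x • n x) (f : RN N → ℝ) :
    glue Ω τ 1 (fun _ => 3) (fun _ => -2) f x = reflectionExt Ω δ₀ f x := by
  have hxr : Metric.infDist x (frontier Ω) < r :=
    lt_of_le_of_lt (show Metric.infDist x (frontier Ω) ≤ δ₀ from hx) hδ
  obtain ⟨h1, h2⟩ := h.existsUnique_normalCoord hδ hx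
  have hex : ∃ q : RN N × ℝ, IsNormalCoord Ω δ₀ x q := ⟨_, h1⟩
  have hq := h2 _ hex.choose_spec
  rw [reflectionExt, dif_pos hex, hq, glue]
  have e0 := h.eq_add x hxr
  have e1 : dilate τ (-1) x = p x - t x • outwardNormal Ω (p x) := by
    rw [dilate, hτ, ← h.normal_eq x hxr]
    nth_rewrite 1 [e0]
    module
  have e2 : dilate τ (-2) x = p x - (2 * t x) • outwardNormal Ω (p x) := by
    rw [dilate, hτ, ← h.normal_eq x hxr]
    nth_rewrite 1 [e0]
    module
  by_cases hxΩ : x ∈ Ω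
  · rw [if_pos hxΩ, if_pos ((h.mem_iff x hxr).1 hxΩ), one_mul]
  · rw [if_neg hxΩ, if_neg (fun h' => hxΩ ((h.mem_iff x hxr).2 h')), e1, e2]
    ring

end Estimate

theorem proposition2p1 {N : ℕ} (hN : 1 ≤ N) (Ω : Set (RN N)) (hΩ : IsSmoothBoundedDomain Ω) :
    ∃ δ₀ : ℝ, 0 < δ₀ ∧
      (∀ x ∈ tube Ω δ₀, ∃! q : RN N × ℝ, IsNormalCoord Ω δ₀ x q) ∧
      ∀ k : ℕ, k ≤ 2 → ∀ p : ℝ≥0∞, 1 ≤ p →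
        ∃ C : ℝ≥0, ∀ δ : ℝ, 0 < δ → δ ≤ δ₀ →
          ∀ f : RN N → ℝ, MemSobolev Ω k p f →
            MemSobolev (interior (tube Ω δ)) k p (reflectionExt Ω δ₀ f) ∧
            sobolevNorm (interior (tube Ω δ)) k p (reflectionExt Ω δ₀ f)
              ≤ C * sobolevNorm (Ω ∩ interior (tube Ω (2 * δ))) k p f := by
  obtain ⟨r, foot, n, t, hchart⟩ := hΩ.exists_isTubularChart hN
  obtain ⟨τ, hfield, hτ⟩ := hchart.exists_isNormalField hΩ
  have hr := hchart.pos
  have hr4 : r / 4 < r := by linarith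
  -- The field `τ` is exact on the layer of width `r / 2`, and the second reflection doubles
  -- distances, so `2 * δ ≤ r / 2` is needed.
  refine ⟨r / 4, by linarith, fun x hx => ?_, fun k hk p hp => ?_⟩
  · obtain ⟨h1, h2⟩ := hchart.existsUnique_normalCoord hr4 hx
    exact ⟨_, h1, h2⟩
  choose C hC using fun m I => hfield.exists_weakDeriv_bound m I
  refine ⟨∑ m ∈ Finset.range (k + 1), ∑ I : Fin m → Fin N, C m I, fun δ hδ hδ0 f hf => ?_⟩
  have hδr : 2 * δ ≤ r / 2 := by linarith
  rw [hchart.interior_tube δ hδ (by linarith),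
    hchart.interior_tube (2 * δ) (by linarith) (by linarith)]
  change MemSobolev (layer Ω δ) k p _ ∧ sobolevNorm (layer Ω δ) k p _
    ≤ _ * sobolevNorm (innerLayer Ω (2 * δ)) k p f
  have hmeas : MeasurableSet (layer Ω δ) := (isOpen_layer Ω δ).measurableSet
  have heq : EqOn (glue Ω τ 1 (fun _ => 3) (fun _ => -2) f) (reflectionExt Ω (r / 4) f)
      (layer Ω δ) := by
    intro x hx
    have hx' : Metric.infDist x (frontier Ω) ≤ r / 4 := (mem_layer.1 hx).le.trans hδ0
    exact hchart.reflectionExt_eq_glue hr4 hx' (hτ x (layer_mono (by linarith) hx)) f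
  have hint : IntegrableOn (glue Ω τ 1 (fun _ => 3) (fun _ => -2) f) (layer Ω δ) volume :=
    hfield.integrableOn_glue 1 continuous_const continuous_const hδ hδr
      (integrableOn_of_memLp hΩ.isBounded hp hf.1)
  have hfin : sobolevNorm (innerLayer Ω (2 * δ)) k p f < ⊤ :=
    (hf.mono_set hΩ.isOpen inter_subset_left).sobolevNorm_lt_top
  have key : ∀ m ≤ k, ∀ I : Fin m → Fin N, ∃ g,
      HasWeakDeriv (layer Ω δ) I (reflectionExt Ω (r / 4) f) g ∧
      MemLp g p (volume.restrict (layer Ω δ)) ∧ eLpNorm g p (volume.restrict (layer Ω δ))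
        ≤ C m I * sobolevNorm (innerLayer Ω (2 * δ)) k p f := by
    intro m hm I
    obtain ⟨g, h1, h2, h3⟩ := hC m I (hm.trans hk) δ hδ hδr p hp f (hf.mono_order hm)
    have h4 := h3.trans (mul_le_mul_right (sobolevNorm_mono_order hm p f) (C m I : ℝ≥0∞))
    exact ⟨g, h1.congr_left hint hmeas heq,
      ⟨h2, h4.trans_lt (ENNReal.mul_lt_top ENNReal.coe_lt_top hfin)⟩, h4⟩
  refine ⟨⟨?_, fun m hm I => ?_⟩, ?_⟩
  -- A weak derivative of order zero agrees almost everywhere with the function itself, which gives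
  -- its own `L^p` membership.
  · obtain ⟨g, h1, h2, -⟩ := key 0 (Nat.zero_le k) fun l => l.elim0
    refine h2.ae_eq (h1.ae_eq (hasWeakDeriv_zero_self h1.1) (isOpen_layer Ω δ))
  · obtain ⟨g, h1, h2, -⟩ := key m hm I
    exact ⟨g, h1, h2⟩
  · push_cast
    rw [sobolevNorm, Finset.sum_mul]
    refine Finset.sum_le_sum fun m hm => ?_
    rw [Finset.sum_mul]
    refine Finset.sum_le_sum fun I _ => ?_
    obtain ⟨g, h1, -, h3⟩ := key m (Nat.lt_succ_iff.1 (Finset.mem_range.1 hm)) I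
    exact (iInf₂_le g h1).trans h3
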